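/- All algebras are commutative. A **positively elliptic algebra** is a non-zero graded $\mathbb{Q}$-algebra with a presentation $$H^*=\mathbb{Q}[x_1,\ldots,x_k]/(u_1,\ldots,u_k),$$ where each $x_i$ has a positive even degree $|x_i|$ and $u_1,\ldots,u_k$ is a regular sequence of homogeneous polynomials, of degrees $|u_1|,\ldots,|u_k|$. The presentation is a **pure model** if $|x_1|\le\cdots\le|x_k|$, $|u_1|\le\cdots\le|u_k|$, and no $u_i$ has a constant or linear term (it then follows that $|u_i|\ge 2|x_i|$ for all $i$). The **degree type** of a pure model is $(|x_1|,\ldots,|x_k|;|u_1|,\ldots,|u_k|)$. The **formal dimension** $\operatorname{fd}H^*$ is the largest $n$ with $H^n\neq 0$. A **derivation of degree** $r\in\mathbb{Z}$ is a $\mathbb{Q}$-linear map $\delta:H^*\to H^*$ with $\delta(xy)=\delta(x)y+x\,\delta(y)$ and $\delta(H^n)\subseteq H^{n+r}$ for all $n$. We say that $H^*$ **splits** if there is an exact sequence $0\to K^*\to H^*\to Q^*\to 0$ of graded algebras, where $K^*$ and $Q^*$ are positively elliptic algebras different from $\mathbb{Q}$. Exactness means: $K^*\to H^*$ is injective and $H^*$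 is flat (equivalently, free) as a $K^*$-module, and $H^*\to Q^*$ is surjective with kernel the ideal of $H^*$ generated by the image of $\bigoplus_{n>0}K^n$. **Proposition.** Let $H^*=\mathbb{Q}[x_1,\ldots,x_k]/(u_1,\ldots,u_k)$, $k\ge 2$, be a pure model of a positively elliptic algebra that does not split. If $H^*$ has a non-zero derivation of negative degree and $|x_{k-1}|+|x_k|=10$, then either $\operatorname{fd}H^*>20$ or the degree type is $$(2,2,2,4,6;\,4,4,6,10,12).$$ -/

import Mathlib

/-- A positively elliptic algebra, given by a presentation
`ℚ[x₁, …, x_k] / (u₁, …, u_k)`: the generators `x_i` have positive even degrees `deg i`, and the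
relations `u_i` are homogeneous of degree `relDeg i` and form a regular sequence.
(`IsRegular` includes that the quotient is not the zero ring; the degrees `relDeg i` are then
determined by the non-zero polynomials `u_i`.) -/
structure PositivelyElliptic where
  /-- the number `k` of generators and of relations -/
  k : ℕ
  /-- the degrees `|x_i|` of the generators -/
  deg : Fin k → ℕ
  /-- the relations `u_i` -/
  rel : Fin k → MvPolynomial (Fin k) ℚ
  /-- the degrees `|u_i|` of the relations -/
  relDeg : Fin k → ℕ
  deg_pos : ∀ i, 0 < deg i
  deg_even : ∀ i, Even (deg i)
  homogeneous : ∀ i, MvPolynomial.IsWeightedHomogeneous deg (rel i) (relDeg i)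
  regular : RingTheory.Sequence.IsRegular (MvPolynomial (Fin k) ℚ) (List.ofFn rel)

namespace PositivelyElliptic

/-- The ideal `(u₁, …, u_k)`. -/
noncomputable abbrev relIdeal (H : PositivelyElliptic) : Ideal (MvPolynomial (Fin H.k) ℚ) :=
  Ideal.span (Set.range H.rel)

/-- The underlying `ℚ`-algebra `ℚ[x₁, …, x_k] / (u₁, …, u_k)`. -/
abbrev Alg (H : PositivelyElliptic) : Type :=
  MvPolynomial (Fin H.k) ℚ ⧸ H.relIdeal

/-- The homogeneous part `Hⁿ`: classes of polynomials that are homogeneous of degree `n`. -/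
noncomputable def grade (H : PositivelyElliptic) (n : ℕ) : Submodule ℚ H.Alg :=
  (MvPolynomial.weightedHomogeneousSubmodule ℚ H.deg n).map
    (Ideal.Quotient.mkₐ ℚ H.relIdeal).toLinearMap

/-- The homogeneous part of degree `m : ℤ`; it is zero for negative `m`. -/
noncomputable def gradeInt (H : PositivelyElliptic) (m : ℤ) : Submodule ℚ H.Alg :=
  if 0 ≤ m then H.grade m.toNat else ⊥

/-- The ideal of elements of positive degree; it is generated by the classes of the `x_i`. -/
noncomputable def posIdeal (H : PositivelyElliptic) : Ideal H.Alg :=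
  Ideal.span (Set.range fun i => Ideal.Quotient.mk H.relIdeal (MvPolynomial.X i))

/-- The formal dimension (socle degree): the largest `n` with `Hⁿ ≠ 0`. The set is bounded since
`H` is finite-dimensional, and it contains `0`. -/
noncomputable def formalDim (H : PositivelyElliptic) : ℕ :=
  sSup {n | H.grade n ≠ ⊥}

/-- The presentation is a pure model: generators and relations are listed by increasing degree,
and no relation has a constant or linear term. (The inequalities `|u_i| ≥ 2|x_i|` follow and are
not imposed.) -/
structure IsPureModel (H : PositivelyElliptic) : Prop where
  deg_mono : Monotone H.deg
  relDeg_mono : Monotone H.relDeg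
  two_le_degree : ∀ i, ∀ m ∈ (H.rel i).support, 2 ≤ m.degree

/-- The derivation `δ` has degree `r`, that is, `δ(Hⁿ) ⊆ H^(n+r)` for all `n`. Since `H` is
concentrated in even degrees, the sign in the graded Leibniz rule is always `+`. -/
def HasDegree (H : PositivelyElliptic) (δ : Derivation ℚ H.Alg H.Alg) (r : ℤ) : Prop :=
  ∀ n : ℕ, ∀ x ∈ H.grade n, δ x ∈ H.gradeInt (n + r)

/-- An algebra homomorphism that preserves degrees. -/
def IsGradedHom {K H : PositivelyElliptic} (f : K.Alg →ₐ[ℚ] H.Alg) : Prop :=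
  ∀ n : ℕ, ∀ x ∈ K.grade n, f x ∈ H.grade n

/-- `H` splits: there is an exact sequence `0 → K → H → Q → 0` of graded algebras, where `K` and
`Q` are positively elliptic and non-trivial (neither is just `ℚ` in degree zero). Exactness means
that `K → H` is injective and makes `H` a flat (equivalently, free) `K`-module, and that `H → Q`
is surjective with kernel the ideal of `H` generated by the elements of positive degree of `K`. -/
def Splits (H : PositivelyElliptic) : Prop :=
  ∃ (K Q : PositivelyElliptic) (ι : K.Alg →ₐ[ℚ] H.Alg) (π : H.Alg →ₐ[ℚ] Q.Alg),
    K.posIdeal ≠ ⊥ ∧ Q.posIdeal ≠ ⊥ ∧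
    IsGradedHom ι ∧ IsGradedHom π ∧
    Function.Injective ι ∧ ι.toRingHom.Flat ∧
    Function.Surjective π ∧ RingHom.ker π.toRingHom = K.posIdeal.map ι.toRingHom

end PositivelyElliptic

/-! The first alternative always holds, so the listed degree type never occurs. Assume that the
formal dimension is at most 20.

Two facts about zero-dimensional complete intersections do the counting. There is a non-zero class
in degree `∑ |u_i| - ∑ |x_i|` (`exists_socle_degree`), which bounds the degrees of the relations
from above. And the relations do not all lie in an ideal generated by fewer than `k` elements
without constant term (`not_rel_mem_span`), so they cannot be too degenerate modulo the generators
of degree two. Both come from exchanging a regular sequence, one member at a time, for elements of a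
suitable vector space (`RegSeq.exchange`).

The same exchange shows that the socle is a line, whence Poincaré duality (`exists_mul_top`). If `a
* δ t` is non-zero, some multiple of it is a top class; under the hypotheses of
`HasDegree.mul_apply_eq_zero` this multiple is `δ` of an antiderivative, while a derivation of
negative degree never reaches the top degree. Hence `δ = 0` whenever its values on the generators
are multiples, by constants of `δ`, of a single value. It follows that `δ` has degree `-2` and that
the last two generators have degrees 4 and 6. Such a `δ` lifts to a derivation `D` of the polynomial
ring that preserves the ideal of relations, and the quadratic parts of `u`, `D u`, `D (D u)` can be
compared.

If the first `p` relations involve only the first `p` generators, all of one degree, then the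
algebra is free over the subalgebra they define, by the local criterion of flatness and the Koszul
syzygies, and it splits (`IsPureModel.splits`). So one of the relations attached to the generators
of degree two has degree at least six. Counting degrees then leaves three families of generators:
`2, …, 2, 4, 6`; `2, 4, 4, 6`; `2, 2, 4, 4, 6`. In each, applying `D` repeatedly to relations either
forces `δ = 0` or places all the relations in an ideal with `k - 1` generators. -/

namespace Ideal

/-! ### Regular sequences modulo an ideal -/

section Regular

variable {R : Type*} [CommRing R]

/-- `a` is a non-zero-divisor modulo `J`. -/
def RegMod (J : Ideal R) (a : R) : Prop := ∀ m, a * m ∈ J → m ∈ J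

/-- The list is a (weakly) regular sequence modulo `J`. -/
def RegSeq : Ideal R → List R → Prop
  | _, [] => True
  | J, a :: l => J.RegMod a ∧ RegSeq (J ⊔ span {a}) l

theorem mem_sup_span_singleton_iff {J : Ideal R} {a x : R} :
    x ∈ J ⊔ span {a} ↔ ∃ b, x - a * b ∈ J := by
  constructor
  · intro h
    obtain ⟨j, hj, c, hc, rfl⟩ := Submodule.mem_sup.1 h
    obtain ⟨b, rfl⟩ := mem_span_singleton'.1 hc
    exact ⟨b, by simpa [mul_comm] using hj⟩
  · rintro ⟨b, hb⟩
    have : x = (x - a * b) + a * b := by ring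
    rw [this]
    exact add_mem (le_sup_left (a := J) hb)
      (mul_mem_right _ _ (le_sup_right (a := J) (mem_span_singleton_self a)))

theorem sup_ofList_cons (J : Ideal R) (a : R) (l : List R) :
    J ⊔ ofList (a :: l) = (J ⊔ span {a}) ⊔ ofList l := by
  rw [ofList_cons, sup_assoc]

theorem sup_ofList_concat (J : Ideal R) (a : R) (l : List R) :
    J ⊔ ofList (l ++ [a]) = (J ⊔ ofList l) ⊔ span {a} := by
  rw [ofList_append, ofList_singleton, sup_assoc]

theorem regSeq_append {J : Ideal R} {l₁ l₂ : List R} :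
    RegSeq J (l₁ ++ l₂) ↔ RegSeq J l₁ ∧ RegSeq (J ⊔ ofList l₁) l₂ := by
  induction l₁ generalizing J with
  | nil => simp [RegSeq]
  | cons a l ih => rw [List.cons_append, RegSeq, RegSeq, ih, sup_ofList_cons, and_assoc]

theorem isWeaklyRegular_iff_regSeq {l : List R} :
    RingTheory.Sequence.IsWeaklyRegular R l ↔ RegSeq (⊥ : Ideal R) l := by
  induction l using List.reverseRecOn with
  | nil => simp [RegSeq]
  | append_singleton l a ih =>
    rw [RingTheory.Sequence.isWeaklyRegular_append_iff, regSeq_append, ih,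
      RingTheory.Sequence.isWeaklyRegular_singleton_iff]
    simp only [RegSeq, and_true, bot_sup_eq]
    refine and_congr_right fun _ => ?_
    rw [isSMulRegular_quotient_iff_mem_of_smul_mem]
    simp [RegMod]

theorem isRegular_iff_regSeq {l : List R} :
    RingTheory.Sequence.IsRegular R l ↔ RegSeq (⊥ : Ideal R) l ∧ ofList l ≠ ⊤ := by
  constructor
  · intro h
    refine ⟨isWeaklyRegular_iff_regSeq.1 h.toIsWeaklyRegular, fun h' => h.top_ne_smul ?_⟩
    simp [h']
  · rintro ⟨h, h'⟩
    exact ⟨isWeaklyRegular_iff_regSeq.2 h, fun h'' => h' (by simpa using h''.symm)⟩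

/-- From `a * m = w * b` modulo `J`, regularity of `w` modulo `(J, a)` gives `b = a * c`, and
cancelling `a` gives `m = w * c`. -/
theorem RegMod.sup_span_singleton {J : Ideal R} {a w : R} (ha : J.RegMod a)
    (hw : (J ⊔ span {a}).RegMod w) : (J ⊔ span {w}).RegMod a := by
  intro m hm
  obtain ⟨b, hb⟩ := mem_sup_span_singleton_iff.1 hm
  obtain ⟨c, hc⟩ := mem_sup_span_singleton_iff.1
    (hw b (mem_sup_span_singleton_iff.2 ⟨m, by rw [← neg_mem_iff]; simpa using hb⟩))
  refine mem_sup_span_singleton_iff.2 ⟨c, ha _ ?_⟩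
  have : a * (m - w * c) = (a * m - w * b) + w * (b - a * c) := by ring
  rw [this]
  exact add_mem hb (mul_mem_left _ _ hc)

theorem RegSeq.sup_span_singleton {J : Ideal R} {w : R} {l : List R} (hl : J.RegSeq l)
    (hw : ∀ v, v <+: l → (J ⊔ ofList v).RegMod w) : (J ⊔ span {w}).RegSeq l := by
  induction l generalizing J with
  | nil => trivial
  | cons a l ih =>
    refine ⟨hl.1.sup_span_singleton ?_, ?_⟩
    · simpa using hw [a] (by simp)
    · rw [sup_right_comm]
      refine ih hl.2 fun v hv => ?_
      rw [← sup_ofList_cons]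
      exact hw _ (by simpa using hv)

/-- Socle elements of `R ⧸ (J, w)` correspond to socle elements of `R ⧸ (J, u)`. -/
theorem RegMod.exchange_mem {J : Ideal R} {u w m m' : R} (hu : J.RegMod u)
    (h : w * m - u * m' ∈ J) {y : R} (hy : y * m ∈ J ⊔ span {u}) : y * m' ∈ J ⊔ span {w} := by
  obtain ⟨b, hb⟩ := mem_sup_span_singleton_iff.1 hy
  refine mem_sup_span_singleton_iff.2 ⟨b, hu _ ?_⟩
  have : u * (y * m' - w * b) = w * (y * m - u * b) - y * (w * m - u * m') := by ring
  rw [this]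
  exact sub_mem (mul_mem_left _ _ hb) (mul_mem_left _ _ h)

end Regular

/-! ### Exchanging a regular sequence for elements of a vector space -/

section Exchange

variable {k R : Type*} [Field k] [Infinite k] [CommRing R] [IsNoetherianRing R] [Algebra k R]

/-- Prime avoidance in a vector space: an associated prime of `R ⧸ J` that contains `W` would
contain the non-zero-divisor `u`. So the finitely many associated primes cut out proper subspaces of
`W`, which over an infinite field do not cover it. -/
theorem exists_common_regMod (W : Submodule k R) (S : Finset (Ideal R))
    (hS : ∀ J ∈ S, ∃ u ∈ (span (W : Set R)).radical, J.RegMod u) :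
    ∃ w ∈ W, ∀ J ∈ S, J.RegMod w := by
  classical
  let primes : Finset (Ideal R) :=
    S.biUnion fun J => (associatedPrimes.finite R (R ⧸ J)).toFinset
  let sub : Ideal R → Submodule k W := fun P => (P.restrictScalars k).comap W.subtype
  have key : (⊤ : Submodule k W) ∉ primes.image sub := by
    intro h
    obtain ⟨P, hP, hPW⟩ := Finset.mem_image.1 h
    obtain ⟨J, hJ, hPJ⟩ := Finset.mem_biUnion.1 hP
    rw [Set.Finite.mem_toFinset] at hPJ
    obtain ⟨u, hu, hreg⟩ := hS J hJ
    have hWP : (W : Set R) ⊆ P := fun x hx => by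
      have : (⟨x, hx⟩ : W) ∈ sub P := by rw [hPW]; trivial
      simpa [sub] using this
    have huP : u ∈ P := (hPJ.isPrime.radical_le_iff.2 (span_le.2 hWP)) hu
    have hz : u ∈ ⋃ p ∈ associatedPrimes R (R ⧸ J), (p : Set R) :=
      Set.mem_biUnion hPJ huP
    rw [biUnion_associatedPrimes_eq_zero_divisors] at hz
    obtain ⟨x, hx, hux⟩ := hz
    obtain ⟨x, rfl⟩ := Ideal.Quotient.mk_surjective x
    refine hx (Quotient.eq_zero_iff_mem.2 (hreg x (Quotient.eq_zero_iff_mem.1 ?_)))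
    rw [map_mul]
    exact hux
  obtain ⟨w, hw⟩ : ∃ w : W, w ∉ ⋃ p ∈ primes.image sub, (p : Set W) := by
    by_contra! h
    exact Subspace.biUnion_ne_univ_of_top_notMem key (Set.eq_univ_of_forall h)
  refine ⟨w, w.2, fun J hJ m hm => ?_⟩
  by_contra hmJ
  have hz : (w : R) ∈ ⋃ p ∈ associatedPrimes R (R ⧸ J), (p : Set R) := by
    rw [biUnion_associatedPrimes_eq_zero_divisors]
    refine ⟨Ideal.Quotient.mk J m, fun h => hmJ (Quotient.eq_zero_iff_mem.1 h), ?_⟩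
    exact Quotient.eq_zero_iff_mem.2 hm
  obtain ⟨P, hP, hwP⟩ := Set.mem_iUnion₂.1 hz
  refine hw (Set.mem_biUnion (x := sub P) (Finset.mem_image_of_mem _ ?_) hwP)
  exact Finset.mem_biUnion.2 ⟨J, hJ, by simpa using hP⟩

/-- A regular sequence in the ideal generated by a space `W` can be exchanged, one element at a
time, for a regular sequence in `W`. -/
theorem RegSeq.exchange (W : Submodule k R) (Inv : Ideal R → Prop) (P : ℤ → Ideal R → Prop)
    (e : R → ℤ) {J : Ideal R} {us : List R} (hJ : J.RegSeq us)
    (hus : ∀ u ∈ us, u ∈ (span (W : Set R)).radical) (hInv : Inv J)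
    (hInvW : ∀ J', Inv J' → ∀ w ∈ W, Inv (J' ⊔ span {w}))
    (hInvU : ∀ J', Inv J' → ∀ u ∈ us, Inv (J' ⊔ span {u}))
    (step : ∀ J' n, ∀ u ∈ us, ∀ w ∈ W, Inv J' → J'.RegMod u → J'.RegMod w →
      P n (J' ⊔ span {w}) → P (n + e u) (J' ⊔ span {u})) :
    ∃ ws : List R, ws.length = us.length ∧ (∀ w ∈ ws, w ∈ W) ∧ J.RegSeq ws ∧
      ∀ n, P n (J ⊔ ofList ws) → P (n + (us.map e).sum) (J ⊔ ofList us) := by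
  classical
  induction us using List.reverseRecOn generalizing J with
  | nil => exact ⟨[], rfl, by simp, trivial, by simp⟩
  | append_singleton us u ih =>
    obtain ⟨h1, h2, -⟩ := regSeq_append.1 hJ
    have hpre : ∀ v, v <+: us → ∃ a ∈ us ++ [u], (J ⊔ ofList v).RegMod a := by
      rintro v ⟨t, rfl⟩
      cases t with
      | nil => exact ⟨u, by simp, by simpa using h2⟩
      | cons a t => exact ⟨a, by simp, (regSeq_append.1 h1).2.1⟩
    -- A single `w` is regular modulo every prefix of `us`. It can therefore be moved to the front,
    -- where the induction hypothesis applies modulo `w`, and it can also stand in for the last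
    -- element `u` modulo all of `us`.
    obtain ⟨w, hwW, hw⟩ := exists_common_regMod W (us.inits.map fun v => J ⊔ ofList v).toFinset (by
      intro I hI
      simp only [List.mem_toFinset, List.mem_map, List.mem_inits] at hI
      obtain ⟨v, hv, rfl⟩ := hI
      obtain ⟨a, ha, hreg⟩ := hpre v hv
      exact ⟨a, hus a ha, hreg⟩)
    have hw' : ∀ v, v <+: us → (J ⊔ ofList v).RegMod w := fun v hv =>
      hw _ (by
        simp only [List.mem_toFinset, List.mem_map, List.mem_inits]
        exact ⟨v, hv, rfl⟩)
    obtain ⟨ws, hlen, hws, hreg, hP⟩ := ih (h1.sup_span_singleton hw')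
      (fun a ha => hus a (by simp [ha])) (hInvW _ hInv w hwW)
      (fun J' hJ' a ha => hInvU J' hJ' a (by simp [ha]))
      (fun J' n a ha => step J' n a (by simp [ha]))
    have hInvus : ∀ vs : List R, (∀ a ∈ vs, a ∈ us ++ [u]) → ∀ J', Inv J' →
        Inv (J' ⊔ ofList vs) := by
      intro vs
      induction vs with
      | nil => intro _ J' h; simpa using h
      | cons a vs ih =>
        intro hvs J' hJ'
        rw [sup_ofList_cons]
        exact ih (fun b hb => hvs b (by simp [hb])) _ (hInvU J' hJ' a (hvs a (by simp)))
    refine ⟨w :: ws, by simp [hlen], by simpa [hwW] using hws, ⟨?_, hreg⟩, fun n hn => ?_⟩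
    · simpa using hw' [] (by simp)
    · rw [sup_ofList_cons] at hn
      rw [sup_ofList_concat]
      have := step (J ⊔ ofList us) (n + (us.map e).sum) u (by simp) w hwW
        (hInvus us (by simp +contextual) J hInv) h2 (hw' us List.prefix_rfl)
        (by rw [sup_right_comm]; exact hP n hn)
      simpa [add_assoc] using this

theorem RegSeq.exists_list_subset (W : Submodule k R) {J : Ideal R} {us : List R}
    (hJ : J.RegSeq us) (hus : ∀ u ∈ us, u ∈ (span (W : Set R)).radical) :
    ∃ ws : List R, ws.length = us.length ∧ (∀ w ∈ ws, w ∈ W) ∧ J.RegSeq ws := by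
  obtain ⟨ws, h1, h2, h3, -⟩ := hJ.exchange W (fun _ => True) (fun _ _ => True) (fun _ => 0) hus
    trivial (by simp) (by simp) (by simp)
  exact ⟨ws, h1, h2, h3⟩

end Exchange

/-! ### Dimension bounds for regular sequences in a vector space -/

section Finrank

variable {k R : Type*} [Field k] [CommRing R] [Algebra k R]

/-- Each member lies in `W` but not in the ideal generated so far, since otherwise regularity would
put `1` in that ideal. So the trace of the ideal on `W` grows at every step. -/
theorem RegSeq.finrank_add_length_le (W : Submodule k R) [FiniteDimensional k W] {J : Ideal R}
    {ws : List R} (hJ : J.RegSeq ws) (hws : ∀ w ∈ ws, w ∈ W) (htop : J ⊔ ofList ws ≠ ⊤) :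
    Module.finrank k (W ⊓ J.restrictScalars k : Submodule k R) + ws.length ≤
      Module.finrank k (W ⊓ (J ⊔ ofList ws).restrictScalars k : Submodule k R) := by
  induction ws generalizing J with
  | nil => rw [ofList_nil, sup_bot_eq]; simp
  | cons w ws ih =>
    rw [sup_ofList_cons] at htop ⊢
    have h1 := ih hJ.2 (fun a ha => hws a (by simp [ha])) htop
    have hwJ : w ∉ J := fun h => htop (by
      have h1 : (1 : R) ∈ J := hJ.1 1 (by simpa using h)
      rw [(eq_top_iff_one J).2 h1]; simp)
    have h2 : Module.finrank k (W ⊓ J.restrictScalars k : Submodule k R) <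
        Module.finrank k (W ⊓ (J ⊔ span {w}).restrictScalars k : Submodule k R) := by
      have : FiniteDimensional k (W ⊓ (J ⊔ span {w}).restrictScalars k : Submodule k R) :=
        Submodule.finiteDimensional_of_le inf_le_left
      refine Submodule.finrank_lt_finrank_of_lt (lt_of_le_of_ne ?_ fun h => hwJ ?_)
      · exact inf_le_inf_left _ (fun x hx => le_sup_left (a := J) hx)
      · have : w ∈ (W ⊓ (J ⊔ span {w}).restrictScalars k : Submodule k R) :=
          ⟨hws w (by simp), le_sup_right (a := J) (mem_span_singleton_self w)⟩
        rw [← h] at this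
        exact this.2
    simp only [List.length_cons]
    omega

theorem RegSeq.length_le_finrank (W : Submodule k R) [FiniteDimensional k W] {J : Ideal R}
    {ws : List R} (hJ : J.RegSeq ws) (hws : ∀ w ∈ ws, w ∈ W) (htop : J ⊔ ofList ws ≠ ⊤) :
    ws.length ≤ Module.finrank k W := by
  have h1 := hJ.finrank_add_length_le W hws htop
  have h2 := Submodule.finrank_mono (R := k)
    (inf_le_left : W ⊓ (J ⊔ ofList ws).restrictScalars k ≤ W)
  omega

/-- With as many members as the dimension of `W`, the trace must be all of `W`. This identifies the
ideal generated by an exchanged sequence. -/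
theorem RegSeq.le_of_finrank_le (W : Submodule k R) [FiniteDimensional k W] {J : Ideal R}
    {ws : List R} (hJ : J.RegSeq ws) (hws : ∀ w ∈ ws, w ∈ W) (htop : J ⊔ ofList ws ≠ ⊤)
    (hlen : Module.finrank k W ≤ ws.length) : W ≤ (J ⊔ ofList ws).restrictScalars k := by
  have h1 := hJ.finrank_add_length_le W hws htop
  have h2 : W ⊓ (J ⊔ ofList ws).restrictScalars k = W :=
    Submodule.eq_of_le_of_finrank_le inf_le_left (by omega)
  exact inf_eq_left.1 h2

end Finrank

/-- Exchanging the sequence for one in the `k`-span of `S` bounds its length by the dimension of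
that span: an elementary form of the bound of depth by the number of generators. -/
theorem RegSeq.length_le_card (k : Type*) {R : Type*} [Field k] [Infinite k] [CommRing R]
    [IsNoetherianRing R] [Algebra k R] {us : List R} (hJ : RegSeq (⊥ : Ideal R) us) (S : Finset R)
    (hus : ∀ u ∈ us, u ∈ span (S : Set R)) (htop : span (S : Set R) ≠ ⊤) :
    us.length ≤ S.card := by
  have hspan : span (Submodule.span k (S : Set R) : Set R) = span (S : Set R) := by
    refine le_antisymm (span_le.2 fun x hx => ?_) (span_mono Submodule.subset_span)
    exact Submodule.span_le_restrictScalars k R _ hx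
  obtain ⟨ws, h1, h2, h3⟩ := hJ.exists_list_subset (Submodule.span k (S : Set R))
    (fun u hu => le_radical (by rw [hspan]; exact hus u hu))
  rw [← h1]
  refine (h3.length_le_finrank _ h2 fun h => htop ?_).trans (finrank_span_finset_le_card S)
  rw [bot_sup_eq] at h
  rw [eq_top_iff, ← h, ofList, ← hspan]
  exact span_mono fun x hx => h2 x hx

end Ideal

/-! ### Homogeneous ideals and permutation of regular sequences -/

namespace MvPolynomial

open Ideal

section Graded

variable {σ : Type*} {w : σ → ℕ}

theorem weightedHomogeneousComponent_mul_left {a : MvPolynomial σ ℚ} {d : ℕ}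
    (ha : a.IsWeightedHomogeneous w d) (b : MvPolynomial σ ℚ) (n : ℕ) :
    weightedHomogeneousComponent w (d + n) (a * b) = a * weightedHomogeneousComponent w n b := by
  induction b using MvPolynomial.induction_on' with
  | monomial s c =>
    have hs := isWeightedHomogeneous_monomial (R := ℚ) w s c rfl
    rw [weightedHomogeneousComponent_of_mem (ha.mul hs), weightedHomogeneousComponent_of_mem hs]
    split_ifs <;> first | rfl | omega | simp
  | add p q hp hq => rw [mul_add, map_add, hp, hq, map_add, mul_add]

theorem weightedHomogeneousComponent_mul_eq_zero {a : MvPolynomial σ ℚ} {d : ℕ}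
    (ha : a.IsWeightedHomogeneous w d) (b : MvPolynomial σ ℚ) {n : ℕ} (hn : n < d) :
    weightedHomogeneousComponent w n (a * b) = 0 := by
  induction b using MvPolynomial.induction_on' with
  | monomial s c =>
    have hs := isWeightedHomogeneous_monomial (R := ℚ) w s c rfl
    rw [weightedHomogeneousComponent_of_mem (ha.mul hs), if_neg (by omega)]
  | add p q hp hq => rw [mul_add, map_add, hp, hq, add_zero]

theorem exists_weightedHomogeneousComponent_mul {a : MvPolynomial σ ℚ} {d : ℕ}
    (ha : a.IsWeightedHomogeneous w d) (b : MvPolynomial σ ℚ) (n : ℕ) :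
    ∃ c, weightedHomogeneousComponent w n (a * b) = a * c := by
  by_cases hn : n < d
  · exact ⟨0, by rw [weightedHomogeneousComponent_mul_eq_zero ha b hn, mul_zero]⟩
  · obtain ⟨m, rfl⟩ := Nat.exists_eq_add_of_le (not_lt.1 hn)
    exact ⟨_, weightedHomogeneousComponent_mul_left ha b m⟩

/-- An ideal that contains the weighted homogeneous components of its elements. -/
def WHomog (w : σ → ℕ) (J : Ideal (MvPolynomial σ ℚ)) : Prop :=
  ∀ f ∈ J, ∀ n, weightedHomogeneousComponent w n f ∈ J

theorem whomog_bot : WHomog w (⊥ : Ideal (MvPolynomial σ ℚ)) := by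
  intro f hf n
  rw [Ideal.mem_bot] at hf ⊢
  rw [hf, map_zero]

theorem WHomog.sup_span_singleton {J : Ideal (MvPolynomial σ ℚ)} (hJ : WHomog w J)
    {a : MvPolynomial σ ℚ} {d : ℕ} (ha : a.IsWeightedHomogeneous w d) :
    WHomog w (J ⊔ span {a}) := by
  intro f hf n
  obtain ⟨b, hb⟩ := mem_sup_span_singleton_iff.1 hf
  obtain ⟨c, hc⟩ := exists_weightedHomogeneousComponent_mul ha b n
  refine mem_sup_span_singleton_iff.2 ⟨c, ?_⟩
  rw [← hc, ← map_sub]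
  exact hJ _ hb n

theorem WHomog.sup_ofList {J : Ideal (MvPolynomial σ ℚ)} (hJ : WHomog w J)
    {l : List (MvPolynomial σ ℚ)} (hl : ∀ a ∈ l, ∃ d, a.IsWeightedHomogeneous w d) :
    WHomog w (J ⊔ ofList l) := by
  induction l generalizing J with
  | nil => simpa using hJ
  | cons a l ih =>
    rw [sup_ofList_cons]
    obtain ⟨d, hd⟩ := hl a (by simp)
    exact ih (hJ.sup_span_singleton hd) fun b hb => hl b (by simp [hb])

theorem mem_of_forall_weightedHomogeneousComponent_mem {J : Ideal (MvPolynomial σ ℚ)}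
    {f : MvPolynomial σ ℚ} (h : ∀ n, weightedHomogeneousComponent w n f ∈ J) : f ∈ J := by
  rw [← finsum_weightedHomogeneousComponent w f]
  exact finsum_induction (· ∈ J) (zero_mem _) (fun _ _ => add_mem) h

theorem WHomog.mem_of_forall_mem_sup_pow {J : Ideal (MvPolynomial σ ℚ)} (hJ : WHomog w J)
    {a : MvPolynomial σ ℚ} {d : ℕ} (ha : a.IsWeightedHomogeneous w d) (hd : 0 < d)
    {f : MvPolynomial σ ℚ} (h : ∀ N, f ∈ J ⊔ span {a ^ N}) : f ∈ J := by
  refine mem_of_forall_weightedHomogeneousComponent_mem (w := w) fun n => ?_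
  obtain ⟨b, hb⟩ := mem_sup_span_singleton_iff.1 (h (n + 1))
  have h1 := hJ _ hb n
  rw [map_sub, weightedHomogeneousComponent_mul_eq_zero (ha.pow (n + 1)) b, sub_zero] at h1
  · exact h1
  · rw [smul_eq_mul]; nlinarith

/-- If `b * m` is in `J`, then `m` is divisible by `a` modulo `J` and the quotient is again killed
by `b`. Iterating, `m` lies in `J + (a ^ N)` for every `N`, hence in `J` for degree reasons. This is
what allows adjacent members to be swapped. -/
theorem WHomog.regMod_of_regMod_sup {J : Ideal (MvPolynomial σ ℚ)} (hJ : WHomog w J)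
    {a b : MvPolynomial σ ℚ} {d : ℕ} (ha : a.IsWeightedHomogeneous w d) (hd : 0 < d)
    (hreg : J.RegMod a) (hb : (J ⊔ span {a}).RegMod b) : J.RegMod b := by
  intro m hm
  refine hJ.mem_of_forall_mem_sup_pow ha hd fun N => mem_sup_span_singleton_iff.2 ?_
  suffices ∃ m', m - a ^ N * m' ∈ J ∧ b * m' ∈ J from this.imp fun _ => And.left
  induction N with
  | zero => exact ⟨m, by simp, hm⟩
  | succ N ih =>
    obtain ⟨m', h1, h2⟩ := ih
    obtain ⟨m'', h3⟩ := mem_sup_span_singleton_iff.1 (hb m' (le_sup_left (a := J) h2))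
    refine ⟨m'', ?_, hreg _ ?_⟩
    · have : m - a ^ (N + 1) * m'' = (m - a ^ N * m') + a ^ N * (m' - a * m'') := by ring
      rw [this]
      exact add_mem h1 (mul_mem_left _ _ h3)
    · have : a * (b * m'') = b * m' - b * (m' - a * m'') := by ring
      rw [this]
      exact sub_mem h2 (mul_mem_left _ _ h3)

theorem WHomog.regSeq_perm {J : Ideal (MvPolynomial σ ℚ)} (hJ : WHomog w J)
    {l l' : List (MvPolynomial σ ℚ)} (hl : ∀ a ∈ l, ∃ d, 0 < d ∧ a.IsWeightedHomogeneous w d)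
    (hp : l.Perm l') (h : J.RegSeq l) : J.RegSeq l' := by
  induction hp generalizing J with
  | nil => trivial
  | cons a _ ih =>
    obtain ⟨d, _, hd⟩ := hl a (by simp)
    exact ⟨h.1, ih (hJ.sup_span_singleton hd) (fun b hb => hl b (by simp [hb])) h.2⟩
  | swap a b l =>
    obtain ⟨d, hd0, hd⟩ := hl b (by simp)
    refine ⟨hJ.regMod_of_regMod_sup hd hd0 h.1 h.2.1, h.1.sup_span_singleton h.2.1, ?_⟩
    rw [sup_right_comm]
    exact h.2.2
  | trans h1 _ ih1 ih2 =>
    exact ih2 hJ (fun a ha => hl a (h1.mem_iff.2 ha)) (ih1 hJ hl h)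

end Graded

/-! ### Finiteness of complete intersections -/

section Artinian

variable {σ : Type*}

theorem ringKrullDim_add_length_le {R : Type*} [CommRing R] {J : Ideal R} {l : List R}
    (h : J.RegSeq l) : ringKrullDim (R ⧸ (J ⊔ ofList l)) + l.length ≤ ringKrullDim (R ⧸ J) := by
  induction l generalizing J with
  | nil =>
    rw [ofList_nil, sup_bot_eq]
    simp
  | cons a l ih =>
    rw [sup_ofList_cons]
    have h1 := ih h.2
    have h2 : ringKrullDim (R ⧸ (J ⊔ span {a})) + 1 ≤ ringKrullDim (R ⧸ J) := by
      refine ringKrullDim_succ_le_of_surjective (Ideal.Quotient.factor le_sup_left)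
        (Ideal.Quotient.factor_surjective _) (r := Ideal.Quotient.mk J a) ?_ ?_
      · rw [mem_nonZeroDivisors_iff_right]
        intro x hx
        obtain ⟨x, rfl⟩ := Ideal.Quotient.mk_surjective x
        rw [← map_mul, Quotient.eq_zero_iff_mem] at hx
        exact Quotient.eq_zero_iff_mem.2 (h.1 x (by rwa [mul_comm]))
      · rw [Ideal.Quotient.factor_mk, Quotient.eq_zero_iff_mem]
        exact le_sup_right (a := J) (mem_span_singleton_self a)
    refine le_trans ?_ h2
    rw [List.length_cons, Nat.cast_add, Nat.cast_one, ← add_assoc]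
    exact add_le_add_left h1 1

/-- Each member lowers the Krull dimension by at least one, so none is left, and a finitely
generated algebra of dimension at most zero is finite over the field. -/
theorem finite_quotient_of_regSeq [Fintype σ] {l : List (MvPolynomial σ ℚ)}
    (h : (⊥ : Ideal (MvPolynomial σ ℚ)).RegSeq l) (hl : l.length = Fintype.card σ) :
    Module.Finite ℚ (MvPolynomial σ ℚ ⧸ ofList l) := by
  have h1 : ringKrullDim (MvPolynomial σ ℚ ⧸ ofList l) + l.length ≤
      ringKrullDim (MvPolynomial σ ℚ) := by
    have h2 := ringKrullDim_add_length_le h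
    rw [ringKrullDim_eq_of_ringEquiv (RingEquiv.quotientBot (MvPolynomial σ ℚ))] at h2
    rwa [ringKrullDim_eq_of_ringEquiv (Ideal.quotEquivOfEq (bot_sup_eq (ofList l)))] at h2
  rw [MvPolynomial.ringKrullDim_of_isNoetherianRing, ringKrullDim_eq_zero_of_field, zero_add,
    Nat.card_eq_fintype_card, hl] at h1
  refine (Module.finite_iff_krullDimLE_zero ℚ _).2 (Ring.krullDimLE_iff.2 ?_)
  generalize ringKrullDim (MvPolynomial σ ℚ ⧸ ofList l) = D at h1 ⊢
  induction D with
  | bot => simp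
  | coe D =>
    induction D with
    | top =>
      have h2 : ((⊤ : ℕ∞) : WithBot ℕ∞) + ((Fintype.card σ : ℕ∞) : WithBot ℕ∞) ≤
        ((Fintype.card σ : ℕ∞) : WithBot ℕ∞) := h1
      rw [← WithBot.coe_add, top_add, WithBot.coe_le_coe, top_le_iff] at h2
      exact absurd h2 (ENat.natCast_ne_top _)
    | coe D =>
      norm_cast at h1 ⊢
      simp at h1
      simp [h1]

/-- In a finite-dimensional graded quotient the homogeneous parts of large degree vanish. -/
theorem exists_forall_mem_of_finite {w : σ → ℕ} {I : Ideal (MvPolynomial σ ℚ)} (hI : WHomog w I)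
    [Module.Finite ℚ (MvPolynomial σ ℚ ⧸ I)] :
    ∃ N, ∀ n, N ≤ n → ∀ f : MvPolynomial σ ℚ, f.IsWeightedHomogeneous w n → f ∈ I := by
  classical
  let S : Set ℕ := {n | ∃ f : MvPolynomial σ ℚ, f.IsWeightedHomogeneous w n ∧ f ∉ I}
  choose f hf using fun n : S => n.2
  -- Non-members of different degrees stay independent because `I` contains the components of its
  -- elements; so only finitely many degrees have one.
  have hli : LinearIndependent ℚ fun n : S => (Ideal.Quotient.mkₐ ℚ I) (f n) := by
    rw [linearIndependent_iff']
    intro s g hg i hi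
    have h1 : ∑ n ∈ s, g n • f n ∈ I := by
      rw [← Quotient.eq_zero_iff_mem, ← hg, ← Ideal.Quotient.mkₐ_eq_mk ℚ, map_sum]
      simp only [map_smul]
    have h2 := hI _ h1 i
    rw [map_sum, Finset.sum_eq_single i] at h2
    · rw [map_smul, (hf i).1.weightedHomogeneousComponent_same] at h2
      by_contra hgi
      refine (hf i).2 ?_
      have := I.mul_mem_left (C (g i)⁻¹) h2
      rwa [← smul_eq_C_mul, smul_smul, inv_mul_cancel₀ hgi, one_smul] at this
    · intro j _ hj
      rw [map_smul, (hf j).1.weightedHomogeneousComponent_ne, smul_zero]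
      exact fun h => hj (Subtype.ext h.symm)
    · exact fun h => absurd hi h
  have hfin : S.Finite := by
    have := hli.finite
    exact Set.toFinite S
  obtain ⟨N, hN⟩ := hfin.bddAbove
  refine ⟨N + 1, fun n hn f hf => ?_⟩
  by_contra h
  have := hN (show n ∈ S from ⟨f, hf, h⟩)
  omega

end Artinian

/-! ### The socle of a complete intersection -/

section Socle

variable {σ : Type*}

theorem sub_C_constantCoeff_mem (f : MvPolynomial σ ℚ) :
    f - C (constantCoeff f) ∈ span (Set.range (X : σ → MvPolynomial σ ℚ)) := by
  rw [← Set.image_univ, mem_ideal_span_X_image]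
  intro m hm
  by_contra! h
  have : m = 0 := by ext i; simpa using h i
  subst this
  rw [mem_support_iff, coeff_sub, coeff_zero_C, constantCoeff_eq] at hm
  simp at hm

theorem span_X_le_ker : span (Set.range (X : σ → MvPolynomial σ ℚ)) ≤
    RingHom.ker (constantCoeff : MvPolynomial σ ℚ →+* ℚ) := by
  rw [span_le]
  rintro _ ⟨i, rfl⟩
  simp

theorem mem_span_X_iff {f : MvPolynomial σ ℚ} :
    f ∈ span (Set.range (X : σ → MvPolynomial σ ℚ)) ↔ constantCoeff f = 0 := by
  refine ⟨fun h => span_X_le_ker h, fun h => ?_⟩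
  simpa [h] using sub_C_constantCoeff_mem f

theorem ne_top_of_le_ker {I : Ideal (MvPolynomial σ ℚ)}
    (h : I ≤ RingHom.ker (constantCoeff : MvPolynomial σ ℚ →+* ℚ)) : I ≠ ⊤ := by
  rintro rfl
  have : (1 : MvPolynomial σ ℚ) ∈ RingHom.ker (constantCoeff : MvPolynomial σ ℚ →+* ℚ) := h trivial
  simp at this

/-- The socle of a zero-dimensional complete intersection is at most one-dimensional. -/
theorem socle_dependent [Fintype σ] {us : List (MvPolynomial σ ℚ)}
    (h : (⊥ : Ideal (MvPolynomial σ ℚ)).RegSeq us) (hlen : us.length = Fintype.card σ)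
    (hus : ∀ u ∈ us, constantCoeff u = 0) {m₁ m₂ : MvPolynomial σ ℚ}
    (h₁ : ∀ i, X i * m₁ ∈ ofList us) (h₂ : ∀ i, X i * m₂ ∈ ofList us) :
    ∃ α β : ℚ, (α ≠ 0 ∨ β ≠ 0) ∧ α • m₁ + β • m₂ ∈ ofList us := by
  classical
  let W : Submodule ℚ (MvPolynomial σ ℚ) := Submodule.span ℚ (Set.range X)
  have hWX : (W : Set (MvPolynomial σ ℚ)) ⊆ span (Set.range (X : σ → MvPolynomial σ ℚ)) := fun x hx =>
    Submodule.span_le_restrictScalars ℚ (MvPolynomial σ ℚ) _ hx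
  have hXW : span (Set.range (X : σ → MvPolynomial σ ℚ)) ≤ span (W : Set (MvPolynomial σ ℚ)) :=
    span_mono Submodule.subset_span
  -- The property carried through the exchange; the integer index plays no role here. A socle
  -- element `m` modulo `(J, u)` gives `n` with `w * m = u * n` modulo `J`, and `n` is a socle
  -- element modulo `(J, w)`.
  let P : ℤ → Ideal (MvPolynomial σ ℚ) → Prop := fun _ J => ∀ m₁ m₂ : MvPolynomial σ ℚ, (∀ i, X i * m₁ ∈ J) →
    (∀ i, X i * m₂ ∈ J) → ∃ α β : ℚ, (α ≠ 0 ∨ β ≠ 0) ∧ α • m₁ + β • m₂ ∈ J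
  have hmul : ∀ (J : Ideal (MvPolynomial σ ℚ)) (m : MvPolynomial σ ℚ), (∀ i, X i * m ∈ J) → ∀ a ∈ W, a * m ∈ J := by
    intro J m hm a ha
    induction ha using Submodule.span_induction with
    | mem x hx => obtain ⟨i, rfl⟩ := hx; exact hm i
    | zero => simp
    | add x y _ _ hx hy => rw [add_mul]; exact add_mem hx hy
    | smul c x _ hx => rw [smul_mul_assoc, smul_eq_C_mul]; exact mul_mem_left _ _ hx
  obtain ⟨ws, hl, hW, hreg, hP⟩ := h.exchange W (fun _ => True) P (fun _ => 0)
    (fun u hu => le_radical (hXW (mem_span_X_iff.2 (hus u hu)))) trivial (by simp) (by simp) (by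
      intro J n u _ w hw _ hu hw' ih m₁ m₂ h₁ h₂
      obtain ⟨n₁, hn₁⟩ := mem_sup_span_singleton_iff.1 (hmul _ _ h₁ w hw)
      obtain ⟨n₂, hn₂⟩ := mem_sup_span_singleton_iff.1 (hmul _ _ h₂ w hw)
      obtain ⟨α, β, hαβ, hmem⟩ := ih n₁ n₂ (fun i => hu.exchange_mem hn₁ (h₁ i))
        (fun i => hu.exchange_mem hn₂ (h₂ i))
      refine ⟨α, β, hαβ, ?_⟩
      obtain ⟨g, hg⟩ := mem_sup_span_singleton_iff.1 hmem
      refine mem_sup_span_singleton_iff.2 ⟨g, hw' _ ?_⟩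
      have : w * (α • m₁ + β • m₂ - u * g) = C α * (w * m₁ - u * n₁) + C β * (w * m₂ - u * n₂)
          + u * (α • n₁ + β • n₂ - w * g) := by
        simp only [smul_eq_C_mul]; ring
      rw [this]
      exact add_mem (add_mem (mul_mem_left _ _ hn₁) (mul_mem_left _ _ hn₂)) (mul_mem_left _ _ hg))
  have hker : ofList ws ≤ span (Set.range (X : σ → MvPolynomial σ ℚ)) := span_le.2 fun x hx => hWX (hW x hx)
  have : FiniteDimensional ℚ W := FiniteDimensional.span_of_finite ℚ (Set.finite_range _)
  have hle := hreg.le_of_finrank_le W hW (by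
    rw [bot_sup_eq]
    exact ne_top_of_le_ker (hker.trans span_X_le_ker)) (by
      rw [hl, hlen]
      exact finrank_range_le_card _)
  have hXws : span (Set.range (X : σ → MvPolynomial σ ℚ)) ≤ ofList ws := by
    refine span_le.2 fun x hx => ?_
    have := hle (Submodule.subset_span hx)
    simpa using this
  -- The exchanged sequence generates all the variables, so modulo it a polynomial is its constant
  -- term, and two constants are dependent.
  have := hP 0 (fun m₁ m₂ _ _ => by
    have hmem : ∀ m : MvPolynomial σ ℚ, m - C (constantCoeff m) ∈ ofList ws := fun m =>
      hXws (sub_C_constantCoeff_mem m)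
    rw [bot_sup_eq]
    by_cases h0 : constantCoeff m₁ = 0
    · refine ⟨1, 0, by simp, ?_⟩
      have := hmem m₁
      simpa [h0] using this
    · refine ⟨-constantCoeff m₂, constantCoeff m₁, Or.inr h0, ?_⟩
      have : -constantCoeff m₂ • m₁ + constantCoeff m₁ • m₂ =
          - C (constantCoeff m₂) * (m₁ - C (constantCoeff m₁)) +
          C (constantCoeff m₁) * (m₂ - C (constantCoeff m₂)) := by
        simp only [smul_eq_C_mul, map_neg]; ring
      rw [this]
      exact add_mem (mul_mem_left _ _ (hmem _)) (mul_mem_left _ _ (hmem _)))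
  rw [bot_sup_eq] at this
  exact this m₁ m₂ h₁ h₂

end Socle

end MvPolynomial

namespace MvPolynomial

open Ideal

variable {σ : Type*}

theorem mem_span_X_pow_iff {n : σ → ℕ} {f : MvPolynomial σ ℚ} :
    f ∈ span (Set.range fun i => (X i : MvPolynomial σ ℚ) ^ n i) ↔
      ∀ m ∈ f.support, ∃ i, n i ≤ m i := by
  have : (Set.range fun i => (X i : MvPolynomial σ ℚ) ^ n i) =
      (fun s => monomial s (1 : ℚ)) '' Set.range fun i => Finsupp.single i (n i) := by
    rw [← Set.range_comp]
    congr 1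
    ext1 i
    simp [X_pow_eq_monomial]
  rw [this, mem_ideal_span_monomial_image]
  simp

/-- The complete intersection of weighted homogeneous polynomials has a socle element of degree
the sum of the degrees of the relations minus the sum of the degrees of the generators. -/
theorem exists_socle_degree [Fintype σ] {w : σ → ℕ} (hw : ∀ i, 0 < w i) {us : List (MvPolynomial σ ℚ)}
    (h : (⊥ : Ideal (MvPolynomial σ ℚ)).RegSeq us) (hlen : us.length = Fintype.card σ)
    (hus : ∀ u ∈ us, constantCoeff u = 0) (D : MvPolynomial σ ℚ → ℕ)
    (hD : ∀ u ∈ us, u.IsWeightedHomogeneous w (D u)) :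
    ∃ (m : MvPolynomial σ ℚ) (N : ℕ), m.IsWeightedHomogeneous w N ∧ m ∉ ofList us ∧
      (N : ℤ) + ∑ i, (w i : ℤ) = (us.map fun u => (D u : ℤ)).sum := by
  classical
  -- The powers `X i ^ n i` share the degree `d`, so their span `W` is homogeneous, and passing from
  -- an element of `W` back to `u` shifts the socle degree by `D u - d`.
  let d := ∏ i, w i
  let n : σ → ℕ := fun i => ∏ j ∈ Finset.univ.erase i, w j
  have hn : ∀ i, n i * w i = d := fun i => Finset.prod_erase_mul _ _ (Finset.mem_univ i)
  have hn0 : ∀ i, 0 < n i := fun i => Finset.prod_pos fun j _ => hw j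
  let W : Submodule ℚ (MvPolynomial σ ℚ) := Submodule.span ℚ (Set.range fun i => X i ^ n i)
  have hWd : ∀ a ∈ W, a.IsWeightedHomogeneous w d := by
    have : W ≤ weightedHomogeneousSubmodule ℚ w d := by
      refine Submodule.span_le.2 ?_
      rintro _ ⟨i, rfl⟩
      have := (isWeightedHomogeneous_X ℚ w i).pow (n i)
      rwa [smul_eq_mul, hn] at this
    exact this
  have hWspan : span (W : Set (MvPolynomial σ ℚ)) =
      span (Set.range fun i => (X i : MvPolynomial σ ℚ) ^ n i) := by
    refine le_antisymm (span_le.2 fun x hx => ?_) (span_mono Submodule.subset_span)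
    exact Submodule.span_le_restrictScalars ℚ (MvPolynomial σ ℚ) _ hx
  have hWX : span (Set.range (X : σ → MvPolynomial σ ℚ)) ≤
      (span (W : Set (MvPolynomial σ ℚ))).radical := by
    rw [span_le]
    rintro _ ⟨i, rfl⟩
    exact ⟨n i, subset_span (Submodule.subset_span ⟨i, rfl⟩)⟩
  let P : ℤ → Ideal (MvPolynomial σ ℚ) → Prop := fun z J => ∃ (m : MvPolynomial σ ℚ) (N : ℕ),
    m.IsWeightedHomogeneous w N ∧ (N : ℤ) = z ∧ m ∉ J ∧ ∀ i, X i * m ∈ J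
  obtain ⟨ws, hl, hW, hreg, hP⟩ := h.exchange W (WHomog w) P (fun u => (D u : ℤ) - d)
    (fun u hu => hWX (mem_span_X_iff.2 (hus u hu))) whomog_bot
    (fun J hJ a ha => hJ.sup_span_singleton (hWd a ha))
    (fun J hJ u hu => hJ.sup_span_singleton (hD u hu)) (by
      rintro J z u hu a ha hJ hregu hrega ⟨m, N, hm, hN, hmJ, hsoc⟩
      have hmul : ∀ b ∈ span (Set.range (X : σ → MvPolynomial σ ℚ)), b * m ∈ J ⊔ span {a} := by
        intro b hb
        induction hb using Submodule.span_induction with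
        | mem x hx => obtain ⟨i, rfl⟩ := hx; exact hsoc i
        | zero => simp
        | add x y _ _ hx hy => rw [add_mul]; exact add_mem hx hy
        | smul c x _ hx => rw [smul_eq_mul, mul_assoc]; exact mul_mem_left _ _ hx
      obtain ⟨m', hm'⟩ := mem_sup_span_singleton_iff.1 (hmul u (mem_span_X_iff.2 (hus u hu)))
      have hcomp := hJ _ hm' (D u + N)
      rw [map_sub, ((hD u hu).mul hm).weightedHomogeneousComponent_same] at hcomp
      -- If so, no multiple of `a` reaches this degree, so `u * m` lies in `J`, and regularity of
      -- `u` puts `m` in `J`.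
      by_cases hlt : D u + N < d
      · rw [weightedHomogeneousComponent_mul_eq_zero (hWd a ha) _ hlt, sub_zero] at hcomp
        exact absurd (le_sup_left (a := J) (hregu m hcomp)) hmJ
      · obtain ⟨N', hN'⟩ := Nat.exists_eq_add_of_le (not_lt.1 hlt)
        rw [hN', weightedHomogeneousComponent_mul_left (hWd a ha)] at hcomp
        refine ⟨weightedHomogeneousComponent w N' m', N',
          weightedHomogeneousComponent_isWeightedHomogeneous _ _, by omega, fun hmem => hmJ ?_,
          fun i => hrega.exchange_mem hcomp (hsoc i)⟩
        have := hregu.exchange_mem (m' := m) (m := weightedHomogeneousComponent w N' m') (w := a)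
          (y := 1) (by rw [← neg_mem_iff]; simpa using hcomp) (by simpa using hmem)
        simpa using this)
  have hker : ofList ws ≤ span (Set.range fun i => (X i : MvPolynomial σ ℚ) ^ n i) := by
    rw [← hWspan]
    exact span_mono fun x hx => hW x hx
  have : FiniteDimensional ℚ W := FiniteDimensional.span_of_finite ℚ (Set.finite_range _)
  have hle := hreg.le_of_finrank_le W hW (by
    rw [bot_sup_eq]
    refine ne_top_of_le_ker (hker.trans (span_le.2 ?_))
    rintro _ ⟨i, rfl⟩
    simp [(hn0 i).ne']) (by
      rw [hl, hlen]
      exact finrank_range_le_card _)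
  have hle' : span (Set.range fun i => (X i : MvPolynomial σ ℚ) ^ n i) ≤ ofList ws := by
    refine span_le.2 fun x hx => ?_
    have := hle (Submodule.subset_span hx)
    simpa using this
  -- The monomial that spans the socle modulo all `X i ^ n i`. The truncated subtraction is harmless
  -- since `n i` is positive.
  let e : σ →₀ ℕ := Finsupp.equivFunOnFinite.symm fun i => n i - 1
  have hweight : (Finsupp.weight w e : ℤ) = ∑ i, ((d : ℤ) - w i) := by
    rw [Finsupp.weight_eq_sum, Nat.cast_sum]
    refine Finset.sum_congr rfl fun i _ => ?_
    have h1 := hn0 i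
    simp only [e, Finsupp.equivFunOnFinite_symm_apply_apply, smul_eq_mul]
    rw [← hn i]
    push_cast [Nat.cast_sub h1]
    ring
  obtain ⟨m, N, h1, h2, h3, -⟩ := hP (Finsupp.weight w e : ℕ) ⟨monomial e 1, Finsupp.weight w e,
    isWeightedHomogeneous_monomial _ _ _ rfl, rfl, fun hmem => by
      rw [bot_sup_eq] at hmem
      obtain ⟨i, hi⟩ := mem_span_X_pow_iff.1 (hker hmem) e (by simp)
      have := hn0 i
      simp [e] at hi
      omega, fun i => by
      rw [bot_sup_eq]
      refine hle' (mem_span_X_pow_iff.2 fun m hm => ⟨i, ?_⟩)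
      rw [X, monomial_mul] at hm
      have := Finset.mem_singleton.1 (support_monomial_subset hm)
      have := hn0 i
      subst m
      simp [e]
      omega⟩
  rw [bot_sup_eq] at h3
  refine ⟨m, N, h1, h3, ?_⟩
  rw [h2, hweight]
  have : (us.map fun u => (D u : ℤ) - d).sum = (us.map fun u => (D u : ℤ)).sum -
      us.length * d := by
    clear * -
    induction us with
    | nil => simp
    | cons u us ih => simp only [List.map_cons, List.sum_cons, ih, List.length_cons]; push_cast; ring
  rw [this, hlen]
  simp

end MvPolynomial

/-! ### Formal dimension and Poincaré duality -/

namespace PositivelyElliptic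

open MvPolynomial Ideal

variable (H : PositivelyElliptic)

theorem ofList_rel : ofList (List.ofFn H.rel) = H.relIdeal := by
  rw [ofList, relIdeal]
  congr 1
  ext x
  simp [List.mem_ofFn]

theorem regSeq : (⊥ : Ideal (MvPolynomial (Fin H.k) ℚ)).RegSeq (List.ofFn H.rel) :=
  (isRegular_iff_regSeq.1 H.regular).1

theorem relIdeal_ne_top : H.relIdeal ≠ ⊤ := by
  rw [← ofList_rel]
  exact (isRegular_iff_regSeq.1 H.regular).2

theorem rel_mem (i : Fin H.k) : H.rel i ∈ H.relIdeal := subset_span ⟨i, rfl⟩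

theorem weight_eq_zero {m : Fin H.k →₀ ℕ} (h : Finsupp.weight H.deg m = 0) : m = 0 := by
  rw [Finsupp.weight_eq_sum, Finset.sum_eq_zero_iff] at h
  ext i
  simpa [(H.deg_pos i).ne'] using h i (Finset.mem_univ i)

theorem degree_le_weight (m : Fin H.k →₀ ℕ) : m.degree ≤ Finsupp.weight H.deg m := by
  rw [Finsupp.weight_eq_sum, Finsupp.degree_eq_sum]
  exact Finset.sum_le_sum fun i _ => Nat.le_mul_of_pos_right _ (H.deg_pos i)

variable {H} in
theorem eq_C_of_isWeightedHomogeneous_zero {f : MvPolynomial (Fin H.k) ℚ}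
    (hf : f.IsWeightedHomogeneous H.deg 0) : f = C (constantCoeff f) := by
  ext m
  rw [coeff_C]
  split_ifs with h
  · rw [← h, constantCoeff_eq]
  · by_contra h'
    exact h (H.weight_eq_zero (hf h')).symm

theorem constantCoeff_rel (i : Fin H.k) : constantCoeff (H.rel i) = 0 := by
  by_contra h
  have h0 : H.relDeg i = 0 := by
    have := H.homogeneous i (d := 0) (by rwa [← constantCoeff_eq])
    simpa using this.symm
  have h1 := H.homogeneous i
  rw [h0] at h1
  refine H.relIdeal_ne_top (eq_top_of_isUnit_mem _ (H.rel_mem i) ?_)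
  rw [eq_C_of_isWeightedHomogeneous_zero h1]
  exact (isUnit_iff_ne_zero.2 h).map C

/-- The relations are not contained in an ideal with fewer than `k` generators. -/
theorem not_rel_mem_span (S : Finset (MvPolynomial (Fin H.k) ℚ)) (hS : S.card < H.k)
    (h0 : ∀ s ∈ S, constantCoeff s = 0)
    (h : ∀ i, H.rel i ∈ span (S : Set (MvPolynomial (Fin H.k) ℚ))) : False := by
  have := H.regSeq.length_le_card ℚ S (by
    intro u hu
    obtain ⟨i, rfl⟩ := List.mem_ofFn.1 hu
    exact h i) (ne_top_of_le_ker (span_le.2 h0))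
  rw [List.length_ofFn] at this
  omega

theorem rel_ne_zero (i : Fin H.k) : H.rel i ≠ 0 := by
  classical
  intro h
  refine H.not_rel_mem_span ((Finset.univ.erase i).image H.rel) ?_ ?_ fun j => ?_
  · have := (Finset.univ.erase i).card_image_le (f := H.rel)
    rw [Finset.card_erase_of_mem (Finset.mem_univ i), Finset.card_univ, Fintype.card_fin] at this
    have := i.2
    omega
  · simp only [Finset.mem_image]
    rintro _ ⟨j, -, rfl⟩
    exact H.constantCoeff_rel j
  · by_cases hj : j = i
    · rw [hj, h]; exact zero_mem _
    · exact subset_span (Finset.mem_image_of_mem _ (Finset.mem_erase.2 ⟨hj, Finset.mem_univ j⟩))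

theorem relDeg_pos (i : Fin H.k) : 0 < H.relDeg i := by
  rw [Nat.pos_iff_ne_zero]
  intro h
  have h1 := H.homogeneous i
  rw [h] at h1
  refine H.rel_ne_zero i ?_
  rw [eq_C_of_isWeightedHomogeneous_zero h1, H.constantCoeff_rel, map_zero]

theorem exists_mem_support (i : Fin H.k) : ∃ m ∈ (H.rel i).support,
    Finsupp.weight H.deg m = H.relDeg i := by
  obtain ⟨m, hm⟩ := support_nonempty.2 (H.rel_ne_zero i)
  exact ⟨m, hm, H.homogeneous i (mem_support_iff.1 hm)⟩

theorem even_weight (m : Fin H.k →₀ ℕ) : Even (Finsupp.weight H.deg m) := by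
  rw [Finsupp.weight_eq_sum]
  exact Finset.even_sum _ fun i _ => (H.deg_even i).mul_left _

theorem even_relDeg (i : Fin H.k) : Even (H.relDeg i) := by
  obtain ⟨m, -, hm⟩ := H.exists_mem_support i
  exact hm ▸ H.even_weight m

theorem whomog_relIdeal : WHomog H.deg H.relIdeal := by
  rw [← ofList_rel, ← bot_sup_eq (ofList _)]
  refine whomog_bot.sup_ofList fun a ha => ?_
  obtain ⟨i, rfl⟩ := List.mem_ofFn.1 ha
  exact ⟨_, H.homogeneous i⟩

instance finite_alg : Module.Finite ℚ H.Alg := by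
  have := finite_quotient_of_regSeq H.regSeq (by simp)
  rwa [ofList_rel] at this

/-- The quotient map. -/
noncomputable abbrev toAlg : MvPolynomial (Fin H.k) ℚ →ₐ[ℚ] H.Alg := Ideal.Quotient.mkₐ ℚ H.relIdeal

variable {H}

theorem toAlg_eq_zero_iff {f : MvPolynomial (Fin H.k) ℚ} : H.toAlg f = 0 ↔ f ∈ H.relIdeal :=
  Quotient.eq_zero_iff_mem

theorem toAlg_surjective : Function.Surjective H.toAlg := Ideal.Quotient.mk_surjective

theorem toAlg_mem_grade {n : ℕ} {f : MvPolynomial (Fin H.k) ℚ}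
    (hf : f.IsWeightedHomogeneous H.deg n) : H.toAlg f ∈ H.grade n := ⟨f, hf, rfl⟩

theorem grade_ne_bot_iff {n : ℕ} : H.grade n ≠ ⊥ ↔
    ∃ f : MvPolynomial (Fin H.k) ℚ, f.IsWeightedHomogeneous H.deg n ∧ f ∉ H.relIdeal := by
  rw [Submodule.ne_bot_iff]
  constructor
  · rintro ⟨_, ⟨f, hf, rfl⟩, h⟩
    exact ⟨f, hf, fun h' => h (toAlg_eq_zero_iff.2 h')⟩
  · rintro ⟨f, hf, h⟩
    exact ⟨_, toAlg_mem_grade hf, fun h' => h (toAlg_eq_zero_iff.1 h')⟩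

variable (H) in
theorem exists_forall_mem : ∃ N, ∀ n, N ≤ n → ∀ f : MvPolynomial (Fin H.k) ℚ,
    f.IsWeightedHomogeneous H.deg n → f ∈ H.relIdeal :=
  exists_forall_mem_of_finite H.whomog_relIdeal

variable (H) in
theorem bddAbove_grade : BddAbove {n | H.grade n ≠ ⊥} := by
  obtain ⟨N, hN⟩ := H.exists_forall_mem
  refine ⟨N, fun n hn => ?_⟩
  obtain ⟨f, hf, hf'⟩ := grade_ne_bot_iff.1 hn
  by_contra h
  exact hf' (hN n (by omega) f hf)

theorem le_formalDim {n : ℕ} {f : MvPolynomial (Fin H.k) ℚ}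
    (hf : f.IsWeightedHomogeneous H.deg n) (hf' : f ∉ H.relIdeal) : n ≤ H.formalDim :=
  le_csSup H.bddAbove_grade (grade_ne_bot_iff.2 ⟨f, hf, hf'⟩)

theorem mem_relIdeal_of_formalDim_lt {n : ℕ} {f : MvPolynomial (Fin H.k) ℚ}
    (hf : f.IsWeightedHomogeneous H.deg n) (hn : H.formalDim < n) : f ∈ H.relIdeal := by
  by_contra h
  exact absurd (le_formalDim hf h) (not_le.2 hn)

variable (H) in
theorem exists_top : ∃ f : MvPolynomial (Fin H.k) ℚ,
    f.IsWeightedHomogeneous H.deg H.formalDim ∧ f ∉ H.relIdeal := by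
  refine grade_ne_bot_iff.1 (Nat.sSup_mem ⟨0, grade_ne_bot_iff.2 ⟨1, ?_, ?_⟩⟩ H.bddAbove_grade)
  · exact isWeightedHomogeneous_one ℚ H.deg
  · exact fun h => H.relIdeal_ne_top ((eq_top_iff_one _).2 h)

variable (H) in
theorem sum_relDeg_le : ∑ i, H.relDeg i ≤ H.formalDim + ∑ i, H.deg i := by
  classical
  -- `exists_socle_degree` takes degrees as a function of the polynomial, not of its index; the
  -- weighted total degree provides one.
  have hD : ∀ i, weightedTotalDegree H.deg (H.rel i) = H.relDeg i := fun i => by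
    have := (H.homogeneous i).weighted_total_degree (H.rel_ne_zero i)
    rw [weightedTotalDegree_coe _ _ (H.rel_ne_zero i)] at this
    exact_mod_cast this
  obtain ⟨m, N, h1, h2, h3⟩ := exists_socle_degree H.deg_pos H.regSeq (by simp)
    (by
      intro u hu
      obtain ⟨i, rfl⟩ := List.mem_ofFn.1 hu
      exact H.constantCoeff_rel i)
    (weightedTotalDegree H.deg) (by
      intro u hu
      obtain ⟨i, rfl⟩ := List.mem_ofFn.1 hu
      rw [hD]
      exact H.homogeneous i)
  rw [ofList_rel] at h2
  have h4 := le_formalDim h1 h2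
  rw [List.map_ofFn, List.sum_ofFn] at h3
  simp only [Function.comp_apply, hD] at h3
  have : (N + ∑ i, H.deg i : ℕ) = ∑ i, H.relDeg i := by exact_mod_cast h3
  omega

/-- Poincaré duality. Multiplying `x` by generators as long as the product survives leads to a
non-zero socle element. A top class is also in the socle, which is a line, so the two are
proportional. -/
theorem exists_mul_top {x : H.Alg} (hx : x ≠ 0) : ∃ (g : H.Alg) (f : MvPolynomial (Fin H.k) ℚ),
    f.IsWeightedHomogeneous H.deg H.formalDim ∧ f ∉ H.relIdeal ∧ H.toAlg f = x * g := by
  obtain ⟨g, hg, hsoc⟩ : ∃ g, x * g ≠ 0 ∧ ∀ i, H.toAlg (X i) * (x * g) = 0 := by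
    by_contra! hcon
    obtain ⟨N, hN⟩ := H.exists_forall_mem
    have : ∀ n, ∃ m : Fin H.k →₀ ℕ, m.degree = n ∧ x * H.toAlg (monomial m 1) ≠ 0 := by
      intro n
      induction n with
      | zero => exact ⟨0, by simp, by simpa [C_1] using hx⟩
      | succ n ih =>
        obtain ⟨m, hm, hne⟩ := ih
        obtain ⟨i, hi⟩ := hcon _ hne
        refine ⟨Finsupp.single i 1 + m, ?_, ?_⟩
        · rw [map_add, hm, Finsupp.degree_single, add_comm]
        · have : monomial (Finsupp.single i 1 + m) (1 : ℚ) = X i * monomial m 1 := by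
            rw [X, monomial_mul, one_mul]
          rw [this, map_mul]
          convert! hi using 1
          ring
    obtain ⟨m, hm, hne⟩ := this N
    refine hne ?_
    rw [toAlg_eq_zero_iff.2 (hN _ (hm ▸ H.degree_le_weight m) _
      (isWeightedHomogeneous_monomial _ _ _ rfl)), mul_zero]
  obtain ⟨h, hh⟩ := toAlg_surjective (x * g)
  obtain ⟨f, hf, hfI⟩ := H.exists_top
  have hhI : h ∉ H.relIdeal := fun h' => hg (hh ▸ toAlg_eq_zero_iff.2 h')
  obtain ⟨α, β, hαβ, hmem⟩ := socle_dependent H.regSeq (by simp) (by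
      intro u hu
      obtain ⟨i, rfl⟩ := List.mem_ofFn.1 hu
      exact H.constantCoeff_rel i) (m₁ := h) (m₂ := f) (by
      intro i
      rw [ofList_rel, ← toAlg_eq_zero_iff, map_mul, hh]
      exact hsoc i) (by
      intro i
      rw [ofList_rel]
      refine mem_relIdeal_of_formalDim_lt ((isWeightedHomogeneous_X ℚ H.deg i).mul hf) ?_
      have := H.deg_pos i
      omega)
  rw [ofList_rel] at hmem
  have hcancel : ∀ (c : ℚ) (p : MvPolynomial (Fin H.k) ℚ), c ≠ 0 → c • p ∈ H.relIdeal →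
      p ∈ H.relIdeal := fun c p hc hp => by
    have := H.relIdeal.mul_mem_left (C c⁻¹) hp
    rwa [← smul_eq_C_mul, smul_smul, inv_mul_cancel₀ hc, one_smul] at this
  have hα : α ≠ 0 := by
    rintro rfl
    rw [zero_smul, zero_add] at hmem
    exact hfI (hcancel β f (by simpa using hαβ) hmem)
  have hβ : β ≠ 0 := by
    rintro rfl
    rw [zero_smul, add_zero] at hmem
    exact hhI (hcancel α h hα hmem)
  refine ⟨g, (-(β / α)) • f, ?_, fun h' => hfI (hcancel _ _ (by simp [hα, hβ]) h'), ?_⟩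
  · rw [smul_eq_C_mul]
    exact hf.C_mul _
  · rw [← hh]
    have : h - (-(β / α)) • f = α⁻¹ • (α • h + β • f) := by
      rw [smul_add, smul_smul, smul_smul, inv_mul_cancel₀ hα, one_smul, neg_smul, sub_neg_eq_add,
        inv_mul_eq_div]
    have h1 : h - (-(β / α)) • f ∈ H.relIdeal := by
      rw [this, smul_eq_C_mul]
      exact mul_mem_left _ _ hmem
    have h2 := toAlg_eq_zero_iff.2 h1
    rw [map_sub, sub_eq_zero] at h2
    exact h2.symm

/-! ### Derivations of negative degree -/

section Derivation

variable {δ : Derivation ℚ H.Alg H.Alg} {r : ℤ}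

theorem HasDegree.exists_lift (hδ : H.HasDegree δ r) {n : ℕ} {f : MvPolynomial (Fin H.k) ℚ}
    (hf : f.IsWeightedHomogeneous H.deg n) :
    ∃ g : MvPolynomial (Fin H.k) ℚ, H.toAlg g = δ (H.toAlg f) ∧
      ((n : ℤ) + r < 0 → g = 0) ∧ g.IsWeightedHomogeneous H.deg (n + r).toNat := by
  have := hδ n _ (toAlg_mem_grade hf)
  rw [gradeInt] at this
  split_ifs at this with h
  · obtain ⟨g, hg, hg'⟩ := this
    exact ⟨g, hg', fun h' => absurd h (not_le.2 h'), hg⟩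
  · rw [Submodule.mem_bot] at this
    exact ⟨0, by rw [this, map_zero], fun _ => rfl, isWeightedHomogeneous_zero _ _ _⟩

/-- The image of a derivation of negative degree has no component in the top degree. -/
theorem HasDegree.component_mem (hδ : H.HasDegree δ r) (hr : r < 0) {s : H.Alg}
    {f : MvPolynomial (Fin H.k) ℚ} (hf : H.toAlg f = δ s) :
    weightedHomogeneousComponent H.deg H.formalDim f ∈ H.relIdeal := by
  obtain ⟨p, rfl⟩ := toAlg_surjective s
  have key : ∃ g, H.toAlg g = δ (H.toAlg p) ∧
      weightedHomogeneousComponent H.deg H.formalDim g ∈ H.relIdeal := by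
    clear hf
    induction p using MvPolynomial.induction_on' with
    | monomial m c =>
      have hm := isWeightedHomogeneous_monomial (R := ℚ) H.deg m c rfl
      by_cases hlt : H.formalDim < Finsupp.weight H.deg m
      · refine ⟨0, ?_, by simp⟩
        rw [toAlg_eq_zero_iff.2 (mem_relIdeal_of_formalDim_lt hm hlt), map_zero, map_zero]
      · obtain ⟨g, hg, hg0, hgd⟩ := hδ.exists_lift hm
        refine ⟨g, hg, ?_⟩
        by_cases hneg : (Finsupp.weight H.deg m : ℤ) + r < 0
        · rw [hg0 hneg, map_zero]; exact zero_mem _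
        · rw [hgd.weightedHomogeneousComponent_ne _ (by omega)]
          exact zero_mem _
    | add p q hp hq =>
      obtain ⟨g, hg, hg'⟩ := hp
      obtain ⟨g', hg1, hg1'⟩ := hq
      refine ⟨g + g', by rw [map_add, map_add, map_add, hg, hg1], ?_⟩
      rw [map_add]
      exact add_mem hg' hg1'
  obtain ⟨g, hg, hgI⟩ := key
  have h1 : f - g ∈ H.relIdeal := by
    rw [← toAlg_eq_zero_iff, map_sub, hf, hg, sub_self]
  have h2 := H.whomog_relIdeal _ h1 H.formalDim
  rw [map_sub] at h2
  simpa using add_mem h2 hgI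

theorem apply_toAlg_C (δ : Derivation ℚ H.Alg H.Alg) (c : ℚ) : δ (H.toAlg (C c)) = 0 :=
  δ.map_algebraMap c

theorem apply_toAlg_C_mul (δ : Derivation ℚ H.Alg H.Alg) (c : ℚ) (x : H.Alg) :
    δ (H.toAlg (C c) * x) = H.toAlg (C c) * δ x := by
  rw [Derivation.leibniz, apply_toAlg_C, smul_zero, add_zero, smul_eq_mul]

/-- By Poincaré duality, integration by parts in the variable `t` kills `a * δ t`. -/
theorem HasDegree.mul_apply_eq_zero (hδ : H.HasDegree δ r) (hr : r < 0) {a : H.Alg}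
    (ha : δ a = 0) (B : Subalgebra ℚ H.Alg) (hB : ∀ b ∈ B, a * δ b = 0) (t : H.Alg)
    (hgen : ∀ i, H.toAlg (X i) ∈ Algebra.adjoin B {t}) : a * δ t = 0 := by
  by_contra hne
  obtain ⟨g, f, hf, hfI, hfg⟩ := exists_mul_top hne
  have htop : g ∈ Algebra.adjoin B {t} := by
    clear hfg
    obtain ⟨p, rfl⟩ := toAlg_surjective g
    induction p using MvPolynomial.induction_on with
    | C c =>
      have : H.toAlg (C c) = algebraMap B H.Alg (algebraMap ℚ B c) :=
        (H.toAlg.commutes c).trans (IsScalarTower.algebraMap_apply ℚ B H.Alg c)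
      rw [this]
      exact Subalgebra.algebraMap_mem _ _
    | add p q hp hq => rw [map_add]; exact add_mem (hp) (hq)
    | mul_X p i hp => rw [map_mul]; exact mul_mem (hp) (hgen i)
  suffices ∃ s, δ s = a * δ t * g by
    obtain ⟨s, hs⟩ := this
    have := hδ.component_mem hr (hfg.trans hs.symm)
    rw [hf.weightedHomogeneousComponent_same] at this
    exact hfI this
  rw [Algebra.adjoin_singleton_eq_range_aeval] at htop
  obtain ⟨p, rfl⟩ := htop
  clear hfg hfI hf
  induction p using Polynomial.induction_on' with
  | add p q hp hq =>
    obtain ⟨s, hs⟩ := hp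
    obtain ⟨s', hs'⟩ := hq
    refine ⟨s + s', ?_⟩
    rw [map_add, hs, hs', ← mul_add]
    exact congrArg (a * δ t * ·) (map_add (Polynomial.aeval t) p q).symm
  | monomial n b =>
    have hn : ((n + 1 : ℕ) : ℚ) ≠ 0 := by positivity
    -- The antiderivative of `a * b * t ^ n * δ t` in the variable `t`: both `δ a` and `a * δ b`
    -- vanish, so only `t` is differentiated.
    refine ⟨H.toAlg (C ((n + 1 : ℕ) : ℚ)⁻¹) * (a * b * t ^ (n + 1)), ?_⟩
    have hab : δ (a * b) = 0 := by
      rw [Derivation.leibniz, ha, smul_zero, add_zero, smul_eq_mul, hB b b.2]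
    have h1 : δ (a * b * t ^ (n + 1)) =
        H.toAlg (C ((n + 1 : ℕ) : ℚ)) * (a * δ t * (b * t ^ n)) := by
      rw [Derivation.leibniz, hab, smul_zero, add_zero, Derivation.leibniz_pow, smul_eq_mul,
        nsmul_eq_mul, smul_eq_mul, map_natCast, map_natCast, Nat.add_sub_cancel]
      ring
    have h2 : H.toAlg (C ((n + 1 : ℕ) : ℚ)⁻¹) * H.toAlg (C ((n + 1 : ℕ) : ℚ)) = 1 := by
      rw [← map_mul, ← map_mul, inv_mul_cancel₀ hn, map_one, map_one]
    have h3 : Polynomial.aeval t (Polynomial.monomial n b) = (b : H.Alg) * t ^ n :=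
      Polynomial.aeval_monomial _
    rw [apply_toAlg_C_mul, h1, ← mul_assoc, h2, one_mul]
    exact congrArg (a * δ t * ·) h3.symm

/-- A derivation of negative degree that is killed by all elements of a generating set except
one is zero. -/
theorem HasDegree.eq_zero_of_generators (hδ : H.HasDegree δ r) (hr : r < 0) (B : Subalgebra ℚ H.Alg)
    (hB : ∀ b ∈ B, δ b = 0) (t : H.Alg) (hgen : ∀ i, H.toAlg (X i) ∈ Algebra.adjoin B {t}) :
    δ t = 0 := by
  have := hδ.mul_apply_eq_zero hr (a := 1) (by simp) B (by simpa using hB) t hgen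
  simpa using this

theorem eq_zero_of_forall_X (h : ∀ i, δ (H.toAlg (X i)) = 0) : δ = 0 := by
  ext x
  obtain ⟨p, rfl⟩ := toAlg_surjective x
  induction p using MvPolynomial.induction_on with
  | C c => exact δ.map_algebraMap c
  | add p q hp hq => simp only [map_add, hp, hq]
  | mul_X p i hp => rw [map_mul, Derivation.leibniz, hp, h i]; simp

theorem HasDegree.eq_zero_of_forall_ne (hδ : H.HasDegree δ r) (hr : r < 0) (j : Fin H.k)
    (h : ∀ i, i ≠ j → δ (H.toAlg (X i)) = 0) : δ = 0 := by
  refine eq_zero_of_forall_X fun i => ?_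
  by_cases hij : i = j
  · subst hij
    let B : Subalgebra ℚ H.Alg := Algebra.adjoin ℚ {x | δ x = 0}
    refine hδ.eq_zero_of_generators hr B ?_ _ fun l => ?_
    · intro b hb
      induction hb using Algebra.adjoin_induction with
      | mem x hx => exact hx
      | algebraMap c => exact δ.map_algebraMap c
      | add x y _ _ hx hy => rw [map_add, hx, hy, add_zero]
      | mul x y _ _ hx hy => rw [Derivation.leibniz, hx, hy]; simp
    · by_cases hl : l = i
      · rw [hl]; exact Algebra.subset_adjoin rfl
      · exact Subalgebra.algebraMap_mem (Algebra.adjoin B {H.toAlg (X i)})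
          ⟨_, Algebra.subset_adjoin (h l hl)⟩
  · exact h i hij

variable (H) in
theorem isNilpotent_toAlg_X (i : Fin H.k) : IsNilpotent (H.toAlg (X i)) := by
  obtain ⟨N, hN⟩ := H.exists_forall_mem
  refine ⟨N, ?_⟩
  rw [← map_pow, toAlg_eq_zero_iff]
  exact hN _ (Nat.le_mul_of_pos_right _ (H.deg_pos i)) _ ((isWeightedHomogeneous_X ℚ H.deg i).pow N)

/-- Differentiating `x ^ n = 0` for the least such `n` gives `n * c * x ^ (n - 1) = 0`, so `c` must
be zero. Thus no generator is sent to a non-zero constant. -/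
theorem apply_eq_zero_of_isNilpotent {x : H.Alg} (hx : IsNilpotent x) {c : ℚ}
    (h : δ x = H.toAlg (C c)) : δ x = 0 := by
  classical
  have : Nontrivial H.Alg := Ideal.Quotient.nontrivial_iff.2 H.relIdeal_ne_top
  have hn := Nat.find_spec hx
  have hmin := fun m => Nat.find_min hx (m := m)
  generalize Nat.find hx = n at hn hmin
  cases n with
  | zero => simp at hn
  | succ n =>
    have h1 := δ.leibniz_pow x (n + 1)
    rw [hn, map_zero, h] at h1
    rw [Nat.add_sub_cancel, nsmul_eq_mul, smul_eq_mul] at h1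
    by_contra hne
    have hc : c ≠ 0 := by
      rintro rfl
      rw [h, map_zero, map_zero] at hne
      exact hne rfl
    have hn : ((n + 1 : ℕ) : ℚ) * c ≠ 0 := mul_ne_zero (by positivity) hc
    refine hmin n (by omega) ?_
    have h2 : H.toAlg (C (((n + 1 : ℕ) : ℚ) * c)⁻¹) * H.toAlg (C (((n + 1 : ℕ) : ℚ) * c)) = 1 := by
      rw [← map_mul, ← map_mul, inv_mul_cancel₀ hn, map_one, map_one]
    rw [← one_mul (x ^ n), ← h2, mul_assoc]
    have h3 : H.toAlg (C (((n + 1 : ℕ) : ℚ) * c)) * x ^ n = 0 := by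
      rw [h1, C_mul, map_mul, map_natCast, map_natCast]
      ring
    rw [h3, mul_zero]

end Derivation

end PositivelyElliptic

/-! ### Counting generators in a pure model -/

namespace PositivelyElliptic

open MvPolynomial Ideal

variable {H : PositivelyElliptic}

/-- At least `k` generators are needed for an ideal containing all relations. -/
theorem not_rel_mem_span_union (A : Finset (Fin H.k)) (E : Finset (MvPolynomial (Fin H.k) ℚ))
    (B : Finset (Fin H.k)) (hcard : A.card + E.card + B.card < H.k)
    (hE : ∀ e ∈ E, constantCoeff e = 0)
    (h : ∀ i ∉ B, H.rel i ∈ span (X '' A ∪ (E : Set (MvPolynomial (Fin H.k) ℚ)) ∪ H.rel '' B)) :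
    False := by
  classical
  refine H.not_rel_mem_span (A.image X ∪ E ∪ B.image H.rel) ?_ ?_ fun i => ?_
  · have h1 := Finset.card_union_le (A.image X ∪ E) (B.image H.rel)
    have h2 := Finset.card_union_le (A.image X) E
    have h3 := A.card_image_le (f := (X : Fin H.k → MvPolynomial (Fin H.k) ℚ))
    have h4 := B.card_image_le (f := H.rel)
    omega
  · intro s hs
    simp only [Finset.mem_union, Finset.mem_image] at hs
    rcases hs with (⟨j, -, rfl⟩ | hs) | ⟨j, -, rfl⟩
    · exact constantCoeff_X _ _
    · exact hE s hs
    · exact H.constantCoeff_rel j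
  · simp only [Finset.coe_union, Finset.coe_image]
    by_cases hi : i ∈ B
    · exact subset_span (Or.inr ⟨i, hi, rfl⟩)
    · exact h i hi

theorem mem_span_of_support {A : Set (Fin H.k)} {S : Set (MvPolynomial (Fin H.k) ℚ)}
    {f : MvPolynomial (Fin H.k) ℚ} (hS : X '' A ⊆ S)
    (h : ∀ m ∈ f.support, ∃ j ∈ A, m j ≠ 0) : f ∈ span S :=
  span_mono hS (mem_ideal_span_X_image.2 h)

/-- If this failed, the relations up to the `i`-th would have no room for two factors `x_j` with `j
≥ i`, so they would lie in the ideal of the generators before `x_i`. Together with the relations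
after the `i`-th that makes only `k - 1` elements. -/
theorem IsPureModel.two_mul_deg_le (hH : H.IsPureModel) (i : Fin H.k) :
    2 * H.deg i ≤ H.relDeg i := by
  by_contra! hlt
  refine not_rel_mem_span_union (H := H) (Finset.Iio i) ∅ (Finset.Ioi i) ?_ (by simp) ?_
  · rw [Fin.card_Iio, Fin.card_Ioi, Finset.card_empty]
    omega
  · intro j hj
    have hji : j ≤ i := by simpa using hj
    refine mem_span_of_support (A := (Finset.Iio i : Finset (Fin H.k)))
      (Set.subset_union_left.trans Set.subset_union_left) fun m hm => ?_
    by_contra! hcon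
    have h1 := hH.two_le_degree j m hm
    have h2 := H.homogeneous j (mem_support_iff.1 hm)
    have h3 : m.degree * H.deg i ≤ H.relDeg j := by
      rw [← h2, Finsupp.weight_eq_sum, Finsupp.degree_eq_sum, Finset.sum_mul]
      refine Finset.sum_le_sum fun l _ => ?_
      by_cases hl : l < i
      · rw [hcon l (by simpa using hl)]; simp
      · exact Nat.mul_le_mul_left _ (hH.deg_mono (not_lt.1 hl))
    have h4 := hH.relDeg_mono hji
    have h5 := Nat.mul_le_mul_right (H.deg i) h1
    omega

end PositivelyElliptic

/-! ### Koszul syzygies and freeness over a subalgebra -/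

namespace Ideal

section RegSeqMaps

variable {R A : Type*} [CommRing R] [CommRing A]

theorem RegSeq.of_retract (f : A →+* R) (ρ : R →+* A) (hρ : ∀ a, ρ (f a) = a) {J : Ideal A}
    {l : List A} (h : (J.map f).RegSeq (l.map f)) : J.RegSeq l := by
  induction l generalizing J with
  | nil => trivial
  | cons a l ih =>
    refine ⟨fun m hm => ?_, ih ?_⟩
    · have h1 := h.1 (f m) (by rw [← map_mul]; exact mem_map_of_mem f hm)
      have h2 := mem_map_of_mem ρ h1
      rw [map_map, hρ, show ρ.comp f = RingHom.id A from RingHom.ext hρ, map_id] at h2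
      exact h2
    · rw [Ideal.map_sup, map_span, Set.image_singleton]
      exact h.2

theorem RegSeq.map_of_surjective (f : R →+* A) (hf : Function.Surjective f) {J : Ideal A}
    {l : List R} (h : (J.comap f).RegSeq l) : J.RegSeq (l.map f) := by
  induction l generalizing J with
  | nil => trivial
  | cons a l ih =>
    refine ⟨fun m hm => ?_, ih ?_⟩
    · obtain ⟨m, rfl⟩ := hf m
      exact h.1 m (by rw [mem_comap, map_mul]; exact hm)
    · have : (J ⊔ span {f a}).comap f = J.comap f ⊔ span {a} := by
        ext x
        rw [mem_comap, mem_sup_span_singleton_iff, mem_sup_span_singleton_iff]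
        constructor
        · rintro ⟨b, hb⟩
          obtain ⟨b, rfl⟩ := hf b
          exact ⟨b, by rw [mem_comap, map_sub, map_mul]; exact hb⟩
        · rintro ⟨b, hb⟩
          exact ⟨f b, by rwa [mem_comap, map_sub, map_mul] at hb⟩
      rw [this]
      exact h.2

theorem ofList_ofFn {n : ℕ} (w : Fin n → R) : ofList (List.ofFn w) = span (Set.range w) := by
  rw [ofList]
  congr 1
  ext x
  simp [List.mem_ofFn]

theorem mem_sup_span_range_iff {J : Ideal R} {n : ℕ} {w : Fin n → R} {x : R} :
    x ∈ J ⊔ span (Set.range w) ↔ ∃ c : Fin n → R, x - ∑ i, w i * c i ∈ J := by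
  constructor
  · intro h
    obtain ⟨j, hj, y, hy, rfl⟩ := Submodule.mem_sup.1 h
    obtain ⟨c, rfl⟩ := mem_span_range_iff_exists_fun.1 hy
    exact ⟨c, by simpa [mul_comm] using hj⟩
  · rintro ⟨c, hc⟩
    have : x = (x - ∑ i, w i * c i) + ∑ i, w i * c i := by ring
    rw [this]
    have h1 : ∑ i, w i * c i ∈ span (Set.range w) :=
      _root_.sum_mem fun i _ => mul_mem_right _ _ (subset_span (Set.mem_range_self i))
    exact add_mem (le_sup_left (a := J) hc) (le_sup_right (a := J) h1)

/-- The syzygies of a regular sequence are generated by the Koszul relations. -/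
theorem RegSeq.koszul {N : Type*} [AddCommGroup N] {J : Ideal R} {n : ℕ} {w : Fin n → R}
    (h : J.RegSeq (List.ofFn w)) (φ : Fin n → R →+ N)
    (hφ : ∀ i j g, φ i (w j * g) = φ j (w i * g)) (hφJ : ∀ i, ∀ g ∈ J, φ i g = 0)
    {g : Fin n → R} (hg : ∑ i, w i * g i ∈ J) : ∑ i, φ i (g i) = 0 := by
  induction n with
  | zero => simp
  | succ n ih =>
    rw [List.ofFn_succ', List.concat_eq_append, regSeq_append, ofList_ofFn] at h
    obtain ⟨h1, h2, -⟩ := h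
    -- Regularity of the last element makes its coefficient a combination of the other elements.
    -- Substituting it leaves a syzygy of the first `n`, and the symmetry of `φ` absorbs the
    -- difference.
    obtain ⟨c, hc⟩ := mem_sup_span_range_iff.1 (h2 (g (Fin.last n))
      (mem_sup_span_range_iff.2 ⟨fun i => - g i.castSucc, by
        rw [Fin.sum_univ_castSucc] at hg
        simpa [add_comm] using hg⟩))
    have h3 := ih h1 (fun i => φ i.castSucc) (fun i j => hφ _ _) (fun i => hφJ _)
      (g := fun i => g i.castSucc + w (Fin.last n) * c i) (by
        rw [Fin.sum_univ_castSucc] at hg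
        have : ∑ i : Fin n, w i.castSucc * (g i.castSucc + w (Fin.last n) * c i) =
            (∑ i : Fin n, w i.castSucc * g i.castSucc + w (Fin.last n) * g (Fin.last n)) -
            w (Fin.last n) * (g (Fin.last n) - ∑ i : Fin n, w i.castSucc * c i) := by
          rw [mul_sub, Finset.mul_sum]
          simp only [mul_add, Finset.sum_add_distrib]
          rw [add_sub_assoc, sub_sub_cancel]
          congr 1
          exact Finset.sum_congr rfl fun i _ => by ring
        rw [this]
        exact sub_mem hg (mul_mem_left _ _ hc))
    have h4 : φ (Fin.last n) (g (Fin.last n)) =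
        ∑ i : Fin n, φ i.castSucc (w (Fin.last n) * c i) := by
      have := hφJ (Fin.last n) _ hc
      rw [map_sub, sub_eq_zero, map_sum] at this
      rw [this]
      exact Finset.sum_congr rfl fun i _ => hφ _ _ _
    rw [Fin.sum_univ_castSucc, h4, ← Finset.sum_add_distrib, ← h3]
    exact Finset.sum_congr rfl fun i _ => (map_add _ _ _).symm

end RegSeqMaps

end Ideal

namespace MvPolynomial

open Ideal

theorem IsWeightedHomogeneous.aeval {σ τ : Type*} {w : σ → ℕ} {w' : τ → ℕ}
    {g : σ → MvPolynomial τ ℚ} (hg : ∀ i, (g i).IsWeightedHomogeneous w' (w i))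
    {f : MvPolynomial σ ℚ} {n : ℕ} (hf : f.IsWeightedHomogeneous w n) :
    (MvPolynomial.aeval g f).IsWeightedHomogeneous w' n := by
  rw [MvPolynomial.aeval_def, eval₂_eq]
  refine IsWeightedHomogeneous.sum _ _ _ fun m hm => ?_
  have h1 : (∏ i ∈ m.support, g i ^ m i).IsWeightedHomogeneous w' (∑ i ∈ m.support, m i • w i) :=
    IsWeightedHomogeneous.prod _ _ _ fun i _ => (hg i).pow (m i)
  have h2 : ∑ i ∈ m.support, m i • w i = n := by
    rw [← hf (mem_support_iff.1 hm), Finsupp.weight_apply, Finsupp.sum]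
  rw [h2] at h1
  exact h1.C_mul _

variable {σ τ : Type*}

/-- The ideal of polynomials without constant term. -/
noncomputable abbrev irrelevant (σ : Type*) : Ideal (MvPolynomial σ ℚ) :=
  span (Set.range (X : σ → MvPolynomial σ ℚ))

theorem map_irrelevant_le (φ : MvPolynomial σ ℚ →ₐ[ℚ] MvPolynomial τ ℚ)
    (h : ∀ i, φ (X i) ∈ irrelevant τ) : (irrelevant σ).map φ ≤ irrelevant τ := by
  rw [map_span, span_le]
  rintro _ ⟨_, ⟨i, rfl⟩, rfl⟩
  exact h i

theorem apply_mem_irrelevant_sq (φ : MvPolynomial σ ℚ →ₐ[ℚ] MvPolynomial τ ℚ)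
    (h : ∀ i, φ (X i) ∈ irrelevant τ) {f : MvPolynomial σ ℚ} (hf : f ∈ irrelevant σ ^ 2) :
    φ f ∈ irrelevant τ ^ 2 := by
  have := mem_map_of_mem φ hf
  rw [Ideal.map_pow] at this
  exact pow_right_mono (map_irrelevant_le φ h) 2 this

theorem constantCoeff_pderiv_of_mem_sq {f : MvPolynomial σ ℚ} (hf : f ∈ irrelevant σ ^ 2) (i : σ) :
    constantCoeff (pderiv i f) = 0 := by
  rw [pow_two] at hf
  refine Submodule.mul_induction_on hf (fun a ha b hb => ?_) fun a b ha hb => ?_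
  · rw [Derivation.leibniz, map_add, smul_eq_mul, smul_eq_mul, map_mul, map_mul,
      mem_span_X_iff.1 ha, mem_span_X_iff.1 hb]
    simp
  · rw [map_add, map_add, ha, hb, add_zero]

theorem X_notMem_irrelevant_sq (i : σ) : (X i : MvPolynomial σ ℚ) ∉ irrelevant σ ^ 2 := by
  intro h
  have := constantCoeff_pderiv_of_mem_sq h i
  rw [pderiv_X_self, map_one] at this
  exact one_ne_zero this

theorem mem_irrelevant_sq {f : MvPolynomial σ ℚ} (hf : ∀ m ∈ f.support, 2 ≤ m.degree) :
    f ∈ irrelevant σ ^ 2 := by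
  classical
  rw [f.as_sum]
  refine sum_mem fun m hm => ?_
  have h2 := hf m hm
  obtain ⟨i, hi⟩ : ∃ i, m i ≠ 0 := by
    by_contra! h
    have : m = 0 := Finsupp.ext h
    rw [this] at h2
    simp at h2
  obtain ⟨m', rfl⟩ : ∃ m', m = Finsupp.single i 1 + m' := by
    refine ⟨m - Finsupp.single i 1, (add_tsub_cancel_of_le ?_).symm⟩
    simpa [Finsupp.single_le_iff] using Nat.one_le_iff_ne_zero.2 hi
  rw [map_add, Finsupp.degree_single] at h2
  obtain ⟨j, hj⟩ : ∃ j, m' j ≠ 0 := by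
    by_contra! h
    have : m' = 0 := Finsupp.ext h
    rw [this] at h2
    simp at h2
  have : monomial (Finsupp.single i 1 + m') (coeff (Finsupp.single i 1 + m') f) =
      X i * monomial m' (coeff (Finsupp.single i 1 + m') f) := by
    rw [X, monomial_mul, one_mul]
  rw [this, pow_two]
  refine Ideal.mul_mem_mul (subset_span ⟨i, rfl⟩) (mem_span_X_iff.2 ?_)
  rw [constantCoeff_monomial, if_neg]
  rintro rfl
  simp at hj

end MvPolynomial

namespace PositivelyElliptic

open MvPolynomial Ideal

open scoped TensorProduct

section Local

variable (H : PositivelyElliptic)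

theorem isNilpotent_toAlg {f : MvPolynomial (Fin H.k) ℚ} (hf : constantCoeff f = 0) :
    IsNilpotent (H.toAlg f) := by
  have h1 : (irrelevant (Fin H.k)).map H.toAlg ≤ nilradical H.Alg := by
    rw [map_span, span_le]
    rintro _ ⟨_, ⟨i, rfl⟩, rfl⟩
    exact H.isNilpotent_toAlg_X i
  exact h1 (mem_map_of_mem _ (mem_span_X_iff.2 hf))

theorem isUnit_toAlg_iff {f : MvPolynomial (Fin H.k) ℚ} :
    IsUnit (H.toAlg f) ↔ constantCoeff f ≠ 0 := by
  have : Nontrivial H.Alg := Ideal.Quotient.nontrivial_iff.2 H.relIdeal_ne_top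
  constructor
  · intro h h0
    exact (H.isNilpotent_toAlg h0).not_isUnit h
  · intro h
    have h1 : f = (f - C (constantCoeff f)) + C (constantCoeff f) := by ring
    rw [h1, map_add]
    refine (H.isNilpotent_toAlg (by simp)).isUnit_add_right_of_commute
      (((isUnit_iff_ne_zero.2 h).map C).map H.toAlg) (Commute.all _ _)

instance isLocalRing_alg : IsLocalRing H.Alg := by
  have : Nontrivial H.Alg := Ideal.Quotient.nontrivial_iff.2 H.relIdeal_ne_top
  refine IsLocalRing.of_isUnit_or_isUnit_one_sub_self fun x => ?_
  obtain ⟨f, rfl⟩ := toAlg_surjective x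
  rw [← map_one H.toAlg, ← map_sub, isUnit_toAlg_iff, isUnit_toAlg_iff]
  by_contra! h
  simp [h.1] at h

theorem toAlg_mem_maximalIdeal_iff {f : MvPolynomial (Fin H.k) ℚ} :
    H.toAlg f ∈ IsLocalRing.maximalIdeal H.Alg ↔ constantCoeff f = 0 := by
  rw [IsLocalRing.mem_maximalIdeal, mem_nonunits_iff, isUnit_toAlg_iff, not_not]

end Local

/-- If the maximal ideal of a local ring `K` is generated by a regular sequence of `R` modulo `T`,
and the kernel of `R → H` is generated by `T` and by the relations of `K`, then `H` is free
over `K`. -/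
theorem free_of_regSeq {A R K H : Type*} [CommRing A] [CommRing R] [CommRing K] [CommRing H]
    [Algebra K H] [IsLocalRing K] [Module.FinitePresentation K H] (qA : A →+* K)
    (hqA : Function.Surjective qA) (qR : R →+* H) (hqR : Function.Surjective qR) (j : A →+* R)
    (hj : ∀ a, algebraMap K H (qA a) = qR (j a)) {m n : ℕ} (w : Fin n → A)
    (hw : ∀ i, qA (w i) ∈ IsLocalRing.maximalIdeal K)
    (hw' : ∀ a, qA a ∈ IsLocalRing.maximalIdeal K → a ∈ span (Set.range w))
    (T : Ideal R) (rel : Fin m → A) (hrel : ∀ l, qA (rel l) = 0) (hT : ∀ t ∈ T, qR t = 0)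
    (hker : ∀ f, qR f = 0 → f ∈ T ⊔ span (Set.range fun i => j (rel i)))
    (hreg : T.RegSeq (List.ofFn fun i => j (w i))) : Module.Free K H := by
  have hsmul : ∀ (a : A) (b : R), qA a • qR b = qR (j a * b) := fun a b => by
    rw [Algebra.smul_def, hj, map_mul]
  let 𝔪 := IsLocalRing.maximalIdeal K
  let wb : Fin n → 𝔪 := fun i => ⟨qA (w i), hw i⟩
  let φ : Fin n → R →+ 𝔪 ⊗[K] H := fun i =>
    (TensorProduct.mk K 𝔪 H (wb i)).toAddMonoidHom.comp qR.toAddMonoidHom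
  have hφ : ∀ i g, φ i g = wb i ⊗ₜ qR g := fun _ _ => rfl
  have hφj : ∀ i a g, φ i (j a * g) = (qA a • wb i) ⊗ₜ qR g := fun i a g => by
    rw [hφ, ← hsmul, TensorProduct.smul_tmul]
  have hmem : ∀ f : A, qA f ∈ 𝔪 → ∃ c : Fin n → A, ∑ i, w i * c i = f := fun f hf => by
    obtain ⟨c, hc⟩ := mem_span_range_iff_exists_fun.1 (hw' f hf)
    exact ⟨c, by simpa [mul_comm] using hc⟩
  have hsum : ∀ c : Fin n → A, ((∑ i, qA (c i) • wb i : 𝔪) : K) = qA (∑ i, w i * c i) := by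
    intro c
    rw [map_sum, AddSubmonoidClass.coe_finsetSum]
    refine Finset.sum_congr rfl fun i _ => ?_
    rw [map_mul, mul_comm]
    rfl
  -- Local criterion: it suffices that `𝔪 ⊗ H → H` is injective. A tensor in the kernel is written
  -- as `∑ wb i ⊗ g i`, so that `∑ j (w i) * g i` is a relation of `H`.
  refine Module.free_of_maximalIdeal_rTensor_injective ?_
  rw [injective_iff_map_eq_zero]
  intro z hz
  obtain ⟨g, rfl⟩ : ∃ g : Fin n → R, z = ∑ i, φ i (g i) := by
    clear hz
    induction z using TensorProduct.induction_on with
    | zero => exact ⟨0, by simp⟩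
    | tmul x y =>
      obtain ⟨f, hf⟩ := hqA x.1
      obtain ⟨y, rfl⟩ := hqR y
      obtain ⟨c, hc⟩ := hmem f (by rw [hf]; exact x.2)
      refine ⟨fun i => j (c i) * y, ?_⟩
      simp only [hφj]
      rw [← TensorProduct.sum_tmul]
      congr 1
      apply Subtype.ext
      rw [hsum, hc, hf]
    | add x y hx hy =>
      obtain ⟨g, rfl⟩ := hx
      obtain ⟨g', rfl⟩ := hy
      exact ⟨g + g', by simp [Finset.sum_add_distrib]⟩
  have h1 : qR (∑ i, j (w i) * g i) = 0 := by
    have h2 := congrArg (TensorProduct.lid K H) hz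
    rw [map_zero, map_sum, map_sum] at h2
    rw [map_sum, ← h2]
    refine Finset.sum_congr rfl fun i _ => ?_
    rw [hφ, LinearMap.rTensor_tmul, TensorProduct.lid_tmul, ← hsmul]
    rfl
  obtain ⟨e, he⟩ := mem_sup_span_range_iff.1 (hker _ h1)
  -- Expanding the relations of `K` in the `w i` removes them from the syzygy. What remains is a
  -- syzygy modulo `T`, handled by `RegSeq.koszul`; the removed part is zero in the tensor product
  -- because `rel l` is zero in `K`.
  choose c hc using fun l => hmem (rel l) (by rw [hrel]; exact zero_mem _)
  have h2 := hreg.koszul φ (fun i l g => by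
      rw [hφj, hφj]
      congr 1
      apply Subtype.ext
      exact mul_comm _ _) (fun i t ht => by rw [hφ, hT t ht, TensorProduct.tmul_zero])
    (g := fun i => g i - ∑ l, j (c l i) * e l) (by
      convert! he using 1
      simp only [mul_sub, Finset.sum_sub_distrib, Finset.mul_sum]
      congr 1
      rw [Finset.sum_comm]
      refine Finset.sum_congr rfl fun l _ => ?_
      rw [← hc l, map_sum, Finset.sum_mul]
      exact Finset.sum_congr rfl fun i _ => by rw [map_mul, mul_assoc])
  simp only [map_sub, map_sum, Finset.sum_sub_distrib] at h2
  rw [sub_eq_zero] at h2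
  rw [h2, Finset.sum_comm]
  refine Finset.sum_eq_zero fun l _ => ?_
  simp only [hφj]
  rw [← TensorProduct.sum_tmul]
  have h3 : ∑ i, qA (c l i) • wb i = 0 := by
    apply Subtype.ext
    rw [hsum, hc, hrel]
    rfl
  rw [h3, TensorProduct.zero_tmul]

/-- A homomorphism along which the maximal ideal is generated by a regular sequence modulo the
remaining relations is injective and flat. -/
theorem injective_and_flat {K H : PositivelyElliptic}
    (j : MvPolynomial (Fin K.k) ℚ →ₐ[ℚ] MvPolynomial (Fin H.k) ℚ) (ι : K.Alg →ₐ[ℚ] H.Alg)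
    (hι : ∀ f, ι (K.toAlg f) = H.toAlg (j f)) {n : ℕ} (w : Fin n → MvPolynomial (Fin K.k) ℚ)
    (hw : span (Set.range w) = irrelevant (Fin K.k)) (T : Ideal (MvPolynomial (Fin H.k) ℚ))
    (hrel : H.relIdeal = T ⊔ span (Set.range fun i => j (K.rel i)))
    (hreg : T.RegSeq (List.ofFn fun i => j (w i))) :
    Function.Injective ι ∧ ι.toRingHom.Flat := by
  let _ : Algebra K.Alg H.Alg := ι.toRingHom.toAlgebra
  have hsmul : ∀ (a : K.Alg) (b : H.Alg), a • b = ι a * b := fun _ _ => rfl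
  have : IsScalarTower ℚ K.Alg H.Alg :=
    ⟨fun a b c => (congrArg (· * c) (map_smul ι.toLinearMap a b)).trans
      (smul_mul_assoc a (ι b) c)⟩
  have : Module.Finite K.Alg H.Alg := Module.Finite.of_restrictScalars_finite ℚ _ _
  have : IsNoetherianRing K.Alg := inferInstance
  have : Module.FinitePresentation K.Alg H.Alg := Module.finitePresentation_of_finite _ _
  have : Nontrivial H.Alg := Ideal.Quotient.nontrivial_iff.2 H.relIdeal_ne_top
  have hfree : Module.Free K.Alg H.Alg :=
    free_of_regSeq K.toAlg.toRingHom toAlg_surjective H.toAlg.toRingHom toAlg_surjective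
      j.toRingHom hι w (fun i => K.toAlg_mem_maximalIdeal_iff.2 (by
        rw [← mem_span_X_iff]
        exact hw.le (subset_span ⟨i, rfl⟩)))
      (fun a ha => by
        rw [hw]
        exact mem_span_X_iff.2 (K.toAlg_mem_maximalIdeal_iff.1 ha))
      T K.rel (fun l => toAlg_eq_zero_iff.2 (K.rel_mem l))
      (fun t ht => toAlg_eq_zero_iff.2 (hrel ▸ le_sup_left (a := T) ht))
      (fun f hf => hrel ▸ toAlg_eq_zero_iff.1 hf) hreg
  refine ⟨?_, (inferInstance : Module.Flat K.Alg H.Alg)⟩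
  rw [injective_iff_map_eq_zero]
  intro x hx
  let b := Module.Free.chooseBasis K.Alg H.Alg
  obtain ⟨i⟩ : Nonempty (Module.Free.ChooseBasisIndex K.Alg H.Alg) := b.index_nonempty
  have h1 : x • b i = 0 := by rw [hsmul, hx, zero_mul]
  have h2 := congrArg (fun y => b.repr y i) h1
  simpa using h2

end PositivelyElliptic

/-! ### Splitting off a block of generators -/

namespace MvPolynomial

open Ideal

section Blocks

variable (p q : ℕ)

/-- The inclusion of the polynomials in the first `p` variables. -/
noncomputable abbrev incl : MvPolynomial (Fin p) ℚ →ₐ[ℚ] MvPolynomial (Fin (p + q)) ℚ :=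
  rename (Fin.castAdd q)

/-- The inclusion of the polynomials in the last `q` variables. -/
noncomputable abbrev sect : MvPolynomial (Fin q) ℚ →ₐ[ℚ] MvPolynomial (Fin (p + q)) ℚ :=
  rename (Fin.natAdd p)

/-- Setting the last `q` variables to zero. -/
noncomputable abbrev retr : MvPolynomial (Fin (p + q)) ℚ →ₐ[ℚ] MvPolynomial (Fin p) ℚ :=
  aeval (Fin.addCases (motive := fun _ => MvPolynomial (Fin p) ℚ) X fun _ => 0)

/-- Setting the first `p` variables to zero. -/
noncomputable abbrev proj : MvPolynomial (Fin (p + q)) ℚ →ₐ[ℚ] MvPolynomial (Fin q) ℚ :=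
  aeval (Fin.addCases (motive := fun _ => MvPolynomial (Fin q) ℚ) (fun _ => 0) X)

/-- The ideal generated by the first `p` variables. -/
noncomputable abbrev firstVars : Ideal (MvPolynomial (Fin (p + q)) ℚ) :=
  span (Set.range fun i : Fin p => X (Fin.castAdd q i))

variable {p q}

theorem retr_incl (a : MvPolynomial (Fin p) ℚ) : retr p q (incl p q a) = a := by
  have : (retr p q).comp (incl p q) = AlgHom.id ℚ _ := by
    ext i
    simp
  exact DFunLike.congr_fun this a

theorem proj_sect (a : MvPolynomial (Fin q) ℚ) : proj p q (sect p q a) = a := by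
  have : (proj p q).comp (sect p q) = AlgHom.id ℚ _ := by
    ext i
    simp
  exact DFunLike.congr_fun this a

theorem proj_incl (a : MvPolynomial (Fin p) ℚ) : proj p q (incl p q a) = C (constantCoeff a) := by
  induction a using MvPolynomial.induction_on with
  | C c => simp
  | add a b ha hb => simp only [map_add, ha, hb]
  | mul_X a i ha => simp

theorem sub_sect_proj_mem (f : MvPolynomial (Fin (p + q)) ℚ) :
    f - sect p q (proj p q f) ∈ firstVars p q := by
  induction f using MvPolynomial.induction_on with
  | C c => simp
  | add a b ha hb =>
    simp only [map_add]
    rw [add_sub_add_comm]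
    exact add_mem ha hb
  | mul_X a i ha =>
    simp only [map_mul]
    have h1 : (X i : MvPolynomial (Fin (p + q)) ℚ) - sect p q (proj p q (X i)) ∈
        firstVars p q := by
      induction i using Fin.addCases with
      | left i =>
        simp only [aeval_X, Fin.addCases_left, map_zero, sub_zero]
        exact subset_span ⟨i, rfl⟩
      | right i => simp
    have h2 : a * X i - sect p q (proj p q a) * sect p q (proj p q (X i)) =
        (a - sect p q (proj p q a)) * X i +
        sect p q (proj p q a) * (X i - sect p q (proj p q (X i))) := by ring
    rw [h2]
    exact add_mem (mul_mem_right _ _ ha) (mul_mem_left _ _ h1)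

theorem proj_eq_zero_iff {f : MvPolynomial (Fin (p + q)) ℚ} :
    proj p q f = 0 ↔ f ∈ firstVars p q := by
  constructor
  · intro h
    have h1 := sub_sect_proj_mem f
    rw [h, map_zero, sub_zero] at h1
    exact h1
  · intro h
    have : firstVars p q ≤ RingHom.ker (proj p q) := by
      rw [span_le]
      rintro _ ⟨i, rfl⟩
      simp
    exact this h

theorem exists_incl_eq {f : MvPolynomial (Fin (p + q)) ℚ}
    (hf : ∀ m ∈ f.support, ∀ j : Fin q, m (Fin.natAdd p j) = 0) :
    incl p q (retr p q f) = f := by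
  have h1 : (f.vars : Set (Fin (p + q))) ⊆ Set.range (Fin.castAdd q) := by
    intro i hi
    obtain ⟨m, hm, him⟩ := (mem_vars_iff_mem_support i).1 hi
    induction i using Fin.addCases with
    | left i => exact ⟨i, rfl⟩
    | right i => exact absurd (hf m hm i) (Finsupp.mem_support_iff.1 him)
  obtain ⟨a, rfl⟩ := exists_rename_eq_of_vars_subset_range f _ (Fin.castAdd_injective p q) h1
  rw [retr_incl]

theorem constantCoeff_incl (a : MvPolynomial (Fin p) ℚ) :
    constantCoeff (incl p q a) = constantCoeff a := constantCoeff_rename _ _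

end Blocks

end MvPolynomial

namespace PositivelyElliptic

open MvPolynomial Ideal

section Split

variable {p q : ℕ} {deg relDeg : Fin (p + q) → ℕ} {u : Fin (p + q) → MvPolynomial (Fin (p + q)) ℚ}

/-- Exchanging relations in the first `p` variables for a generating set of linear forms in these
variables. -/
theorem exists_regSeq_exchange {d : ℕ} (hd : 0 < d) (hdeg : ∀ i, deg (Fin.castAdd q i) = d)
    (hpos : ∀ i, 0 < relDeg i) (hu : ∀ i, (u i).IsWeightedHomogeneous deg (relDeg i))
    (hreg : (⊥ : Ideal (MvPolynomial (Fin (p + q)) ℚ)).RegSeq (List.ofFn u))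
    {a : Fin p → MvPolynomial (Fin p) ℚ} (ha : ∀ i, u (Fin.castAdd q i) = incl p q (a i))
    (ha0 : ∀ i, constantCoeff (a i) = 0) :
    ∃ w : Fin p → MvPolynomial (Fin p) ℚ, span (Set.range w) = irrelevant (Fin p) ∧
      (span (Set.range fun i => u (Fin.natAdd p i))).RegSeq (List.ofFn fun i => incl p q (w i)) ∧
      (firstVars p q).RegSeq (List.ofFn fun i => u (Fin.natAdd p i)) := by
  let W : Submodule ℚ (MvPolynomial (Fin (p + q)) ℚ) :=
    Submodule.span ℚ (Set.range fun i : Fin p => X (Fin.castAdd q i))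
  have hWd : ∀ x ∈ W, x.IsWeightedHomogeneous deg d := by
    have : W ≤ weightedHomogeneousSubmodule ℚ deg d := by
      refine Submodule.span_le.2 ?_
      rintro _ ⟨i, rfl⟩
      have := isWeightedHomogeneous_X ℚ deg (Fin.castAdd q i)
      rwa [hdeg] at this
    exact this
  have hWi : ∀ x ∈ W, ∃ y, x = incl p q y := by
    intro x hx
    have : W ≤ LinearMap.range (incl p q).toLinearMap := by
      refine Submodule.span_le.2 ?_
      rintro _ ⟨i, rfl⟩
      exact ⟨X i, by simp⟩
    obtain ⟨y, hy⟩ := this hx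
    exact ⟨y, hy.symm⟩
  have hWspan : span (W : Set (MvPolynomial (Fin (p + q)) ℚ)) = firstVars p q := by
    refine le_antisymm (span_le.2 fun x hx => ?_) (span_mono Submodule.subset_span)
    exact Submodule.span_le_restrictScalars ℚ (MvPolynomial (Fin (p + q)) ℚ) _ hx
  have hincl : ∀ b : MvPolynomial (Fin p) ℚ, constantCoeff b = 0 → incl p q b ∈ firstVars p q := by
    intro b hb
    rw [← proj_eq_zero_iff, proj_incl, hb, map_zero]
  rw [List.ofFn_add] at hreg
  have hreg' := whomog_bot.regSeq_perm (w := deg) (by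
    intro b hb
    rw [← List.ofFn_add] at hb
    obtain ⟨i, rfl⟩ := List.mem_ofFn.1 hb
    exact ⟨_, hpos i, hu i⟩) List.perm_append_comm hreg
  rw [regSeq_append] at hreg'
  -- The block relations, moved to the end, are exchanged for `p` linear forms in the block. Once
  -- these are moved back to the front, counting dimensions shows that they generate all the block
  -- variables.
  obtain ⟨ws, hlen, hws, hwsreg⟩ := hreg'.2.exists_list_subset W (by
    intro b hb
    obtain ⟨i, rfl⟩ := List.mem_ofFn.1 hb
    refine le_radical ?_
    rw [hWspan]
    have := hincl _ (ha0 i)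
    rw [← ha] at this
    exact this)
  rw [List.length_ofFn] at hlen
  have hreg'' := whomog_bot.regSeq_perm (w := deg) (by
    intro b hb
    rcases List.mem_append.1 hb with hb | hb
    · obtain ⟨i, rfl⟩ := List.mem_ofFn.1 hb
      exact ⟨_, hpos _, hu _⟩
    · exact ⟨d, hd, hWd b (hws b hb)⟩) List.perm_append_comm
    (regSeq_append.2 ⟨hreg'.1, hwsreg⟩)
  rw [regSeq_append, bot_sup_eq] at hreg''
  have hker : ofList ws ≤ firstVars p q := by
    rw [← hWspan]
    exact span_mono fun x hx => hws x hx
  have : FiniteDimensional ℚ W := FiniteDimensional.span_of_finite ℚ (Set.finite_range _)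
  have hle := hreg''.1.le_of_finrank_le W hws (by
    rw [bot_sup_eq]
    refine ne_top_of_le_ker (hker.trans (span_le.2 ?_))
    rintro _ ⟨i, rfl⟩
    simp) (by
    rw [hlen]
    exact (finrank_range_le_card _).trans (by simp))
  have hws_eq : ofList ws = firstVars p q := by
    refine le_antisymm hker (span_le.2 fun x hx => ?_)
    have := hle (Submodule.subset_span hx)
    simpa using this
  choose w hw using fun i : Fin p =>
    hWi (ws.get (Fin.cast hlen.symm i)) (hws _ (List.get_mem ws _))
  have hofFn : (List.ofFn fun i => incl p q (w i)) = ws := by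
    refine List.ext_getElem (by simp [hlen]) fun n h1 h2 => ?_
    rw [List.getElem_ofFn, ← hw]
    rfl
  refine ⟨w, ?_, ?_, ?_⟩
  · have h1 : firstVars p q = span (Set.range fun i => incl p q (w i)) := by
      rw [← ofList_ofFn, hofFn, hws_eq]
    have h2 := congrArg (Ideal.map (retr p q)) h1
    rw [map_span, map_span, ← Set.range_comp, ← Set.range_comp] at h2
    simp only [Function.comp_def, retr_incl] at h2
    rw [← h2]
    congr 2
    ext1 i
    simp
  · rw [hofFn]
    rw [bot_sup_eq, ofList_ofFn] at hwsreg
    exact hwsreg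
  · rw [← hws_eq]
    exact hreg''.2

end Split

/-- Relations without linear terms cannot make a variable zero. This certifies that neither end of
the exact sequence is trivial. -/
theorem posIdeal_ne_bot {K : PositivelyElliptic} (hK : ∀ i, K.rel i ∈ irrelevant (Fin K.k) ^ 2)
    (i : Fin K.k) : K.posIdeal ≠ ⊥ := by
  intro h
  have h1 : K.toAlg (X i) ∈ K.posIdeal := subset_span ⟨i, rfl⟩
  rw [h, Ideal.mem_bot, toAlg_eq_zero_iff] at h1
  refine X_notMem_irrelevant_sq i (?_ : X i ∈ irrelevant (Fin K.k) ^ 2)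
  refine (span_le.2 ?_ : K.relIdeal ≤ _) h1
  rintro _ ⟨j, rfl⟩
  exact hK j

/-- `K` is given by the first block of generators and its relations, and `Q` arises by setting these
generators to zero. The common degree `d` makes linear forms in the block homogeneous, so that
`exists_regSeq_exchange` yields both the flatness over `K` and the regularity of the relations of
`Q`. -/
theorem splits_of_add {p q : ℕ} (hp : 0 < p) (hq : 0 < q) (deg : Fin (p + q) → ℕ)
    (rel : Fin (p + q) → MvPolynomial (Fin (p + q)) ℚ) (relDeg : Fin (p + q) → ℕ)
    (h₁ : ∀ i, 0 < deg i) (h₂ : ∀ i, Even (deg i))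
    (h₃ : ∀ i, IsWeightedHomogeneous deg (rel i) (relDeg i))
    (h₄ : RingTheory.Sequence.IsRegular (MvPolynomial (Fin (p + q)) ℚ) (List.ofFn rel))
    (hsq : ∀ i, rel i ∈ irrelevant (Fin (p + q)) ^ 2) {d : ℕ}
    (hdeg : ∀ i, deg (Fin.castAdd q i) = d)
    (hrel : ∀ i, ∀ m ∈ (rel (Fin.castAdd q i)).support, ∀ j, m (Fin.natAdd p j) = 0) :
    Splits ⟨p + q, deg, rel, relDeg, h₁, h₂, h₃, h₄⟩ := by
  let H : PositivelyElliptic := ⟨p + q, deg, rel, relDeg, h₁, h₂, h₃, h₄⟩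
  have hd : 0 < d := hdeg ⟨0, hp⟩ ▸ h₁ _
  let a : Fin p → MvPolynomial (Fin p) ℚ := fun i => retr p q (rel (Fin.castAdd q i))
  have ha : ∀ i, rel (Fin.castAdd q i) = incl p q (a i) := fun i => (exists_incl_eq (hrel i)).symm
  have hu0 : ∀ i, constantCoeff (rel i) = 0 := H.constantCoeff_rel
  have ha0 : ∀ i, constantCoeff (a i) = 0 := fun i => by
    rw [← constantCoeff_incl (q := q), ← ha, hu0]
  obtain ⟨w, hw, hwreg, hTreg⟩ := exists_regSeq_exchange hd hdeg H.relDeg_pos h₃ H.regSeq ha ha0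
  have hretr0 : ∀ i, (Fin.addCases (motive := fun _ => MvPolynomial (Fin p) ℚ) X (fun _ => 0) i
      : MvPolynomial (Fin p) ℚ).IsWeightedHomogeneous (fun i => deg (Fin.castAdd q i)) (deg i) := by
    intro i
    induction i using Fin.addCases with
    | left i =>
      rw [Fin.addCases_left]
      exact isWeightedHomogeneous_X ℚ (fun i => deg (Fin.castAdd q i)) i
    | right i =>
      rw [Fin.addCases_right]
      exact isWeightedHomogeneous_zero _ _ _
  have hproj0 : ∀ i, (Fin.addCases (motive := fun _ => MvPolynomial (Fin q) ℚ) (fun _ => 0) X i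
      : MvPolynomial (Fin q) ℚ).IsWeightedHomogeneous (fun i => deg (Fin.natAdd p i)) (deg i) := by
    intro i
    induction i using Fin.addCases with
    | left i =>
      rw [Fin.addCases_left]
      exact isWeightedHomogeneous_zero _ _ _
    | right i =>
      rw [Fin.addCases_right]
      exact isWeightedHomogeneous_X ℚ (fun i => deg (Fin.natAdd p i)) i
  have hregT : (⊥ : Ideal (MvPolynomial (Fin q) ℚ)).RegSeq
      (List.ofFn fun i => proj p q (rel (Fin.natAdd p i))) := by
    have hcomap : (⊥ : Ideal (MvPolynomial (Fin q) ℚ)).comap (proj p q).toRingHom =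
        firstVars p q := by
      ext f
      exact proj_eq_zero_iff
    rw [← hcomap] at hTreg
    have := hTreg.map_of_surjective (proj p q).toRingHom fun s => ⟨sect p q s, proj_sect s⟩
    rw [List.map_ofFn] at this
    exact this
  have hregU : (⊥ : Ideal (MvPolynomial (Fin p) ℚ)).RegSeq (List.ofFn a) := by
    refine RegSeq.of_retract (incl p q).toRingHom (retr p q).toRingHom retr_incl ?_
    rw [Ideal.map_bot, List.map_ofFn]
    have := H.regSeq
    have h1 : List.ofFn H.rel = _ := List.ofFn_add (f := rel)
    rw [h1, regSeq_append] at this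
    convert! this.1 using 2
    ext1 i
    exact (ha i).symm
  let K : PositivelyElliptic := ⟨p, fun i => deg (Fin.castAdd q i), a,
    fun i => relDeg (Fin.castAdd q i), fun i => h₁ _, fun i => h₂ _,
    fun i => (h₃ _).aeval hretr0, by
      refine isRegular_iff_regSeq.2 ⟨hregU, ?_⟩
      rw [ofList_ofFn]
      refine ne_top_of_le_ker (span_le.2 ?_)
      rintro _ ⟨i, rfl⟩
      exact ha0 i⟩
  let Q : PositivelyElliptic := ⟨q, fun i => deg (Fin.natAdd p i),
    fun i => proj p q (rel (Fin.natAdd p i)), fun i => relDeg (Fin.natAdd p i), fun i => h₁ _,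
    fun i => h₂ _, fun i => (h₃ _).aeval hproj0, by
      refine isRegular_iff_regSeq.2 ⟨hregT, ?_⟩
      rw [ofList_ofFn]
      refine ne_top_of_le_ker (span_le.2 ?_)
      rintro _ ⟨i, rfl⟩
      have h1 := sub_sect_proj_mem (rel (Fin.natAdd p i))
      have h2 : firstVars p q ≤ RingHom.ker (constantCoeff (σ := Fin (p + q)) (R := ℚ)) := by
        rw [span_le]
        rintro _ ⟨i, rfl⟩
        simp
      have h3 : constantCoeff (sect p q (proj p q (rel (Fin.natAdd p i)))) = 0 := by
        have := h2 h1
        rw [RingHom.mem_ker, map_sub, hu0, zero_sub, neg_eq_zero] at this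
        exact this
      rwa [constantCoeff_rename] at h3⟩
  have hretrX : ∀ i, retr p q (X i) ∈ irrelevant (Fin p) := by
    intro i
    induction i using Fin.addCases with
    | left i =>
      simp only [aeval_X, Fin.addCases_left]
      exact subset_span ⟨i, rfl⟩
    | right i => simp
  have hprojX : ∀ i, proj p q (X i) ∈ irrelevant (Fin q) := by
    intro i
    induction i using Fin.addCases with
    | left i => simp
    | right i =>
      simp only [aeval_X, Fin.addCases_right]
      exact subset_span ⟨i, rfl⟩
  have hιker : ∀ f ∈ K.relIdeal, H.toAlg.comp (incl p q) f = 0 := by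
    have : K.relIdeal ≤ RingHom.ker (H.toAlg.comp (incl p q)) := by
      rw [relIdeal, span_le]
      rintro _ ⟨i, rfl⟩
      refine toAlg_eq_zero_iff.2 ?_
      have := H.rel_mem (Fin.castAdd q i)
      rw [show H.rel (Fin.castAdd q i) = incl p q (a i) from ha i] at this
      exact this
    exact this
  let ι : K.Alg →ₐ[ℚ] H.Alg := Ideal.Quotient.liftₐ K.relIdeal (H.toAlg.comp (incl p q)) hιker
  have hι : ∀ f, ι (K.toAlg f) = H.toAlg (incl p q f) := fun f => rfl
  have hπker : ∀ f ∈ H.relIdeal, Q.toAlg.comp (proj p q) f = 0 := by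
    have : H.relIdeal ≤ RingHom.ker (Q.toAlg.comp (proj p q)) := by
      rw [relIdeal, span_le]
      rintro _ ⟨i, rfl⟩
      refine toAlg_eq_zero_iff.2 ?_
      change proj p q (rel i) ∈ Q.relIdeal
      induction i using Fin.addCases with
      | left i => rw [ha, proj_incl, ha0, map_zero]; exact zero_mem _
      | right i => exact Q.rel_mem i
    exact this
  let π : H.Alg →ₐ[ℚ] Q.Alg := Ideal.Quotient.liftₐ H.relIdeal (Q.toAlg.comp (proj p q)) hπker
  have hπ : ∀ f, π (H.toAlg f) = Q.toAlg (proj p q f) := fun f => rfl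
  have hrelIdeal : H.relIdeal = span (Set.range fun i => rel (Fin.natAdd p i)) ⊔
      span (Set.range fun i => incl p q (a i)) := by
    have h1 := H.ofList_rel
    have h2 : List.ofFn H.rel = _ := List.ofFn_add (f := rel)
    rw [h2, ofList_append, ofList_ofFn, ofList_ofFn, sup_comm] at h1
    rw [← h1]
    congr 3
    ext1 i
    exact ha i
  obtain ⟨hinj, hflat⟩ := injective_and_flat (K := K) (H := H) (incl p q) ι hι w hw _ hrelIdeal hwreg
  refine ⟨K, Q, ι, π, posIdeal_ne_bot (K := K) (fun i => ?_) ⟨0, hp⟩,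
    posIdeal_ne_bot (K := Q) (fun i => ?_) ⟨0, hq⟩, ?_, ?_, hinj, hflat, ?_, ?_⟩
  · exact apply_mem_irrelevant_sq (retr p q) hretrX (hsq _)
  · exact apply_mem_irrelevant_sq (proj p q) hprojX (hsq _)
  · rintro n _ ⟨f, hf, rfl⟩
    refine ⟨incl p q f, ?_, rfl⟩
    rw [incl, rename_eq_aeval]
    exact IsWeightedHomogeneous.aeval (w' := deg)
      (fun i => isWeightedHomogeneous_X ℚ deg (Fin.castAdd q i)) hf
  · rintro n _ ⟨f, hf, rfl⟩
    exact ⟨proj p q f, IsWeightedHomogeneous.aeval hproj0 hf, rfl⟩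
  · intro x
    obtain ⟨s, rfl⟩ := toAlg_surjective x
    exact ⟨H.toAlg (sect p q s), by rw [hπ, proj_sect]⟩
  · have hmap : K.posIdeal.map ι.toRingHom =
        span (Set.range fun i : Fin p => H.toAlg (X (Fin.castAdd q i))) := by
      rw [posIdeal, map_span, ← Set.range_comp]
      congr 2
      ext1 i
      change H.toAlg (incl p q (X i)) = _
      rw [rename_X]
    rw [hmap]
    have hfirst : (firstVars p q).map H.toAlg =
        span (Set.range fun i : Fin p => H.toAlg (X (Fin.castAdd q i))) := by
      rw [map_span, ← Set.range_comp]
      rfl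
    rw [← hfirst]
    refine le_antisymm (fun x hx => ?_) ?_
    · obtain ⟨f, rfl⟩ := toAlg_surjective x
      have h1 : proj p q f ∈ Q.relIdeal := toAlg_eq_zero_iff.1 hx
      obtain ⟨c, hc⟩ := mem_span_range_iff_exists_fun.1 h1
      have h2 : f - ∑ i : Fin q, sect p q (c i) * rel (Fin.natAdd p i) ∈ firstVars p q := by
        rw [← proj_eq_zero_iff, map_sub, ← hc, map_sum, sub_eq_zero]
        refine Finset.sum_congr rfl fun i _ => ?_
        rw [map_mul, proj_sect]
      have h3 : H.toAlg (∑ i : Fin q, sect p q (c i) * rel (Fin.natAdd p i)) = 0 :=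
        toAlg_eq_zero_iff.2 (sum_mem fun i _ => H.relIdeal.mul_mem_left _ (H.rel_mem _))
      have h4 := mem_map_of_mem H.toAlg h2
      rw [map_sub, h3, sub_zero] at h4
      exact h4
    · rw [map_span, span_le]
      rintro _ ⟨_, ⟨i, rfl⟩, rfl⟩
      refine (RingHom.mem_ker).2 ?_
      change Q.toAlg (proj p q (X (Fin.castAdd q i))) = 0
      simp

/-- If the first `p` relations of a pure model involve only the first `p` generators, and these
have the same degree, then the algebra splits. -/
theorem IsPureModel.splits {H : PositivelyElliptic} (hH : H.IsPureModel) {p d : ℕ} (hp : 0 < p)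
    (hpk : p < H.k) (hdeg : ∀ i : Fin H.k, i.1 < p → H.deg i = d)
    (hrel : ∀ i : Fin H.k, i.1 < p → ∀ m ∈ (H.rel i).support, ∀ j : Fin H.k, p ≤ j.1 → m j = 0) :
    H.Splits := by
  have hsq : ∀ i, H.rel i ∈ irrelevant (Fin H.k) ^ 2 := fun i =>
    mem_irrelevant_sq (hH.two_le_degree i)
  clear hH
  obtain ⟨k, deg, rel, relDeg, h₁, h₂, h₃, h₄⟩ := H
  obtain ⟨q, rfl⟩ := Nat.exists_eq_add_of_lt hpk
  exact splits_of_add (q := q + 1) hp (by omega) deg rel relDeg h₁ h₂ h₃ h₄ hsq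
    (fun i => hdeg (Fin.castAdd (q + 1) i) i.2)
    (fun i m hm j => hrel (Fin.castAdd (q + 1) i) i.2 m hm (Fin.natAdd p j) (by simp))

end PositivelyElliptic

/-! ### Quadratic parts of polynomials -/

namespace MvPolynomial

open Ideal

variable {σ : Type*}

/-- The Hessian at the origin. -/
noncomputable def hess (f : MvPolynomial σ ℚ) (a b : σ) : ℚ :=
  constantCoeff (pderiv a (pderiv b f))

theorem pderiv_pderiv_comm (a b : σ) (f : MvPolynomial σ ℚ) :
    pderiv a (pderiv b f) = pderiv b (pderiv a f) := by
  classical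
  have : ⁅(pderiv a : Derivation ℚ (MvPolynomial σ ℚ) (MvPolynomial σ ℚ)),
      (pderiv b : Derivation ℚ (MvPolynomial σ ℚ) (MvPolynomial σ ℚ))⁆ = 0 := by
    refine derivation_ext fun i => ?_
    rw [Derivation.commutator_apply, pderiv_X, pderiv_X, Pi.single_apply, Pi.single_apply]
    split_ifs <;> simp
  have h := DFunLike.congr_fun this f
  rw [Derivation.commutator_apply] at h
  exact sub_eq_zero.1 h

theorem hess_comm (f : MvPolynomial σ ℚ) (a b : σ) : hess f a b = hess f b a := by
  rw [hess, hess, pderiv_pderiv_comm]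

theorem hess_add (f g : MvPolynomial σ ℚ) (a b : σ) : hess (f + g) a b = hess f a b + hess g a b := by
  simp [hess]

theorem hess_sum {ι : Type*} (s : Finset ι) (f : ι → MvPolynomial σ ℚ) (a b : σ) :
    hess (∑ i ∈ s, f i) a b = ∑ i ∈ s, hess (f i) a b := by
  simp [hess]

theorem constantCoeff_of_mem_sq {f : MvPolynomial σ ℚ} (hf : f ∈ irrelevant σ ^ 2) :
    constantCoeff f = 0 :=
  mem_span_X_iff.1 (pow_le_self two_ne_zero hf)

/-- As `u` starts in order two, only the constant term of the other factor is seen. Hence Hessians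
of elements of the ideal of relations are rational combinations of those of the relations. -/
theorem hess_mul {u : MvPolynomial σ ℚ} (hu : u ∈ irrelevant σ ^ 2) (c : MvPolynomial σ ℚ)
    (a b : σ) : hess (c * u) a b = constantCoeff c * hess u a b := by
  simp only [hess, Derivation.leibniz, map_add, smul_eq_mul, map_mul, constantCoeff_of_mem_sq hu,
    constantCoeff_pderiv_of_mem_sq hu]
  ring

theorem exists_hess_eq {ι : Type*} [Fintype ι] {u : ι → MvPolynomial σ ℚ}
    (hu : ∀ i, u i ∈ irrelevant σ ^ 2) {f : MvPolynomial σ ℚ} (hf : f ∈ span (Set.range u)) :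
    ∃ γ : ι → ℚ, ∀ a b, hess f a b = ∑ i, γ i * hess (u i) a b := by
  obtain ⟨c, rfl⟩ := mem_span_range_iff_exists_fun.1 hf
  refine ⟨fun i => constantCoeff (c i), fun a b => ?_⟩
  rw [hess_sum]
  exact Finset.sum_congr rfl fun i _ => hess_mul (hu i) _ _ _

theorem derivation_eq_sum [Fintype σ] (D : Derivation ℚ (MvPolynomial σ ℚ) (MvPolynomial σ ℚ))
    (f : MvPolynomial σ ℚ) : D f = ∑ i, pderiv i f * D (X i) := by
  classical
  induction f using MvPolynomial.induction_on with
  | C c => simp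
  | add p q hp hq => simp only [map_add, hp, hq, add_mul, Finset.sum_add_distrib]
  | mul_X p i hp =>
    simp only [Derivation.leibniz, hp, smul_eq_mul, add_mul, Finset.sum_add_distrib,
      Finset.mul_sum, pderiv_X, Pi.single_apply, mul_ite, ite_mul, mul_one, mul_zero, zero_mul,
      Finset.sum_ite_eq, Finset.mem_univ, if_true, mul_assoc]

/-- A vector field vanishing at the origin acts on quadratic parts through its linear part alone. -/
theorem hess_derivation [Fintype σ] (D : Derivation ℚ (MvPolynomial σ ℚ) (MvPolynomial σ ℚ))
    (hD : ∀ i, constantCoeff (D (X i)) = 0) {f : MvPolynomial σ ℚ} (hf : f ∈ irrelevant σ ^ 2)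
    (a b : σ) : hess (D f) a b = ∑ j, (hess f a j * constantCoeff (pderiv b (D (X j))) +
      hess f b j * constantCoeff (pderiv a (D (X j)))) := by
  rw [derivation_eq_sum, hess_sum]
  refine Finset.sum_congr rfl fun j _ => ?_
  simp only [hess, Derivation.leibniz, map_add, smul_eq_mul, map_mul, hD,
    constantCoeff_pderiv_of_mem_sq hf]
  ring

theorem hess_X_mul_X [DecidableEq σ] (c d a b : σ) : hess (X c * X d) a b =
    (if c = a then 1 else 0) * (if d = b then 1 else 0) +
    (if c = b then 1 else 0) * (if d = a then 1 else 0) := by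
  simp only [hess, Derivation.leibniz, map_add, smul_eq_mul, map_mul, pderiv_X, Pi.single_apply]
  split_ifs <;> simp

/-- The quadratic part of a polynomial. -/
noncomputable def quad [Fintype σ] (f : MvPolynomial σ ℚ) : MvPolynomial σ ℚ :=
  C (1 / 2) * ∑ a, ∑ b, C (hess f a b) * (X a * X b)

theorem X_mul_X_mem (a b : σ) : (X a * X b : MvPolynomial σ ℚ) ∈ irrelevant σ ^ 2 := by
  rw [pow_two]
  exact Ideal.mul_mem_mul (subset_span ⟨a, rfl⟩) (subset_span ⟨b, rfl⟩)

theorem quad_mem [Fintype σ] (f : MvPolynomial σ ℚ) : quad f ∈ irrelevant σ ^ 2 :=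
  Ideal.mul_mem_left _ _ (_root_.sum_mem fun a _ => _root_.sum_mem fun b _ =>
    Ideal.mul_mem_left _ _ (X_mul_X_mem a b))

theorem sub_quad_mem [Fintype σ] {f : MvPolynomial σ ℚ} (hf : f ∈ irrelevant σ ^ 2) :
    f - quad f ∈ irrelevant σ ^ 3 := by
  classical
  have hspan : irrelevant σ ^ 2 = span (Set.range fun x : σ × σ => X x.1 * X x.2) := by
    rw [pow_two, span_mul_span', ← Set.image2_mul, Set.image2_range]
  have hadd : ∀ f g : MvPolynomial σ ℚ, quad (f + g) = quad f + quad g := by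
    intro f g
    simp only [quad, hess_add, C_add, add_mul, Finset.sum_add_distrib, mul_add]
  have hf' := hf
  rw [hspan] at hf'
  clear hf
  suffices f ∈ irrelevant σ ^ 2 ∧ f - quad f ∈ irrelevant σ ^ 3 from this.2
  induction hf' using Submodule.span_induction with
  | mem f hf =>
    obtain ⟨⟨c, d⟩, rfl⟩ := hf
    refine ⟨X_mul_X_mem c d, ?_⟩
    have h2 : (C (1 / 2) * C 2 : MvPolynomial σ ℚ) = 1 := by
      rw [← C_mul]
      norm_num
    have : quad (X c * X d : MvPolynomial σ ℚ) = X c * X d := by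
      simp only [quad, hess_X_mul_X, C_add, add_mul, Finset.sum_add_distrib, apply_ite C,
        C_1, C_0, mul_ite, ite_mul, mul_one, mul_zero, zero_mul, one_mul, Finset.sum_ite_eq,
        Finset.mem_univ, if_true, Finset.sum_ite_irrel, Finset.sum_const_zero]
      rw [mul_comm (X d) (X c), ← two_mul, ← mul_assoc, show (2 : MvPolynomial σ ℚ) = C 2 from rfl,
        h2, one_mul]
    rw [this, sub_self]
    exact zero_mem _
  | zero => simp [quad, hess]
  | add f g _ _ hf hg =>
    refine ⟨add_mem hf.1 hg.1, ?_⟩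
    rw [hadd, add_sub_add_comm]
    exact add_mem hf.2 hg.2
  | smul g f _ hf =>
    rw [smul_eq_mul]
    refine ⟨Ideal.mul_mem_left _ _ hf.1, ?_⟩
    have h1 : quad (g * f) = C (constantCoeff g) * quad f := by
      simp only [quad, hess_mul hf.1, C_mul, Finset.mul_sum]
      refine Finset.sum_congr rfl fun a _ => Finset.sum_congr rfl fun b _ => ?_
      ring
    have h2 : g * f - quad (g * f) =
        g * (f - quad f) + (g - C (constantCoeff g)) * quad f := by
      rw [h1]
      ring
    rw [h2]
    refine add_mem (Ideal.mul_mem_left _ _ hf.2) ?_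
    rw [pow_succ']
    exact Ideal.mul_mem_mul (sub_C_constantCoeff_mem g) (quad_mem f)

section Weights

variable {w : σ → ℕ} {f : MvPolynomial σ ℚ} {n : ℕ}

theorem IsWeightedHomogeneous.constantCoeff_eq_zero (hf : f.IsWeightedHomogeneous w n)
    (hn : n ≠ 0) : constantCoeff f = 0 := by
  by_contra h
  have := hf (d := 0) h
  simp only [map_zero] at this
  exact hn this.symm

theorem IsWeightedHomogeneous.pderiv_eq_zero (hf : f.IsWeightedHomogeneous w n) {i : σ}
    (hn : n < w i) : pderiv i f = 0 := by
  ext m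
  rw [coeff_pderiv, coeff_zero]
  by_contra h
  have h1 := hf (left_ne_zero_of_mul h)
  rw [map_add, Finsupp.weight_single] at h1
  simp only [one_smul] at h1
  omega

theorem IsWeightedHomogeneous.pderiv_sub (hf : f.IsWeightedHomogeneous w n) (i : σ) :
    (pderiv i f).IsWeightedHomogeneous w (n - w i) := by
  rcases lt_or_ge n (w i) with h | h
  · rw [hf.pderiv_eq_zero h]
    exact isWeightedHomogeneous_zero _ _ _
  · exact hf.pderiv (by omega)

theorem IsWeightedHomogeneous.hess_eq_zero (hf : f.IsWeightedHomogeneous w n) {a b : σ}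
    (hn : w a + w b ≠ n) : hess f a b = 0 := by
  rcases lt_or_ge n (w b) with h | h
  · rw [hess, hf.pderiv_eq_zero h, map_zero, map_zero]
  · have h1 := hf.pderiv_sub b
    rcases lt_or_ge (n - w b) (w a) with h' | h'
    · rw [hess, h1.pderiv_eq_zero h', map_zero]
    · exact (h1.pderiv_sub a).constantCoeff_eq_zero (by omega)

theorem IsWeightedHomogeneous.quad [Fintype σ] (hf : f.IsWeightedHomogeneous w n) :
    f.quad.IsWeightedHomogeneous w n := by
  rw [MvPolynomial.quad, ← zero_add n]
  refine (isWeightedHomogeneous_C w _).mul ?_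
  refine IsWeightedHomogeneous.sum _ _ _ fun a _ => IsWeightedHomogeneous.sum _ _ _ fun b _ => ?_
  by_cases h : w a + w b = n
  · rw [← h, ← zero_add (w a + w b)]
    exact (isWeightedHomogeneous_C w _).mul
      ((isWeightedHomogeneous_X ℚ w a).mul (isWeightedHomogeneous_X ℚ w b))
  · rw [hf.hess_eq_zero h, C_0, zero_mul]
    exact isWeightedHomogeneous_zero _ _ _

/-- If all monomials of `f` of degree at least three involve variables in `J`, and the quadratic
part of `f` is a product of linear forms modulo such variables, one of which lies in `J`, then
`f` is in `J`. -/
theorem IsWeightedHomogeneous.mem_of_hess [Fintype σ] (hf : f.IsWeightedHomogeneous w n)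
    (hsq : f ∈ irrelevant σ ^ 2) {J : Ideal (MvPolynomial σ ℚ)} {A : Set σ}
    (hA : ∀ a ∈ A, X a ∈ J) {d : ℕ} (hd : ∀ a ∉ A, d ≤ w a) (hn : n < 3 * d) {s t : σ → ℚ}
    (hst : ∀ a ∉ A, ∀ b ∉ A, hess f a b = s a * t b + t a * s b)
    (hs : ∑ a, C (s a) * X a ∈ J) : f ∈ J := by
  classical
  have hAJ : span (X '' A) ≤ J := by
    rw [span_le]
    rintro _ ⟨a, ha, rfl⟩
    exact hA a ha
  -- Here all monomials have at least three factors; if all of these were outside `A`, the weight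
  -- would be at least `3 * d > n`.
  have h1 : f - f.quad ∈ J := by
    refine hAJ (mem_ideal_span_X_image.2 fun m hm => ?_)
    have h3 : 3 ≤ m.degree := (mem_pow_idealOfVars_iff 3 _).1 (sub_quad_mem hsq) m hm
    have h4 : Finsupp.weight w m = n := (hf.sub hf.quad) (mem_support_iff.1 hm)
    by_contra! hcon
    have : m.degree * d ≤ Finsupp.weight w m := by
      rw [Finsupp.weight_eq_sum, Finsupp.degree_eq_sum, Finset.sum_mul]
      refine Finset.sum_le_sum fun l _ => ?_
      by_cases hl : l ∈ A
      · rw [hcon l hl]; simp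
      · exact Nat.mul_le_mul_left _ (hd l hl)
    have h5 := Nat.mul_le_mul_right d h3
    omega
  have h2 : f.quad ∈ J := by
    have h3 : ∑ a, ∑ b, C (hess f a b - (s a * t b + t a * s b)) * (X a * X b) ∈ J := by
      refine _root_.sum_mem fun a _ => _root_.sum_mem fun b _ => ?_
      by_cases ha : a ∈ A
      · exact J.mul_mem_left _ (J.mul_mem_right _ (hA a ha))
      by_cases hb : b ∈ A
      · exact J.mul_mem_left _ (J.mul_mem_left _ (hA b hb))
      rw [hst a ha b hb, sub_self, C_0, zero_mul]
      exact zero_mem _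
    have h4 : ∑ a, ∑ b, C (s a * t b + t a * s b) * (X a * X b) =
        2 * ((∑ a, C (s a) * X a) * ∑ b, C (t b) * X b) := by
      rw [two_mul]
      conv_rhs =>
        congr
        · rw [Finset.sum_mul_sum]
        · rw [mul_comm, Finset.sum_mul_sum]
      rw [← Finset.sum_add_distrib]
      refine Finset.sum_congr rfl fun a _ => ?_
      rw [← Finset.sum_add_distrib]
      refine Finset.sum_congr rfl fun b _ => ?_
      rw [map_add, map_mul, map_mul]
      ring
    refine J.mul_mem_left _ ?_
    have h5 : ∑ a, ∑ b, C (hess f a b) * (X a * X b) =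
        ∑ a, ∑ b, C (hess f a b - (s a * t b + t a * s b)) * (X a * X b) +
        ∑ a, ∑ b, C (s a * t b + t a * s b) * (X a * X b) := by
      rw [← Finset.sum_add_distrib]
      refine Finset.sum_congr rfl fun a _ => ?_
      rw [← Finset.sum_add_distrib]
      refine Finset.sum_congr rfl fun b _ => ?_
      rw [← add_mul, ← C_add, sub_add_cancel]
    rw [h5, h4]
    exact add_mem h3 (J.mul_mem_left _ (J.mul_mem_right _ hs))
  have := add_mem h1 h2
  rwa [sub_add_cancel] at this

theorem apply_eq_zero_of_pderiv_eq_zero {i : σ} (h : pderiv i f = 0) {m : σ →₀ ℕ}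
    (hm : m ∈ f.support) : m i = 0 := by
  classical
  by_contra hi
  obtain ⟨m', rfl⟩ : ∃ m', m = m' + Finsupp.single i 1 :=
    ⟨m - Finsupp.single i 1, (tsub_add_cancel_of_le (by
      simpa [Finsupp.single_le_iff] using Nat.one_le_iff_ne_zero.2 hi)).symm⟩
  have h1 := coeff_pderiv (i := i) f m'
  rw [h, coeff_zero] at h1
  rcases mul_eq_zero.1 h1.symm with h2 | h2
  · exact mem_support_iff.1 hm h2
  · exact absurd h2 (by positivity)

theorem IsWeightedHomogeneous.eq_zero_of_forall_pderiv_eq_zero [Fintype σ]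
    (hf : f.IsWeightedHomogeneous w n) (hn : n ≠ 0) (h : ∀ i, pderiv i f = 0) : f = 0 := by
  have h1 := hf.sum_weight_X_mul_pderiv
  simp only [h, mul_zero, smul_zero, Finset.sum_const_zero] at h1
  simpa [hn] using h1.symm

end Weights

end MvPolynomial

/-! ### Homogeneous lifts of derivations of degree `-2` -/

namespace PositivelyElliptic

open MvPolynomial Ideal

variable {H : PositivelyElliptic}

theorem two_le_deg (H : PositivelyElliptic) (i : Fin H.k) : 2 ≤ H.deg i := by
  have h1 := H.deg_pos i
  obtain ⟨c, hc⟩ := H.deg_even i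
  omega

theorem IsPureModel.rel_mem_sq (hH : H.IsPureModel) (i : Fin H.k) :
    H.rel i ∈ irrelevant (Fin H.k) ^ 2 := mem_irrelevant_sq (hH.two_le_degree i)

theorem IsPureModel.mem_sq (hH : H.IsPureModel) {f : MvPolynomial (Fin H.k) ℚ}
    (hf : f ∈ H.relIdeal) : f ∈ irrelevant (Fin H.k) ^ 2 := by
  have : H.relIdeal ≤ irrelevant (Fin H.k) ^ 2 := by
    rw [relIdeal, span_le]
    rintro _ ⟨i, rfl⟩
    exact hH.rel_mem_sq i
  exact this hf

theorem IsPureModel.four_le_relDeg (hH : H.IsPureModel) (i : Fin H.k) : 4 ≤ H.relDeg i := by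
  have h1 := hH.two_mul_deg_le i
  have h2 := H.two_le_deg i
  omega

/-- A homogeneous relation is a combination of the defining relations with homogeneous
coefficients. -/
theorem exists_homogeneous_coeff {n : ℕ} {f : MvPolynomial (Fin H.k) ℚ}
    (hf : f.IsWeightedHomogeneous H.deg n) (hfI : f ∈ H.relIdeal) :
    ∃ c : Fin H.k → MvPolynomial (Fin H.k) ℚ, f = ∑ i, c i * H.rel i ∧
      (∀ i, (c i).IsWeightedHomogeneous H.deg (n - H.relDeg i)) ∧
      ∀ i, n < H.relDeg i → c i = 0 := by
  obtain ⟨c, rfl⟩ := mem_span_range_iff_exists_fun.1 hfI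
  refine ⟨fun i => if n < H.relDeg i then 0 else
    weightedHomogeneousComponent H.deg (n - H.relDeg i) (c i), ?_, fun i => ?_, fun i hi => ?_⟩
  · conv_lhs => rw [← hf.weightedHomogeneousComponent_same]
    rw [map_sum]
    refine Finset.sum_congr rfl fun i _ => ?_
    dsimp only
    split_ifs with h
    · rw [zero_mul, mul_comm]
      exact weightedHomogeneousComponent_mul_eq_zero (H.homogeneous i) _ h
    · obtain ⟨d, hd⟩ := Nat.exists_eq_add_of_le (not_lt.1 h)
      rw [hd, mul_comm, weightedHomogeneousComponent_mul_left (H.homogeneous i),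
        Nat.add_sub_cancel_left, mul_comm]
  · dsimp only
    split_ifs with h
    · exact isWeightedHomogeneous_zero _ _ _
    · exact weightedHomogeneousComponent_isWeightedHomogeneous _ _
  · exact if_pos hi

theorem exists_hess_rel_ne_zero (hH : H.IsPureModel) {f : MvPolynomial (Fin H.k) ℚ}
    (hf : f ∈ H.relIdeal) {a b : Fin H.k} (h : hess f a b ≠ 0) :
    ∃ i, H.relDeg i = H.deg a + H.deg b ∧ hess (H.rel i) a b ≠ 0 := by
  obtain ⟨γ, hγ⟩ := exists_hess_eq hH.rel_mem_sq hf
  rw [hγ] at h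
  obtain ⟨i, -, hi⟩ := Finset.exists_ne_zero_of_sum_ne_zero h
  have h1 := right_ne_zero_of_mul hi
  refine ⟨i, ?_, h1⟩
  by_contra h2
  exact h1 ((H.homogeneous i).hess_eq_zero (Ne.symm h2))

/-- The other relations. -/
noncomputable abbrev otherIdeal (H : PositivelyElliptic) (i : Fin H.k) :
    Ideal (MvPolynomial (Fin H.k) ℚ) :=
  ofList ((List.ofFn H.rel).eraseIdx i)

theorem otherIdeal_le (i : Fin H.k) : H.otherIdeal i ≤ H.relIdeal := by
  rw [← H.ofList_rel]
  exact span_mono fun x hx => List.mem_of_mem_eraseIdx hx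

theorem rel_mem_otherIdeal {i j : Fin H.k} (h : j ≠ i) : H.rel j ∈ H.otherIdeal i := by
  refine subset_span ?_
  refine List.mem_eraseIdx_iff_getElem.2 ⟨j, by simp, ?_, by simp⟩
  intro h'
  exact h (Fin.ext h')

/-- A homogeneous regular sequence may be permuted, so any relation can be put last. -/
theorem regMod_otherIdeal (i : Fin H.k) : (H.otherIdeal i).RegMod (H.rel i) := by
  have h1 : (List.ofFn H.rel).Perm ((List.ofFn H.rel).eraseIdx i ++ [H.rel i]) := by
    have := List.getElem_cons_eraseIdx_perm (l := List.ofFn H.rel) (n := i) (by simp)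
    rw [List.getElem_ofFn] at this
    exact this.symm.trans (List.perm_append_singleton _ _).symm
  have h2 := whomog_bot.regSeq_perm (w := H.deg) (by
    intro a ha
    obtain ⟨j, rfl⟩ := List.mem_ofFn.1 ha
    exact ⟨_, H.relDeg_pos j, H.homogeneous j⟩) h1 H.regSeq
  rw [regSeq_append, bot_sup_eq] at h2
  exact h2.2.1

theorem rel_eq_otherIdeal_sup (i : Fin H.k) : H.relIdeal ≤ H.otherIdeal i ⊔ span {H.rel i} := by
  rw [relIdeal, span_le]
  rintro _ ⟨j, rfl⟩
  by_cases h : j = i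
  · rw [h]
    exact mem_sup_right (subset_span rfl)
  · exact mem_sup_left (rel_mem_otherIdeal h)

/-- If `L * l` is a non-zero relation of the least possible degree, then `L * Q = 0` in `H` only if
`Q` is a multiple of `l` in `H`. -/
theorem exists_sub_mul_mem {n m d : ℕ} {L l Q : MvPolynomial (Fin H.k) ℚ}
    (hn : ∀ i, n ≤ H.relDeg i) (hL : L.IsWeightedHomogeneous H.deg m)
    (hl : l.IsWeightedHomogeneous H.deg d) (hmd : m + d = n)
    (h0 : L * l ≠ 0) (hLl : L * l ∈ H.relIdeal) (hLQ : L * Q ∈ H.relIdeal) :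
    ∃ f, Q - f * l ∈ H.relIdeal := by
  obtain ⟨c, hc, hc', hc0⟩ := exists_homogeneous_coeff (hmd ▸ hL.mul hl) hLl
  obtain ⟨i, hi⟩ : ∃ i, c i ≠ 0 := by
    by_contra! h
    exact h0 (by rw [hc]; simp [h])
  -- The difference `n - H.relDeg i` is zero because `n` is minimal, so the coefficient is a
  -- constant. Therefore `L * l` can replace the `i`-th relation, and its factor `L` is regular
  -- modulo the others.
  have hCi : c i = C (constantCoeff (c i)) := by
    refine eq_C_of_isWeightedHomogeneous_zero ?_
    have := hc' i
    rwa [Nat.sub_eq_zero_of_le (hn i)] at this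
  set γ := constantCoeff (c i)
  have hγ : γ ≠ 0 := by
    intro h
    rw [hCi, h, C_0] at hi
    exact hi rfl
  have h1 : L * l - C γ * H.rel i ∈ H.otherIdeal i := by
    rw [hc, ← Finset.add_sum_erase _ _ (Finset.mem_univ i), hCi, add_sub_cancel_left]
    exact sum_mem fun j hj => Ideal.mul_mem_left _ _ (rel_mem_otherIdeal (Finset.ne_of_mem_erase hj))
  have h2 : H.rel i - C γ⁻¹ * (L * l) ∈ H.otherIdeal i := by
    have h3 : H.rel i - C γ⁻¹ * (L * l) = -(C γ⁻¹ * (L * l - C γ * H.rel i)) := by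
      have h4 : (C γ⁻¹ * C γ : MvPolynomial (Fin H.k) ℚ) = 1 := by
        rw [← C_mul, inv_mul_cancel₀ hγ, C_1]
      linear_combination (-H.rel i) * h4
    rw [h3]
    exact neg_mem (Ideal.mul_mem_left _ _ h1)
  have hreg : (H.otherIdeal i).RegMod L := by
    intro x hx
    refine regMod_otherIdeal i x ?_
    have h5 : H.rel i * x = (H.rel i - C γ⁻¹ * (L * l)) * x + C γ⁻¹ * l * (L * x) := by ring
    rw [h5]
    exact add_mem (Ideal.mul_mem_right _ _ h2) (Ideal.mul_mem_left _ _ hx)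
  obtain ⟨g, hg⟩ := mem_sup_span_singleton_iff.1 (rel_eq_otherIdeal_sup i hLQ)
  refine ⟨C γ⁻¹ * g, otherIdeal_le i (hreg _ ?_)⟩
  have h6 : L * (Q - C γ⁻¹ * g * l) = (L * Q - H.rel i * g) +
      (H.rel i - C γ⁻¹ * (L * l)) * g := by ring
  rw [h6]
  exact add_mem hg (Ideal.mul_mem_right _ _ h2)

section Derivation

variable {δ : Derivation ℚ H.Alg H.Alg} {r : ℤ}

/-- The subalgebra of elements killed by a derivation. -/
def kerSubalgebra (δ : Derivation ℚ H.Alg H.Alg) : Subalgebra ℚ H.Alg where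
  carrier := {x | δ x = 0}
  mul_mem' {a b} ha hb := by
    change δ a = 0 at ha
    change δ b = 0 at hb
    change δ (a * b) = 0
    rw [Derivation.leibniz, ha, hb, smul_zero, smul_zero, add_zero]
  add_mem' {a b} ha hb := by
    change δ a = 0 at ha
    change δ b = 0 at hb
    change δ (a + b) = 0
    rw [map_add, ha, hb, add_zero]
  algebraMap_mem' c := δ.map_algebraMap c

/-- A derivation of negative degree which on all generators is proportional, by constants of the
derivation, to its value on one generator, is zero. -/
theorem HasDegree.eq_zero_of_forall_eq_mul (hδ : H.HasDegree δ r) (hr : r < 0) (t : Fin H.k)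
    (ρ : Fin H.k → H.Alg) (hρ : ∀ i, δ (ρ i) = 0)
    (h : ∀ i, δ (H.toAlg (X i)) = ρ i * δ (H.toAlg (X t))) : δ = 0 := by
  have ht : δ (H.toAlg (X t)) = 0 := by
    refine hδ.eq_zero_of_generators hr (kerSubalgebra δ) (fun b hb => hb) _ fun i => ?_
    -- After this correction every generator is a constant of `δ`; over the constants the algebra is
    -- thus generated by `X t` alone.
    have h1 : H.toAlg (X i) - ρ i * H.toAlg (X t) ∈ kerSubalgebra δ := by
      change δ _ = 0
      rw [map_sub, Derivation.leibniz, hρ, smul_zero, add_zero, smul_eq_mul, h i, sub_self]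
    have h2 : H.toAlg (X i) = (H.toAlg (X i) - ρ i * H.toAlg (X t)) + ρ i * H.toAlg (X t) := by
      ring
    rw [h2]
    refine add_mem (Subalgebra.algebraMap_mem (Algebra.adjoin (kerSubalgebra δ) _) ⟨_, h1⟩)
      (mul_mem (Subalgebra.algebraMap_mem (Algebra.adjoin (kerSubalgebra δ) _) ⟨_, hρ i⟩)
        (Algebra.subset_adjoin rfl))
  exact eq_zero_of_forall_X fun i => by rw [h, ht, mul_zero]

/-- A homogeneous lift to the polynomial ring of a derivation of degree `-2`. -/
structure IsLift (δ : Derivation ℚ H.Alg H.Alg)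
    (D : Derivation ℚ (MvPolynomial (Fin H.k) ℚ) (MvPolynomial (Fin H.k) ℚ)) : Prop where
  toAlg_apply : ∀ f, H.toAlg (D f) = δ (H.toAlg f)
  apply_X_eq_zero : ∀ i, H.deg i = 2 → D (X i) = 0
  homogeneous_X : ∀ i, (D (X i)).IsWeightedHomogeneous H.deg (H.deg i - 2)

/-- Generators of degree two go to constants, hence to zero by nilpotence. Lifting them to zero
makes `D` vanish there exactly and not just modulo the relations; any homogeneous lifts serve for
the others. -/
theorem HasDegree.exists_isLift (hδ : H.HasDegree δ (-2)) :
    ∃ D : Derivation ℚ (MvPolynomial (Fin H.k) ℚ) (MvPolynomial (Fin H.k) ℚ), IsLift δ D := by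
  have key : ∀ i, ∃ g : MvPolynomial (Fin H.k) ℚ, H.toAlg g = δ (H.toAlg (X i)) ∧
      (H.deg i = 2 → g = 0) ∧ g.IsWeightedHomogeneous H.deg (H.deg i - 2) := by
    intro i
    by_cases hi : H.deg i = 2
    · refine ⟨0, ?_, fun _ => rfl, isWeightedHomogeneous_zero _ _ _⟩
      obtain ⟨g, hg, -, hg'⟩ := hδ.exists_lift (isWeightedHomogeneous_X ℚ H.deg i)
      rw [hi] at hg'
      have hC := eq_C_of_isWeightedHomogeneous_zero (H := H) hg'
      rw [map_zero]
      refine (apply_eq_zero_of_isNilpotent (H.isNilpotent_toAlg_X i)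
        (c := constantCoeff g) ?_).symm
      rw [← hg, ← hC]
    · obtain ⟨g, hg, -, hg'⟩ := hδ.exists_lift (isWeightedHomogeneous_X ℚ H.deg i)
      refine ⟨g, hg, fun h => absurd h hi, ?_⟩
      have h2 : ((H.deg i : ℤ) + -2).toNat = H.deg i - 2 := by omega
      rwa [h2] at hg'
  choose g hg hg0 hgh using key
  refine ⟨mkDerivation ℚ g, ?_, fun i hi => ?_, fun i => ?_⟩
  · intro f
    induction f using MvPolynomial.induction_on with
    | C c => rw [apply_toAlg_C, derivation_C, map_zero]
    | add p q hp hq => simp only [map_add, hp, hq]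
    | mul_X p i hp =>
      rw [Derivation.leibniz, map_add, map_mul, Derivation.leibniz, smul_eq_mul, smul_eq_mul,
        smul_eq_mul, smul_eq_mul, map_mul, map_mul, hp, mkDerivation_X, hg]
  · rw [mkDerivation_X, hg0 i hi]
  · rw [mkDerivation_X]
    exact hgh i

namespace IsLift

variable {D : Derivation ℚ (MvPolynomial (Fin H.k) ℚ) (MvPolynomial (Fin H.k) ℚ)}

theorem mem (hD : IsLift δ D) {f : MvPolynomial (Fin H.k) ℚ} (hf : f ∈ H.relIdeal) :
    D f ∈ H.relIdeal := by
  rw [← toAlg_eq_zero_iff, hD.toAlg_apply, toAlg_eq_zero_iff.2 hf, map_zero]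

theorem constantCoeff_X (hD : IsLift δ D) (i : Fin H.k) : constantCoeff (D (X i)) = 0 := by
  by_cases hi : H.deg i = 2
  · rw [hD.apply_X_eq_zero i hi, map_zero]
  · have := H.two_le_deg i
    exact (hD.homogeneous_X i).constantCoeff_eq_zero (by omega)

theorem homogeneous (hD : IsLift δ D) {f : MvPolynomial (Fin H.k) ℚ} {n : ℕ}
    (hf : f.IsWeightedHomogeneous H.deg n) : (D f).IsWeightedHomogeneous H.deg (n - 2) := by
  rw [derivation_eq_sum]
  refine IsWeightedHomogeneous.sum _ _ _ fun i _ => ?_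
  by_cases hi : H.deg i = 2
  · rw [hD.apply_X_eq_zero i hi, mul_zero]
    exact isWeightedHomogeneous_zero _ _ _
  rcases lt_or_ge n (H.deg i) with h | h
  · rw [hf.pderiv_eq_zero h, zero_mul]
    exact isWeightedHomogeneous_zero _ _ _
  · have h1 := H.two_le_deg i
    have h2 : n - 2 = (n - H.deg i) + (H.deg i - 2) := by omega
    rw [h2]
    exact (hf.pderiv_sub i).mul (hD.homogeneous_X i)

/-- A lift kills the linear forms in the generators of degree two. -/
theorem apply_eq_zero (hD : IsLift δ D) {f : MvPolynomial (Fin H.k) ℚ}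
    (hf : f.IsWeightedHomogeneous H.deg 2) : D f = 0 := by
  rw [derivation_eq_sum]
  refine Finset.sum_eq_zero fun i _ => ?_
  by_cases hi : H.deg i = 2
  · rw [hD.apply_X_eq_zero i hi, mul_zero]
  · have := H.two_le_deg i
    rw [hf.pderiv_eq_zero (by omega), zero_mul]

theorem apply_apply_eq_sum (D : Derivation ℚ (MvPolynomial (Fin H.k) ℚ) (MvPolynomial (Fin H.k) ℚ))
    (f : MvPolynomial (Fin H.k) ℚ) : D (D f) =
      ∑ j, (∑ i, pderiv i (pderiv j f) * D (X i)) * D (X j) + ∑ j, pderiv j f * D (D (X j)) := by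
  rw [derivation_eq_sum D f, map_sum, ← Finset.sum_add_distrib]
  refine Finset.sum_congr rfl fun j _ => ?_
  rw [Derivation.leibniz, derivation_eq_sum D (pderiv j f), smul_eq_mul, smul_eq_mul]
  ring

/-- If all generators except `z` are mapped to multiples of a linear form `D (X t)`, then no
product of `D (X t)` with a linear form is a relation. -/
theorem mul_notMem (hD : IsLift δ D) (hH : H.IsPureModel) (hδ : H.HasDegree δ r) (hr : r < 0)
    (hδ0 : δ ≠ 0) {z t : Fin H.k} {ρ : Fin H.k → ℚ} (ht : H.deg t = 4)
    (hz : H.deg z = 6) (hρ : ∀ i ≠ z, D (X i) = C (ρ i) * D (X t)) (ht0 : D (X t) ≠ 0)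
    {L : MvPolynomial (Fin H.k) ℚ} (hL : L.IsWeightedHomogeneous H.deg 2) (hL0 : L ≠ 0) :
    L * D (X t) ∉ H.relIdeal := by
  intro hmem
  have htl : (D (X t)).IsWeightedHomogeneous H.deg 2 := by
    have := hD.homogeneous_X t
    rwa [ht] at this
  -- `L` is a constant of `δ`, and `L * δ` kills all generators except `z`: integration by parts in
  -- `z`.
  have hLz : H.toAlg L * δ (H.toAlg (X z)) = 0 := by
    let B : Subalgebra ℚ H.Alg := Algebra.adjoin ℚ (Set.range fun i : {i // i ≠ z} => H.toAlg (X i.1))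
    refine hδ.mul_apply_eq_zero hr ?_ B ?_ _ fun i => ?_
    · rw [← hD.toAlg_apply, hD.apply_eq_zero hL, map_zero]
    · intro b hb
      induction hb using Algebra.adjoin_induction with
      | mem x hx =>
        obtain ⟨i, rfl⟩ := hx
        dsimp only
        rw [← hD.toAlg_apply, hρ i.1 i.2, ← map_mul, toAlg_eq_zero_iff, mul_left_comm]
        exact Ideal.mul_mem_left _ _ hmem
      | algebraMap c => rw [δ.map_algebraMap, mul_zero]
      | add x y _ _ hx hy => rw [map_add, mul_add, hx, hy, add_zero]
      | mul x y _ _ hx hy =>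
        rw [Derivation.leibniz, smul_eq_mul, smul_eq_mul, mul_add, mul_left_comm, hy,
          mul_left_comm, hx, mul_zero, mul_zero, add_zero]
    · by_cases hi : i = z
      · rw [hi]; exact Algebra.subset_adjoin rfl
      · exact Subalgebra.algebraMap_mem (Algebra.adjoin B {H.toAlg (X z)})
          ⟨_, Algebra.subset_adjoin ⟨⟨i, hi⟩, rfl⟩⟩
  rw [← hD.toAlg_apply, ← map_mul, toAlg_eq_zero_iff] at hLz
  -- `L * D (X t)` has degree four, the least possible for a relation, so `D (X z)` is a multiple of
  -- `D (X t)` in the algebra. The factor may be taken of degree two, where `D` vanishes, and then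
  -- `δ = 0`.
  obtain ⟨f, hf⟩ := exists_sub_mul_mem hH.four_le_relDeg hL htl rfl (mul_ne_zero hL0 ht0) hmem hLz
  have hzh : (D (X z)).IsWeightedHomogeneous H.deg (2 + 2) := by
    have := hD.homogeneous_X z
    rwa [hz] at this
  have hf2 := H.whomog_relIdeal _ hf (2 + 2)
  rw [map_sub, hzh.weightedHomogeneousComponent_same, mul_comm,
    weightedHomogeneousComponent_mul_left htl, ← toAlg_eq_zero_iff, map_sub, sub_eq_zero] at hf2
  set f2 := weightedHomogeneousComponent H.deg 2 f
  have hf2h : f2.IsWeightedHomogeneous H.deg 2 := weightedHomogeneousComponent_isWeightedHomogeneous _ _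
  refine hδ0 (hδ.eq_zero_of_forall_eq_mul hr t
    (fun i => if i = z then H.toAlg f2 else H.toAlg (C (ρ i))) (fun i => ?_) fun i => ?_)
  · split_ifs
    · rw [← hD.toAlg_apply, hD.apply_eq_zero hf2h, map_zero]
    · exact apply_toAlg_C _ _
  · rw [← hD.toAlg_apply, ← hD.toAlg_apply]
    split_ifs with hi
    · rw [hi, hf2, mul_comm, map_mul]
    · rw [← map_mul, ← hρ i hi]

end IsLift

end Derivation

end PositivelyElliptic

/-! ### The action of a lift on quadratic parts -/

namespace PositivelyElliptic

open MvPolynomial Ideal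

variable {H : PositivelyElliptic}

theorem eq_C_of_pderiv_eq {f : MvPolynomial (Fin H.k) ℚ} {n : ℕ}
    (hf : f.IsWeightedHomogeneous H.deg n) {i : Fin H.k} (hi : n = H.deg i) :
    pderiv i f = C (constantCoeff (pderiv i f)) := by
  refine eq_C_of_isWeightedHomogeneous_zero ?_
  have := hf.pderiv_sub i
  rwa [hi, Nat.sub_self] at this

theorem pderiv_eq_zero_of_mem_sq {f : MvPolynomial (Fin H.k) ℚ} {n : ℕ}
    (hf : f.IsWeightedHomogeneous H.deg n) (hsq : f ∈ irrelevant (Fin H.k) ^ 2) {i : Fin H.k}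
    (hi : n ≤ H.deg i) : pderiv i f = 0 := by
  rcases hi.lt_or_eq with h | h
  · exact hf.pderiv_eq_zero h
  · rw [eq_C_of_pderiv_eq hf h, constantCoeff_pderiv_of_mem_sq hsq, C_0]

theorem pderiv_pderiv_eq_C {f : MvPolynomial (Fin H.k) ℚ} {n : ℕ}
    (hf : f.IsWeightedHomogeneous H.deg n) {i j : Fin H.k} (hij : n = H.deg i + H.deg j) :
    pderiv i (pderiv j f) = C (hess f i j) :=
  eq_C_of_pderiv_eq (hf.pderiv_sub j) (by omega)

theorem pderiv_pderiv_eq_zero {f : MvPolynomial (Fin H.k) ℚ} {n : ℕ}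
    (hf : f.IsWeightedHomogeneous H.deg n) {i j : Fin H.k} (hij : n < H.deg i + H.deg j) :
    pderiv i (pderiv j f) = 0 := by
  rcases lt_or_ge n (H.deg j) with h | h
  · rw [hf.pderiv_eq_zero h, map_zero]
  · exact (hf.pderiv_sub j).pderiv_eq_zero (by omega)

theorem eq_zero_of_linear {f : MvPolynomial (Fin H.k) ℚ} (hf : f.IsWeightedHomogeneous H.deg 2)
    (h : ∀ i, H.deg i = 2 → constantCoeff (pderiv i f) = 0) : f = 0 := by
  refine hf.eq_zero_of_forall_pderiv_eq_zero two_ne_zero fun i => ?_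
  by_cases hi : H.deg i = 2
  · rw [eq_C_of_pderiv_eq hf hi.symm, h i hi, C_0]
  · have := H.two_le_deg i
    exact hf.pderiv_eq_zero (by omega)

theorem prime_of_linear {f : MvPolynomial (Fin H.k) ℚ} (hf : f.IsWeightedHomogeneous H.deg 2)
    (h0 : f ≠ 0) : Prime f := by
  have hdeg : ∀ m ∈ f.support, m.degree = 1 := by
    intro m hm
    have h1 : Finsupp.weight H.deg m = 2 := hf (mem_support_iff.1 hm)
    have h2 : m.degree * 2 ≤ Finsupp.weight H.deg m := by
      rw [Finsupp.weight_eq_sum, Finsupp.degree_eq_sum, Finset.sum_mul]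
      exact Finset.sum_le_sum fun l _ => Nat.mul_le_mul_left _ (H.two_le_deg l)
    have h3 : m.degree ≠ 0 := by
      intro h
      rw [Finsupp.degree_eq_zero_iff] at h
      rw [h, map_zero] at h1
      omega
    omega
  obtain ⟨m, hm⟩ := support_nonempty.2 h0
  refine (irreducible_of_totalDegree_eq_one ?_ fun x hx => ?_).prime
  · refine IsHomogeneous.totalDegree (n := 1) (fun d hd => ?_) h0
    have := hdeg d (mem_support_iff.2 hd)
    rwa [Finsupp.degree_eq_weight_one] at this
  · refine isUnit_iff_ne_zero.2 fun h => ?_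
    have := hx m
    rw [h, zero_dvd_iff] at this
    exact mem_support_iff.1 hm this

/-- Below degree 18 the only pure power of `z` available to a relation is `z²`. If no relation
contained it, all would lie in the ideal of the other `k - 1` generators. -/
theorem IsPureModel.exists_hess_ne_zero (hH : H.IsPureModel) {z : Fin H.k} (hz : H.deg z = 6)
    (hlt : ∀ i, H.relDeg i < 18) : ∃ i, hess (H.rel i) z z ≠ 0 := by
  by_contra! hcon
  refine not_rel_mem_span_union (H := H) (Finset.univ.erase z) ∅ ∅ ?_ (by simp) fun i _ => ?_
  · have := z.2
    rw [Finset.card_erase_of_mem (Finset.mem_univ z), Finset.card_univ, Fintype.card_fin]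
    simp only [Finset.card_empty]
    omega
  · refine (H.homogeneous i).mem_of_hess (hH.rel_mem_sq i)
      (A := (Finset.univ.erase z : Finset (Fin H.k))) (d := 6) (s := 0) (t := 0)
      (fun a ha => subset_span (Or.inl (Or.inl ⟨a, ha, rfl⟩))) (fun a ha => ?_)
      (by have := hlt i; omega) (fun a ha b hb => ?_) (by simp)
    · have : a = z := by simpa using ha
      rw [this, hz]
    · have ha' : a = z := by simpa using ha
      have hb' : b = z := by simpa using hb
      rw [ha', hb', hcon i]
      simp

theorem relDeg_eq_of_hess_ne_zero {i a b : Fin H.k} (h : hess (H.rel i) a b ≠ 0) :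
    H.relDeg i = H.deg a + H.deg b := by
  by_contra h'
  exact h ((H.homogeneous i).hess_eq_zero (Ne.symm h'))

section Derivation

variable {δ : Derivation ℚ H.Alg H.Alg} {r : ℤ}

theorem HasDegree.apply_X_eq_zero (hδ : H.HasDegree δ r) {i : Fin H.k}
    (h : H.deg i + r ≤ 0 ∨ Odd r) : δ (H.toAlg (X i)) = 0 := by
  obtain ⟨g, hg, hg0, hgh⟩ := hδ.exists_lift (isWeightedHomogeneous_X ℚ H.deg i)
  rcases lt_or_ge ((H.deg i : ℤ) + r) 0 with h1 | h1
  · rw [← hg, hg0 h1, map_zero]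
  rcases h with h | h
  · rw [Int.toNat_of_nonpos h] at hgh
    have hC := eq_C_of_isWeightedHomogeneous_zero hgh
    refine apply_eq_zero_of_isNilpotent (H.isNilpotent_toAlg_X i) (c := constantCoeff g) ?_
    rw [← hg, ← hC]
  · have : g = 0 := by
      by_contra hne
      obtain ⟨m, hm⟩ := support_nonempty.2 hne
      have h2 : Finsupp.weight H.deg m = _ := hgh (mem_support_iff.1 hm)
      obtain ⟨a, ha⟩ := H.even_weight m
      obtain ⟨b, hb⟩ := H.deg_even i
      obtain ⟨c, hc⟩ := h
      omega
    rw [← hg, this, map_zero]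

namespace IsLift

variable {D : Derivation ℚ (MvPolynomial (Fin H.k) ℚ) (MvPolynomial (Fin H.k) ℚ)}

theorem lin_eq_zero (hD : IsLift δ D) {j a : Fin H.k} (h : H.deg j ≠ H.deg a + 2) :
    constantCoeff (pderiv a (D (X j))) = 0 := by
  by_cases hj : H.deg j = 2
  · rw [hD.apply_X_eq_zero j hj, map_zero, map_zero]
  have h1 := H.two_le_deg j
  have h2 := hD.homogeneous_X j
  rcases lt_or_ge (H.deg j - 2) (H.deg a) with h3 | h3
  · rw [h2.pderiv_eq_zero h3, map_zero]
  · exact (h2.pderiv_sub a).constantCoeff_eq_zero (by omega)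

theorem exists_apply_X_ne_zero (hD : IsLift δ D) (hδ : H.HasDegree δ r) (hr : r < 0) (hδ0 : δ ≠ 0)
    (z : Fin H.k) : ∃ t, t ≠ z ∧ D (X t) ≠ 0 := by
  by_contra! h
  refine hδ0 (hδ.eq_zero_of_forall_ne hr z fun i hi => ?_)
  rw [← hD.toAlg_apply, h i hi, map_zero]

variable {z : Fin H.k}

theorem sum_hess_mul_lin (hD : IsLift δ D) (hz : ∀ i ≠ z, H.deg i ≤ 4)
    (f : MvPolynomial (Fin H.k) ℚ) (a : Fin H.k) {y : Fin H.k} (hy : H.deg y = 4) :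
    ∑ j, hess f a j * constantCoeff (pderiv y (D (X j))) =
      hess f a z * constantCoeff (pderiv y (D (X z))) := by
  refine Finset.sum_eq_single z (fun j _ hj => ?_) (by simp)
  have := hz j hj
  rw [hD.lin_eq_zero (by omega), mul_zero]

theorem sum_hess_mul_lin_eq_zero (hD : IsLift δ D) (hz : ∀ i, H.deg i ≤ 6)
    (f : MvPolynomial (Fin H.k) ℚ) (a : Fin H.k) {y : Fin H.k} (hy : H.deg y = 6) :
    ∑ j, hess f a j * constantCoeff (pderiv y (D (X j))) = 0 := by
  refine Finset.sum_eq_zero fun j _ => ?_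
  have := hz j
  rw [hD.lin_eq_zero (by omega), mul_zero]

theorem hess_apply_z (hD : IsLift δ D) (hH : H.IsPureModel) (hz : H.deg z = 6)
    (hne : ∀ i ≠ z, H.deg i ≤ 4) {f : MvPolynomial (Fin H.k) ℚ} (hf : f ∈ H.relIdeal)
    {y : Fin H.k} (hy : H.deg y = 4) :
    hess (D f) z y = hess f z z * constantCoeff (pderiv y (D (X z))) := by
  have h6 : ∀ i, H.deg i ≤ 6 := by
    intro i
    by_cases h : i = z
    · rw [h, hz]
    · exact (hne i h).trans (by norm_num)
  rw [hess_derivation D hD.constantCoeff_X (hH.mem_sq hf), Finset.sum_add_distrib,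
    hD.sum_hess_mul_lin hne f z hy, hD.sum_hess_mul_lin_eq_zero h6 f y hz, add_zero]

theorem hess_apply_y (hD : IsLift δ D) (hH : H.IsPureModel)
    (hne : ∀ i ≠ z, H.deg i ≤ 4) {f : MvPolynomial (Fin H.k) ℚ} (hf : f ∈ H.relIdeal)
    {y y' : Fin H.k} (hy : H.deg y = 4) (hy' : H.deg y' = 4) :
    hess (D f) y y' = hess f z y * constantCoeff (pderiv y' (D (X z))) +
      hess f z y' * constantCoeff (pderiv y (D (X z))) := by
  rw [hess_derivation D hD.constantCoeff_X (hH.mem_sq hf), Finset.sum_add_distrib,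
    hD.sum_hess_mul_lin hne f y hy', hD.sum_hess_mul_lin hne f y' hy, hess_comm f y z,
    hess_comm f y' z]

/-- For degree reasons, and by `hc` in the case of `z`, the values of `D` on generators involve only
generators of degree two, which `D` kills. -/
theorem apply_apply_X_eq_zero (hD : IsLift δ D) (hz : H.deg z = 6) (hne : ∀ i ≠ z, H.deg i ≤ 4)
    (hc : ∀ y, H.deg y = 4 → constantCoeff (pderiv y (D (X z))) = 0) (i : Fin H.k) :
    D (D (X i)) = 0 := by
  have hi := hD.homogeneous_X i
  rw [derivation_eq_sum]
  refine Finset.sum_eq_zero fun j _ => ?_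
  by_cases hj : H.deg j = 2
  · rw [hD.apply_X_eq_zero j hj, mul_zero]
  have h1 := H.two_le_deg j
  obtain ⟨b, hb⟩ := H.deg_even j
  by_cases hiz : i = z
  · rw [hiz, hz] at hi
    by_cases hj4 : H.deg j = 4
    · rw [hiz, eq_C_of_pderiv_eq hi hj4.symm, hc j hj4, C_0, zero_mul]
    · rw [hiz, hi.pderiv_eq_zero (by omega), zero_mul]
  · have := hne i hiz
    rw [hi.pderiv_eq_zero (by omega), zero_mul]

/-- The quadratic part of a relation of degree `8` is isotropic. -/
theorem sum_hess_eq_zero (hD : IsLift δ D) (hH : H.IsPureModel) (hδ : H.HasDegree δ r) (hr : r < 0)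
    (hδ0 : δ ≠ 0) {t : Fin H.k} {ρ : Fin H.k → ℚ} (ht : H.deg t = 4)
    (hz : H.deg z = 6) (hne : ∀ i ≠ z, H.deg i ≤ 4)
    (hρ : ∀ i ≠ z, D (X i) = C (ρ i) * D (X t)) (ht0 : D (X t) ≠ 0)
    (hc : ∀ y, H.deg y = 4 → constantCoeff (pderiv y (D (X z))) = 0)
    {u : MvPolynomial (Fin H.k) ℚ} (hu : u.IsWeightedHomogeneous H.deg 8) (huI : u ∈ H.relIdeal) :
    ∑ j, ∑ i, hess u i j * ρ i * ρ j = 0 := by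
  have h1 := hD.mem (hD.mem huI)
  have hρ0 : ∀ i, H.deg i = 2 → ρ i = 0 := by
    intro i hi
    have hiz : i ≠ z := by
      rintro rfl
      omega
    have := hρ i hiz
    rw [hD.apply_X_eq_zero i hi, eq_comm, mul_eq_zero] at this
    exact C_eq_zero.1 (this.resolve_right ht0)
  -- On the generators of degree four, `D` is the vector `ρ` times a linear form, so applying it
  -- twice evaluates the quadratic part at `ρ`. Terms with `z` and a generator of degree at least
  -- four exceed degree eight.
  have h2 : D (D u) = C (∑ j, ∑ i, hess u i j * ρ i * ρ j) * D (X t) * D (X t) := by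
    rw [apply_apply_eq_sum]
    simp only [hD.apply_apply_X_eq_zero hz hne hc, mul_zero, Finset.sum_const_zero, add_zero,
      map_sum, Finset.sum_mul]
    refine Finset.sum_congr rfl fun j _ => Finset.sum_congr rfl fun i _ => ?_
    by_cases hi : H.deg i = 2
    · rw [hD.apply_X_eq_zero i hi, hρ0 i hi]
      simp
    by_cases hj : H.deg j = 2
    · rw [hD.apply_X_eq_zero j hj, hρ0 j hj]
      simp
    have hi2 := H.two_le_deg i
    have hj2 := H.two_le_deg j
    obtain ⟨a, ha⟩ := H.deg_even i
    obtain ⟨b, hb⟩ := H.deg_even j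
    by_cases hij : i = z ∨ j = z
    · have h3 : 8 < H.deg i + H.deg j := by
        rcases hij with rfl | rfl <;> omega
      rw [pderiv_pderiv_eq_zero hu h3, hu.hess_eq_zero (by omega)]
      simp
    · push Not at hij
      have hi4 := hne i hij.1
      have hj4 := hne j hij.2
      rw [pderiv_pderiv_eq_C hu (by omega), hρ i hij.1, hρ j hij.2]
      simp only [map_mul]
      ring
  rw [h2] at h1
  by_contra hs
  refine hD.mul_notMem hH hδ hr hδ0 ht hz hρ ht0 ?_ (mul_ne_zero (C_ne_zero.2 hs) ht0) h1
  have h4 := hD.homogeneous_X t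
  rw [ht] at h4
  have h5 := (isWeightedHomogeneous_C H.deg (∑ j, ∑ i, hess u i j * ρ i * ρ j)).mul h4
  rwa [zero_add] at h5

/-- If there is only one generator `x` of degree two and `D (X z)` has no linear part, then the
derivation vanishes. -/
theorem eq_zero_of_unique (hD : IsLift δ D) (hδ : H.HasDegree δ r) (hr : r < 0) {x : Fin H.k}
    (hx : H.deg x = 2) (hx' : ∀ i, H.deg i = 2 → i = x) (hz : H.deg z = 6)
    (hne : ∀ i ≠ z, H.deg i ≤ 4)
    (hc : ∀ y, H.deg y = 4 → constantCoeff (pderiv y (D (X z))) = 0) : δ = 0 := by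
  by_contra hδ0
  obtain ⟨t, htz, ht0⟩ := hD.exists_apply_X_ne_zero hδ hr hδ0 z
  have hlin : ∀ f : MvPolynomial (Fin H.k) ℚ, f.IsWeightedHomogeneous H.deg 2 →
      f = C (constantCoeff (pderiv x f)) * X x := by
    intro f hf
    refine sub_eq_zero.1 (eq_zero_of_linear ?_ fun i hi => ?_)
    · have h1 := isWeightedHomogeneous_X ℚ H.deg x
      rw [hx] at h1
      have h2 := (isWeightedHomogeneous_C H.deg (constantCoeff (pderiv x f))).mul h1
      rw [zero_add] at h2
      exact hf.sub h2
    · rw [hx' i hi]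
      simp
  have hy : ∀ i ≠ z, (D (X i)).IsWeightedHomogeneous H.deg 2 := by
    intro i hi
    by_cases h2 : H.deg i = 2
    · rw [hD.apply_X_eq_zero i h2]
      exact isWeightedHomogeneous_zero _ _ _
    · have h3 := H.two_le_deg i
      obtain ⟨a, ha⟩ := H.deg_even i
      have h4 := hne i hi
      have h5 := hD.homogeneous_X i
      rwa [show H.deg i - 2 = 2 by omega] at h5
  have hz4 : (D (X z)).IsWeightedHomogeneous H.deg 4 := by
    have := hD.homogeneous_X z
    rwa [hz] at this
  -- Euler's identity: `D (X z)` depends on `x` alone, so it is a multiple of `x`, hence of `D (X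
  -- t)`, by a factor of degree two that `D` kills.
  have hQ : C 2 * D (X z) = X x * pderiv x (D (X z)) := by
    have h1 := hz4.sum_weight_X_mul_pderiv
    rw [Finset.sum_eq_single x (fun i _ hi => ?_) (by simp), hx] at h1
    · have h2 : (C 2 : MvPolynomial (Fin H.k) ℚ) ≠ 0 := C_ne_zero.2 two_ne_zero
      refine mul_left_cancel₀ h2 ?_
      rw [← mul_assoc, ← C_mul]
      simp only [nsmul_eq_mul] at h1
      have h3 : (C 2 : MvPolynomial (Fin H.k) ℚ) = ((2 : ℕ) : MvPolynomial (Fin H.k) ℚ) := rfl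
      have h4 : (C (2 * 2) : MvPolynomial (Fin H.k) ℚ) =
          ((4 : ℕ) : MvPolynomial (Fin H.k) ℚ) := by norm_num; rfl
      rw [h3, h4, h1]
    · have hi2 : H.deg i ≠ 2 := fun h => hi (hx' i h)
      have hi3 := H.two_le_deg i
      obtain ⟨a, ha⟩ := H.deg_even i
      by_cases hi4 : H.deg i = 4
      · rw [eq_C_of_pderiv_eq hz4 hi4.symm, hc i hi4, C_0, mul_zero, smul_zero]
      · rw [hz4.pderiv_eq_zero (by omega), mul_zero, smul_zero]
  set a : Fin H.k → ℚ := fun i => constantCoeff (pderiv x (D (X i)))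
  have ha : ∀ i ≠ z, D (X i) = C (a i) * X x := fun i hi => hlin _ (hy i hi)
  have hat : a t ≠ 0 := by
    intro h
    rw [ha t htz, h, C_0, zero_mul] at ht0
    exact ht0 rfl
  have hat' : (C (a t)⁻¹ * C (a t) : MvPolynomial (Fin H.k) ℚ) = 1 := by
    rw [← C_mul, inv_mul_cancel₀ hat, C_1]
  have h2' : (C 2⁻¹ * C 2 : MvPolynomial (Fin H.k) ℚ) = 1 := by
    rw [← C_mul, inv_mul_cancel₀ two_ne_zero, C_1]
  refine hδ0 (hδ.eq_zero_of_forall_eq_mul hr t (fun i => H.toAlg (if i = z then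
    C (a t)⁻¹ * C 2⁻¹ * pderiv x (D (X z)) else C (a i) * C (a t)⁻¹)) (fun i => ?_) fun i => ?_)
  · rw [← hD.toAlg_apply]
    split_ifs
    · rw [← C_mul, Derivation.leibniz, derivation_C, hD.apply_eq_zero]
      · simp
      · have := hz4.pderiv_sub x
        rwa [hx] at this
    · rw [← C_mul, derivation_C, map_zero]
  · rw [← hD.toAlg_apply, ← hD.toAlg_apply, ← map_mul]
    congr 1
    split_ifs with hi
    · rw [hi, ha t htz]
      calc D (X z) = C 2⁻¹ * C 2 * D (X z) := by rw [h2', one_mul]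
        _ = C 2⁻¹ * (X x * pderiv x (D (X z))) := by rw [mul_assoc, hQ]
        _ = C (a t)⁻¹ * C (a t) * (C 2⁻¹ * (X x * pderiv x (D (X z)))) := by rw [hat', one_mul]
        _ = _ := by ring
    · rw [ha i hi, ha t htz]
      linear_combination (-(C (a i) * X x)) * hat'

end IsLift

end Derivation

end PositivelyElliptic

/-! ### Generators of degrees `2, …, 2, 4, 6` -/

namespace PositivelyElliptic

open MvPolynomial Ideal

variable {H : PositivelyElliptic}

theorem four_mul_add_le_sum {k : ℕ} (f : Fin k → ℕ) (hk : 3 ≤ k) (hf : ∀ i, 4 ≤ f i) :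
    4 * (k - 3) + f ⟨k - 3, by omega⟩ + f ⟨k - 2, by omega⟩ + f ⟨k - 1, by omega⟩ ≤ ∑ i, f i := by
  obtain ⟨n, rfl⟩ := Nat.exists_eq_add_of_le' hk
  rw [Fin.sum_univ_castSucc, Fin.sum_univ_castSucc, Fin.sum_univ_castSucc]
  have h1 := Finset.card_nsmul_le_sum (Finset.univ : Finset (Fin n))
    (fun i => f i.castSucc.castSucc.castSucc) 4 fun i _ => hf _
  rw [Finset.card_univ, Fintype.card_fin, smul_eq_mul] at h1
  have h2 : f ⟨n + 3 - 3, by omega⟩ = f (Fin.last n).castSucc.castSucc := rfl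
  have h3 : f ⟨n + 3 - 2, by omega⟩ = f (Fin.last (n + 1)).castSucc := rfl
  have h4 : f ⟨n + 3 - 1, by omega⟩ = f (Fin.last (n + 2)) := rfl
  omega

/-- In a pure model that does not split, whose first `p` generators have degree two, not all of the
first `p` relations involve only these generators. -/
theorem IsPureModel.exists_pderiv_ne_zero (hH : H.IsPureModel) (hsplit : ¬ H.Splits) {p : ℕ}
    (hp : 0 < p) (hpk : p < H.k) (hdeg : ∀ i : Fin H.k, i.1 < p → H.deg i = 2) :
    ∃ i j : Fin H.k, i.1 < p ∧ p ≤ j.1 ∧ pderiv j (H.rel i) ≠ 0 := by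
  by_contra! h
  exact hsplit (hH.splits hp hpk hdeg fun i hi m hm j hj =>
    apply_eq_zero_of_pderiv_eq_zero (h i j hi hj) hm)

namespace IsLift

variable {δ : Derivation ℚ H.Alg H.Alg} {r : ℤ}
  {D : Derivation ℚ (MvPolynomial (Fin H.k) ℚ) (MvPolynomial (Fin H.k) ℚ)} {z t : Fin H.k}

theorem apply_eq_add (hD : IsLift δ D) (htz : t ≠ z) (hx : ∀ i, i ≠ z → i ≠ t → H.deg i = 2)
    (f : MvPolynomial (Fin H.k) ℚ) :
    D f = pderiv t f * D (X t) + pderiv z f * D (X z) := by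
  rw [derivation_eq_sum]
  refine Finset.sum_eq_add t z htz (fun i _ hi => ?_) (by simp) (by simp)
  rw [hD.apply_X_eq_zero i (hx i hi.2 hi.1), mul_zero]

theorem apply_X_eq_C_mul (hD : IsLift δ D) (hx : ∀ i, i ≠ z → i ≠ t → H.deg i = 2) :
    ∀ i ≠ z, D (X i) = C (if i = t then 1 else 0) * D (X t) := by
  intro i hi
  split_ifs with h
  · rw [h, C_1, one_mul]
  · rw [hD.apply_X_eq_zero i (hx i hi h), C_0, zero_mul]

theorem apply_X_ne_zero (hD : IsLift δ D) (hδ : H.HasDegree δ r) (hr : r < 0) (hδ0 : δ ≠ 0)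
    (hx : ∀ i, i ≠ z → i ≠ t → H.deg i = 2) : D (X t) ≠ 0 := by
  obtain ⟨i, hi, h0⟩ := hD.exists_apply_X_ne_zero hδ hr hδ0 z
  rw [hD.apply_X_eq_C_mul hx i hi] at h0
  exact right_ne_zero_of_mul h0

/-- Having no linear term, `f` does not involve `z`, so `D f` is `pderiv t f * D (X t)`. Were the
first factor non-zero, this would be a product of linear forms forbidden by `mul_notMem`. -/
theorem pderiv_eq_zero_of_mem (hD : IsLift δ D) (hH : H.IsPureModel) (hδ : H.HasDegree δ r)
    (hr : r < 0) (hδ0 : δ ≠ 0) (ht : H.deg t = 4) (hz : H.deg z = 6)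
    (hx : ∀ i, i ≠ z → i ≠ t → H.deg i = 2) {f : MvPolynomial (Fin H.k) ℚ}
    (hf : f.IsWeightedHomogeneous H.deg 6) (hfI : f ∈ H.relIdeal) : pderiv t f = 0 := by
  have htz : t ≠ z := by
    rintro rfl
    omega
  by_contra hne
  have h1 := hD.mem hfI
  rw [hD.apply_eq_add htz hx, pderiv_eq_zero_of_mem_sq hf (hH.mem_sq hfI) hz.ge, zero_mul,
    add_zero] at h1
  have h2 := hf.pderiv_sub t
  rw [ht] at h2
  exact hD.mul_notMem hH hδ hr hδ0 ht hz (hD.apply_X_eq_C_mul hx)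
    (hD.apply_X_ne_zero hδ hr hδ0 hx) h2 hne h1

/-- Apply `D` three times to the relation containing `z²`, with Hessian entry `ζ`. The result has
degree six and its entry at `x, t` is `3 * ζ * c² * l`, where `l` is a non-zero coefficient of `D (X
t)`; but relations of degree six do not involve `t`. -/
theorem lin_z_eq_zero (hD : IsLift δ D) (hH : H.IsPureModel) (hδ : H.HasDegree δ r)
    (hr : r < 0) (hδ0 : δ ≠ 0) (ht : H.deg t = 4) (hz : H.deg z = 6)
    (hx : ∀ i, i ≠ z → i ≠ t → H.deg i = 2) {i : Fin H.k} (hi : hess (H.rel i) z z ≠ 0) :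
    constantCoeff (pderiv t (D (X z))) = 0 := by
  have ht0 := hD.apply_X_ne_zero hδ hr hδ0 hx
  have htl : (D (X t)).IsWeightedHomogeneous H.deg 2 := by
    have := hD.homogeneous_X t
    rwa [ht] at this
  have htz : t ≠ z := by
    rintro rfl
    omega
  have hne : ∀ i ≠ z, H.deg i ≤ 4 := by
    intro i hi
    by_cases h : i = t
    · rw [h, ht]
    · rw [hx i hi h]
      norm_num
  set c := constantCoeff (pderiv t (D (X z)))
  by_contra hc
  obtain ⟨x, hx2, hxl⟩ : ∃ x, H.deg x = 2 ∧ constantCoeff (pderiv x (D (X t))) ≠ 0 := by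
    by_contra! h
    exact ht0 (eq_zero_of_linear htl h)
  set l := constantCoeff (pderiv x (D (X t)))
  have hr0 := relDeg_eq_of_hess_ne_zero hi
  have hI1 := hD.mem (H.rel_mem i)
  have hI2 := hD.mem hI1
  have hI3 := hD.mem hI2
  have hh := H.homogeneous i
  rw [hr0, hz] at hh
  have hh3 := hD.homogeneous (hD.homogeneous (hD.homogeneous hh))
  have hlin : ∀ f : MvPolynomial (Fin H.k) ℚ, ∀ a,
      ∑ j, hess f a j * constantCoeff (pderiv x (D (X j))) = hess f a t * l := by
    intro f a
    refine Finset.sum_eq_single t (fun j _ hj => ?_) (by simp)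
    by_cases hjz : j = z
    · rw [hD.lin_eq_zero (by rw [hjz]; omega), mul_zero]
    · rw [hD.apply_X_eq_zero j (hx j hjz hj), map_zero, map_zero, mul_zero]
  have h1 : hess (D (H.rel i)) z t = hess (H.rel i) z z * c := hD.hess_apply_z hH hz hne (H.rel_mem i) ht
  have h2 : hess (D (D (H.rel i))) t t = hess (D (H.rel i)) z t * c + hess (D (H.rel i)) z t * c :=
    hD.hess_apply_y hH hne hI1 ht ht
  have h6 : ∀ i, H.deg i ≤ 6 := by
    intro i
    by_cases h : i = z
    · rw [h, hz]
    · exact (hne i h).trans (by norm_num)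
  have h3 : hess (D (D (H.rel i))) x z = hess (D (H.rel i)) z t * l := by
    rw [hess_derivation D hD.constantCoeff_X (hH.mem_sq hI1), Finset.sum_add_distrib,
      hD.sum_hess_mul_lin_eq_zero h6 _ x hz, zero_add, hlin]
  have h4 : hess (D (D (D (H.rel i)))) x t = hess (D (D (H.rel i))) x z * c +
      hess (D (D (H.rel i))) t t * l := by
    rw [hess_derivation D hD.constantCoeff_X (hH.mem_sq hI2), Finset.sum_add_distrib,
      hD.sum_hess_mul_lin hne _ x ht, hlin]
  have h5 : hess (D (D (D (H.rel i)))) x t = 0 := by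
    rw [hess, hD.pderiv_eq_zero_of_mem hH hδ hr hδ0 ht hz hx hh3 hI3, map_zero, map_zero]
  rw [h5, h3, h2, h1] at h4
  have h7 : 3 * (hess (H.rel i) z z * c * c * l) = 0 := by linear_combination -h4
  simp [hi, hc, hxl] at h7

end IsLift

/-- The case of one generator of degree four and one of degree six. -/
theorem IsPureModel.lt_formalDim_of_single (hH : H.IsPureModel) (hsplit : ¬ H.Splits)
    {δ : Derivation ℚ H.Alg H.Alg} (hδ : H.HasDegree δ (-2)) (hδ0 : δ ≠ 0) (hk : 3 ≤ H.k)
    (hdeg : ∀ i : Fin H.k, i.1 < H.k - 2 → H.deg i = 2) (ht : H.deg ⟨H.k - 2, by omega⟩ = 4)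
    (hz : H.deg ⟨H.k - 1, by omega⟩ = 6) : 20 < H.formalDim := by
  by_contra! hfd
  obtain ⟨D, hD⟩ := hδ.exists_isLift
  have hr : (-2 : ℤ) < 0 := by norm_num
  set t : Fin H.k := ⟨H.k - 2, by omega⟩ with ht_def
  set z : Fin H.k := ⟨H.k - 1, by omega⟩ with hz_def
  have htz : t ≠ z := by
    intro h
    rw [h] at ht
    omega
  have hx : ∀ i, i ≠ z → i ≠ t → H.deg i = 2 := by
    intro i hi hi'
    refine hdeg i ?_
    have h1 : i.1 ≠ H.k - 1 := fun h => hi (Fin.ext h)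
    have h2 : i.1 ≠ H.k - 2 := fun h => hi' (Fin.ext h)
    omega
  have hne : ∀ i ≠ z, H.deg i ≤ 4 := by
    intro i hi
    by_cases h : i = t
    · rw [h, ht]
    · rw [hx i hi h]
      norm_num
  have ht0 := hD.apply_X_ne_zero hδ hr hδ0 hx
  have htl : (D (X t)).IsWeightedHomogeneous H.deg 2 := by
    have := hD.homogeneous_X t
    rwa [ht] at this
  have hρ := hD.apply_X_eq_C_mul hx
  have hsum : ∑ i, H.relDeg i ≤ 2 * H.k + 26 := by
    have h1 := H.sum_relDeg_le
    have h2 : ∑ i, H.deg i = 2 * H.k + 6 := by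
      have h3 : ∀ i, H.deg i = 2 + ((if i = t then 2 else 0) + if i = z then 4 else 0) := by
        intro i
        by_cases h : i = t
        · rw [h, ht, if_pos rfl, if_neg htz]
        by_cases h' : i = z
        · rw [h', hz, if_pos rfl, if_neg htz.symm]
        · rw [hx i h' h, if_neg h, if_neg h']
      simp only [h3, Finset.sum_add_distrib, Finset.sum_const, Finset.card_univ, Fintype.card_fin,
        Finset.sum_ite_eq', Finset.mem_univ, if_true, smul_eq_mul]
      omega
    omega
  have hlow : 4 * (H.k - 3) + H.relDeg ⟨H.k - 3, by omega⟩ + H.relDeg t + H.relDeg z ≤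
      ∑ i, H.relDeg i := four_mul_add_le_sum H.relDeg hk hH.four_le_relDeg
  have hm1 : H.relDeg ⟨H.k - 3, by omega⟩ ≤ H.relDeg t :=
    hH.relDeg_mono (Fin.mk_le_mk.2 (by omega))
  have hm2 : H.relDeg t ≤ H.relDeg z := hH.relDeg_mono (Fin.mk_le_mk.2 (by omega))
  have hlast : ∀ i, H.relDeg i ≤ H.relDeg z := fun i =>
    hH.relDeg_mono (Fin.le_def.2 (by have := i.2; simp only [hz_def]; omega))
  -- If the first `k - 2` relations had degree at most six, none would involve `t` or `z`, and the
  -- algebra would split. This bound already excludes `(2,2,2,4,6; 4,4,6,10,12)`.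
  have hp8 : 8 ≤ H.relDeg ⟨H.k - 3, by omega⟩ := by
    by_contra! hlt
    obtain ⟨i, j, hi, hj, hij⟩ := hH.exists_pderiv_ne_zero hsplit (p := H.k - 2) (by omega)
      (by omega) hdeg
    refine hij ?_
    have h1 : H.relDeg i ≤ H.relDeg ⟨H.k - 3, by omega⟩ :=
      hH.relDeg_mono (Fin.le_def.2 (by simp only; omega))
    have h2 := H.even_relDeg i
    have h3 : H.relDeg i ≤ 6 := by
      obtain ⟨a, ha⟩ := h2
      omega
    have h4 : j = t ∨ j = z := by
      have := j.2
      rcases (show j.1 = H.k - 2 ∨ j.1 = H.k - 1 by omega) with h | h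
      · exact Or.inl (Fin.ext h)
      · exact Or.inr (Fin.ext h)
    rcases h4 with rfl | rfl
    · by_cases h6 : H.relDeg i = 6
      · exact hD.pderiv_eq_zero_of_mem hH hδ hr hδ0 ht hz hx (h6 ▸ H.homogeneous i) (H.rel_mem i)
      · refine pderiv_eq_zero_of_mem_sq (H.homogeneous i) (hH.rel_mem_sq i) ?_
        obtain ⟨a, ha⟩ := h2
        omega
    · exact pderiv_eq_zero_of_mem_sq (H.homogeneous i) (hH.rel_mem_sq i) (by omega)
  obtain ⟨i₀, hi₀⟩ := hH.exists_hess_ne_zero hz fun i => by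
    have := hlast i
    omega
  have hi₀' := relDeg_eq_of_hess_ne_zero hi₀
  have hz12 : 12 ≤ H.relDeg z := by
    have := hlast i₀
    omega
  have hc := hD.lin_z_eq_zero hH hδ hr hδ0 ht hz hx hi₀
  have hc' : ∀ y, H.deg y = 4 → constantCoeff (pderiv y (D (X z))) = 0 := by
    intro y hy
    by_cases hyz : y = z
    · rw [hyz] at hy
      omega
    by_cases hyt : y = t
    · rw [hyt, hc]
    · have := hx y hyz hyt
      omega
  let A : Finset (Fin H.k) := (Finset.univ.erase z).erase t
  have hA : A.card = H.k - 2 := by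
    rw [Finset.card_erase_of_mem (by simp [htz]), Finset.card_erase_of_mem (by simp),
      Finset.card_univ, Fintype.card_fin]
    omega
  have hmemA : ∀ a, a ∉ A → a = t ∨ a = z := by
    intro a ha
    by_contra! h
    exact ha (by simp [A, h])
  have hmem : ∀ S : Set (MvPolynomial (Fin H.k) ℚ), X '' (A : Set (Fin H.k)) ⊆ S → ∀ i,
      H.relDeg i < 12 → hess (H.rel i) t t = 0 → hess (H.rel i) t z = 0 → H.rel i ∈ span S := by
    intro S hS i hi h1 h2
    refine (H.homogeneous i).mem_of_hess (hH.rel_mem_sq i) (A := A) (d := 4) (s := 0) (t := 0)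
      (fun a ha => subset_span (hS ⟨a, ha, rfl⟩)) (fun a ha => ?_) (by omega)
      (fun a ha b hb => ?_) (by simp)
    · rcases hmemA a ha with rfl | rfl <;> omega
    · have h3 : hess (H.rel i) z z = 0 := (H.homogeneous i).hess_eq_zero (by omega)
      rcases hmemA a ha with rfl | rfl <;> rcases hmemA b hb with rfl | rfl <;>
        simp [h1, h2, h3, hess_comm _ z t]
  have hiso : ∀ i, H.relDeg i ≤ 8 → hess (H.rel i) t t = 0 := by
    intro i hi
    by_cases h8 : H.relDeg i = 8
    · have := hD.sum_hess_eq_zero hH hδ hr hδ0 ht hz hne hρ ht0 hc' (h8 ▸ H.homogeneous i)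
        (H.rel_mem i)
      simpa using this
    · exact (H.homogeneous i).hess_eq_zero (by omega)
  -- Otherwise all relations but the last have degree at most eight. Their `t²` coefficients vanish
  -- by isotropy, so they lie in the ideal of the `k - 2` generators of degree two.
  have ht10 : 10 ≤ H.relDeg t := by
    by_contra! hlt
    have ht8 : H.relDeg t ≤ 8 := by
      obtain ⟨a, ha⟩ := H.even_relDeg t
      omega
    refine not_rel_mem_span_union (H := H) A ∅ {z} ?_ (by simp) fun i hi => ?_
    · rw [hA, Finset.card_empty, Finset.card_singleton]
      omega
    · have h1 : H.relDeg i ≤ H.relDeg t := by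
        refine hH.relDeg_mono (Fin.le_def.2 ?_)
        have h2 : i.1 ≠ H.k - 1 := fun h => hi (Finset.mem_singleton.2 (Fin.ext h))
        have := i.2
        simp only [ht_def]
        omega
      exact hmem _ (Set.subset_union_left.trans Set.subset_union_left) i (by omega)
        (hiso i (by omega)) ((H.homogeneous i).hess_eq_zero (by omega))
  -- The lower bounds 8, 10, 12 on the last three relations, and 4 on the others, fit under `2 * k +
  -- 26` only for `k ≤ 4`.
  rcases (show H.k = 3 ∨ H.k = 4 by omega) with hk3 | hk4
  · refine hδ0 (hD.eq_zero_of_unique hδ hr (x := ⟨0, by omega⟩) (hdeg _ (by simp only; omega))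
      (fun i hi => ?_) hz hne hc')
    have h1 : i ≠ t := by
      rintro rfl
      omega
    have h2 : i ≠ z := by
      rintro rfl
      omega
    have h3 : i.1 ≠ H.k - 1 := fun h => h2 (Fin.ext h)
    have h4 : i.1 ≠ H.k - 2 := fun h => h1 (Fin.ext h)
    have := i.2
    exact Fin.ext (by simp only; omega)
  let i₁ : Fin H.k := ⟨0, by omega⟩
  have hother : ∀ i, i ≠ i₁ → 8 ≤ H.relDeg i := by
    intro i hi
    refine hp8.trans (hH.relDeg_mono (Fin.le_def.2 ?_))
    have h1 : i.1 ≠ 0 := fun h => hi (Fin.ext h)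
    simp only
    omega
  have ht10' : H.relDeg t = 10 := by omega
  have hz4 : (D (X z)).IsWeightedHomogeneous H.deg 4 := by
    have := hD.homogeneous_X z
    rwa [hz] at this
  -- Without the term `t * z` in the relation of degree ten, every relation but the last would again
  -- lie in the ideal of the generators of degree two.
  have hκ : hess (H.rel t) t z ≠ 0 := by
    intro hκ
    refine not_rel_mem_span_union (H := H) A ∅ {z} ?_ (by simp) fun i hi => ?_
    · rw [hA, Finset.card_empty, Finset.card_singleton]
      omega
    · by_cases hit : i = t
      · rw [hit]
        exact hmem _ (Set.subset_union_left.trans Set.subset_union_left) t (by omega)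
          ((H.homogeneous t).hess_eq_zero (by omega)) hκ
      · have h1 : H.relDeg i ≤ H.relDeg ⟨H.k - 3, by omega⟩ := by
          refine hH.relDeg_mono (Fin.le_def.2 ?_)
          have h2 : i.1 ≠ H.k - 1 := fun h => hi (Finset.mem_singleton.2 (Fin.ext h))
          have h3 : i.1 ≠ H.k - 2 := fun h => hit (Fin.ext h)
          have := i.2
          simp only
          omega
        exact hmem _ (Set.subset_union_left.trans Set.subset_union_left) i (by omega)
          (hiso i (by omega)) ((H.homogeneous i).hess_eq_zero (by omega))
  have hut := H.homogeneous t
  rw [ht10'] at hut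
  set m := pderiv t (pderiv t (H.rel t))
  have hm : m.IsWeightedHomogeneous H.deg 2 := by
    have := (hut.pderiv_sub t).pderiv_sub t
    rwa [ht] at this
  set κ := hess (H.rel t) t z
  have hDD : D (D (H.rel t)) = D (X t) * (m * D (X t) + C (2 * κ) * D (X z)) := by
    have h1 : pderiv t (pderiv z (H.rel t)) = C κ := pderiv_pderiv_eq_C hut (by omega)
    have h2 : pderiv z (pderiv t (H.rel t)) = C κ := by rw [pderiv_pderiv_comm, h1]
    have h3 : pderiv z (pderiv z (H.rel t)) = 0 := pderiv_pderiv_eq_zero hut (by omega)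
    have h4 : (C 2 : MvPolynomial (Fin H.k) ℚ) = 2 := rfl
    rw [hD.apply_eq_add htz hx (H.rel t), map_add, Derivation.leibniz, Derivation.leibniz,
      hD.apply_apply_X_eq_zero hz hne hc', hD.apply_apply_X_eq_zero hz hne hc',
      hD.apply_eq_add htz hx (pderiv t (H.rel t)), hD.apply_eq_add htz hx (pderiv z (H.rel t)),
      h1, h2, h3, C_mul, h4]
    simp only [smul_eq_mul]
    ring
  have hDDI := hD.mem (hD.mem (H.rel_mem t))
  have hDDh := hD.homogeneous (hD.homogeneous hut)
  -- `D (D (H.rel t))` has degree six, so only the first relation can contribute to it, all others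
  -- having degree at least eight.
  obtain ⟨c, hc1, -, hc3⟩ := exists_homogeneous_coeff hDDh hDDI
  rw [Finset.sum_eq_single i₁ (fun i _ hi => by
    rw [hc3 i (by have := hother i hi; omega), zero_mul]) (by simp), hDD] at hc1
  have h1deg : H.relDeg i₁ = 4 := by
    have h1 := hH.four_le_relDeg i₁
    have h2 : H.relDeg i₁ + H.relDeg ⟨H.k - 3, by omega⟩ + H.relDeg t + H.relDeg z ≤
        ∑ i, H.relDeg i := by
      have h3 : ∀ (n : ℕ) (hn : n = 4) (f : Fin n → ℕ), f ⟨0, by omega⟩ + f ⟨n - 3, by omega⟩ +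
          f ⟨n - 2, by omega⟩ + f ⟨n - 1, by omega⟩ ≤ ∑ i, f i := by
        rintro n rfl f
        rw [Fin.sum_univ_four]
        exact le_rfl
      exact h3 H.k hk4 H.relDeg
    omega
  have hu1 := H.homogeneous i₁
  rw [h1deg] at hu1
  -- If the prime `D (X t)` divides the coefficient, cancelling it makes `D (X z)` a multiple of `D
  -- (X t)` in the algebra, so `δ = 0`. If it divides the first relation, that relation is a product
  -- forbidden by `mul_notMem`.
  rcases (prime_of_linear htl ht0).dvd_or_dvd (Dvd.intro _ hc1) with ⟨g, hg⟩ | ⟨g, hg⟩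
  · have hgI : m * D (X t) + C (2 * κ) * D (X z) ∈ H.relIdeal := by
      rw [hg, mul_assoc] at hc1
      rw [mul_left_cancel₀ ht0 hc1]
      exact Ideal.mul_mem_left _ _ (H.rel_mem i₁)
    have h2κ : 2 * κ ≠ 0 := mul_ne_zero two_ne_zero hκ
    have hinv : (C (2 * κ)⁻¹ * C (2 * κ) : MvPolynomial (Fin H.k) ℚ) = 1 := by
      rw [← C_mul, inv_mul_cancel₀ h2κ, C_1]
    refine hδ0 (hδ.eq_zero_of_forall_eq_mul hr t (fun i => H.toAlg (if i = z then
      -(C (2 * κ)⁻¹ * m) else C (if i = t then 1 else 0))) (fun i => ?_) fun i => ?_)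
    · rw [← hD.toAlg_apply]
      split_ifs
      · rw [map_neg, Derivation.leibniz, derivation_C, hD.apply_eq_zero hm]
        simp
      all_goals rw [derivation_C, map_zero]
    · rw [← hD.toAlg_apply, ← hD.toAlg_apply, ← map_mul, ← sub_eq_zero, ← map_sub,
        toAlg_eq_zero_iff]
      by_cases hi : i = z
      · rw [if_pos hi, hi]
        have : D (X z) - -(C (2 * κ)⁻¹ * m) * D (X t) =
            C (2 * κ)⁻¹ * (m * D (X t) + C (2 * κ) * D (X z)) := by
          linear_combination (-D (X z)) * hinv
        rw [this]
        exact Ideal.mul_mem_left _ _ hgI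
      · rw [if_neg hi, hρ i hi, sub_self]
        exact zero_mem _
  · have hg2 : H.rel i₁ = D (X t) * weightedHomogeneousComponent H.deg 2 g := by
      rw [← weightedHomogeneousComponent_mul_left htl, ← hg]
      exact hu1.weightedHomogeneousComponent_same.symm
    refine hD.mul_notMem hH hδ hr hδ0 ht hz hρ ht0
      (weightedHomogeneousComponent_isWeightedHomogeneous (w := H.deg) 2 g) (fun h => ?_) ?_
    · rw [h, mul_zero] at hg2
      exact H.rel_ne_zero _ hg2
    · rw [mul_comm, ← hg2]
      exact H.rel_mem _

end PositivelyElliptic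

/-! ### Generators of degrees `2, 4, 4, 6` -/

namespace PositivelyElliptic

open MvPolynomial Ideal

variable {H : PositivelyElliptic}

/-- A Hessian entry of an element of the ideal is proportional to that of the only defining
relation of the appropriate degree. -/
theorem exists_hess_eq_mul (hH : H.IsPureModel) {f : MvPolynomial (Fin H.k) ℚ}
    (hf : f ∈ H.relIdeal) {n : ℕ} {i : Fin H.k} (hi : ∀ j, H.relDeg j = n → j = i) :
    ∃ γ : ℚ, ∀ a b, H.deg a + H.deg b = n → hess f a b = γ * hess (H.rel i) a b := by
  obtain ⟨γ, hγ⟩ := exists_hess_eq hH.rel_mem_sq hf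
  refine ⟨γ i, fun a b hab => ?_⟩
  rw [hγ]
  refine Finset.sum_eq_single i (fun j _ hj => ?_) (by simp)
  rw [(H.homogeneous j).hess_eq_zero, mul_zero]
  rw [hab]
  exact fun h => hj (hi j h.symm)

/-- Membership in an ideal containing the generators of degree two. -/
theorem IsPureModel.mem_of_hess (hH : H.IsPureModel) {f : MvPolynomial (Fin H.k) ℚ} {n : ℕ}
    (hf : f.IsWeightedHomogeneous H.deg n) (hfI : f ∈ H.relIdeal) (hn : n < 12)
    {J : Ideal (MvPolynomial (Fin H.k) ℚ)} (hJ : ∀ i, H.deg i = 2 → X i ∈ J) {s t : Fin H.k → ℚ}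
    (hst : ∀ a, H.deg a ≠ 2 → ∀ b, H.deg b ≠ 2 → hess f a b = s a * t b + t a * s b)
    (hs : ∑ a, C (s a) * X a ∈ J) : f ∈ J := by
  refine hf.mem_of_hess (hH.mem_sq hfI) (A := {i | H.deg i = 2}) hJ (d := 4) (fun a ha => ?_)
    (by omega) hst hs
  have h1 := H.two_le_deg a
  obtain ⟨b, hb⟩ := H.deg_even a
  have h2 : H.deg a ≠ 2 := ha
  omega

theorem IsPureModel.mem_of_hess_eq_zero (hH : H.IsPureModel) {f : MvPolynomial (Fin H.k) ℚ} {n : ℕ}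
    (hf : f.IsWeightedHomogeneous H.deg n) (hfI : f ∈ H.relIdeal) (hn : n < 12)
    {J : Ideal (MvPolynomial (Fin H.k) ℚ)} (hJ : ∀ i, H.deg i = 2 → X i ∈ J)
    (h0 : ∀ a, H.deg a ≠ 2 → ∀ b, H.deg b ≠ 2 → hess f a b = 0) : f ∈ J :=
  hH.mem_of_hess hf hfI hn hJ (s := 0) (t := 0) (fun a ha b hb => by simp [h0 a ha b hb]) (by simp)

theorem constantCoeff_linear (s : Fin H.k → ℚ) :
    constantCoeff (∑ a, C (s a) * X a : MvPolynomial (Fin H.k) ℚ) = 0 := by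
  simp

/-- In a pure model that does not split, whose generators of degree two are the first `p`, the
relation with index `p - 1` has degree at least six. -/
theorem IsPureModel.six_le_relDeg (hH : H.IsPureModel) (hsplit : ¬ H.Splits) {p : ℕ}
    (hpk : p + 1 < H.k) (hdeg : ∀ i : Fin H.k, H.deg i = 2 ↔ i.1 < p + 1) :
    6 ≤ H.relDeg ⟨p, by omega⟩ := by
  by_contra! hlt
  obtain ⟨i, j, hi, hj, hij⟩ := hH.exists_pderiv_ne_zero hsplit (p := p + 1) (by omega) hpk
    fun i hi => (hdeg i).2 hi
  refine hij (pderiv_eq_zero_of_mem_sq (H.homogeneous i) (hH.rel_mem_sq i) ?_)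
  have h1 : H.relDeg i ≤ H.relDeg ⟨p, by omega⟩ :=
    hH.relDeg_mono (Fin.le_def.2 (by simp only; omega))
  have h2 : H.deg j ≠ 2 := fun h => by
    have := (hdeg j).1 h
    omega
  have h3 := H.two_le_deg j
  obtain ⟨a, ha⟩ := H.deg_even j
  obtain ⟨b, hb⟩ := H.even_relDeg i
  omega

/-- The case of generators of degrees `2, 4, 4, 6`. -/
theorem IsPureModel.lt_formalDim_of_two_four_four_six (hH : H.IsPureModel) (hsplit : ¬ H.Splits)
    {δ : Derivation ℚ H.Alg H.Alg} (hδ : H.HasDegree δ (-2)) (hδ0 : δ ≠ 0) (hk : H.k = 4)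
    (h₀ : H.deg ⟨0, by omega⟩ = 2) (h₁ : H.deg ⟨1, by omega⟩ = 4) (h₂ : H.deg ⟨2, by omega⟩ = 4)
    (h₃ : H.deg ⟨3, by omega⟩ = 6) : 20 < H.formalDim := by
  by_contra! hfd
  obtain ⟨D, hD⟩ := hδ.exists_isLift
  have hr : (-2 : ℤ) < 0 := by norm_num
  set x : Fin H.k := ⟨0, by omega⟩ with hx
  set y : Fin H.k := ⟨1, by omega⟩ with hy
  set y' : Fin H.k := ⟨2, by omega⟩ with hy'
  set z : Fin H.k := ⟨3, by omega⟩ with hz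
  have hall : ∀ i : Fin H.k, i = x ∨ i = y ∨ i = y' ∨ i = z := by
    intro i
    have := i.2
    simp only [Fin.ext_iff, hx, hy, hy', hz]
    omega
  have hsum : ∀ f : Fin H.k → ℕ, ∑ i, f i = f x + f y + f y' + f z := by
    have : ∀ (n : ℕ) (hn : n = 4) (f : Fin n → ℕ), ∑ i, f i = f ⟨0, by omega⟩ + f ⟨1, by omega⟩ +
        f ⟨2, by omega⟩ + f ⟨3, by omega⟩ := by
      rintro n rfl f
      exact Fin.sum_univ_four f
    exact this H.k hk
  have hne : ∀ i ≠ z, H.deg i ≤ 4 := by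
    intro i hi
    rcases hall i with rfl | rfl | rfl | rfl <;> omega
  have hdeg2 : ∀ i, H.deg i = 2 → i = x := by
    intro i hi
    rcases hall i with rfl | rfl | rfl | rfl <;> omega
  have hbound := H.sum_relDeg_le
  rw [hsum, hsum, h₀, h₁, h₂, h₃] at hbound
  have hm1 : H.relDeg x ≤ H.relDeg y := hH.relDeg_mono (Fin.mk_le_mk.2 (by omega))
  have hm2 : H.relDeg y ≤ H.relDeg y' := hH.relDeg_mono (Fin.mk_le_mk.2 (by omega))
  have hm3 : H.relDeg y' ≤ H.relDeg z := hH.relDeg_mono (Fin.mk_le_mk.2 (by omega))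
  have hb0 : 6 ≤ H.relDeg x := hH.six_le_relDeg hsplit (p := 0) (by omega) fun i => by
    have hv : x.1 = 0 ∧ y.1 = 1 ∧ y'.1 = 2 ∧ z.1 = 3 := ⟨rfl, rfl, rfl, rfl⟩
    rcases hall i with rfl | rfl | rfl | rfl <;> constructor <;> intro h <;> omega
  have hb1 := hH.two_mul_deg_le y
  have hb2 := hH.two_mul_deg_le y'
  obtain ⟨i₀, hi₀⟩ := hH.exists_hess_ne_zero h₃ fun i => by
    rcases hall i with rfl | rfl | rfl | rfl <;> omega
  have hi₀' := relDeg_eq_of_hess_ne_zero hi₀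
  set c : Fin H.k → ℚ := fun j => constantCoeff (pderiv j (D (X z))) with hc
  -- As there is one generator of degree two, `D (X z)` needs a linear part. Applied to the relation
  -- containing `z²`, `D` then produces a term `z * t` and `D²` a term `t²`, which forces relations
  -- of degrees ten and eight.
  obtain ⟨t, ht, hct⟩ : ∃ t, H.deg t = 4 ∧ c t ≠ 0 := by
    by_contra! h
    exact hδ0 (hD.eq_zero_of_unique hδ hr h₀ hdeg2 h₃ hne h)
  set ζ := hess (H.rel i₀) z z
  have hI1 := hD.mem (H.rel_mem i₀)
  have hI2 := hD.mem hI1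
  have hDz : ∀ j, H.deg j = 4 → hess (D (H.rel i₀)) z j = ζ * c j := fun j hj =>
    hD.hess_apply_z hH h₃ hne (H.rel_mem i₀) hj
  have hDy : ∀ j l, H.deg j = 4 → H.deg l = 4 →
      hess (D (D (H.rel i₀))) j l = 2 * ζ * (c j * c l) := by
    intro j l hj hl
    rw [hD.hess_apply_y hH hne hI1 hj hl, hDz j hj, hDz l hl]
    ring
  obtain ⟨i₁, hi₁, -⟩ := exists_hess_rel_ne_zero hH hI1 (a := z) (b := t) (by
    rw [hDz t ht]
    exact mul_ne_zero hi₀ hct)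
  obtain ⟨i₂, hi₂, -⟩ := exists_hess_rel_ne_zero hH hI2 (a := t) (b := t) (by
    rw [hDy t t ht ht]
    exact mul_ne_zero (mul_ne_zero two_ne_zero hi₀) (mul_ne_zero hct hct))
  have hbx : H.relDeg x = 6 ∧ H.relDeg y = 8 ∧ H.relDeg y' = 10 ∧ H.relDeg z = 12 := by
    rcases hall i₀ with rfl | rfl | rfl | rfl <;> rcases hall i₁ with rfl | rfl | rfl | rfl <;>
      rcases hall i₂ with rfl | rfl | rfl | rfl <;> omega
  obtain ⟨hbx, hby, hby', hbz⟩ := hbx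
  have hc0 : ∀ a, H.deg a ≠ 4 → c a = 0 := fun a ha => hD.lin_eq_zero (by omega)
  obtain ⟨γ, hγ⟩ := exists_hess_eq_mul hH hI1 (n := 10) (i := y') fun j hj => by
    rcases hall j with rfl | rfl | rfl | rfl <;> first | rfl | omega
  obtain ⟨γ', hγ'⟩ := exists_hess_eq_mul hH hI2 (n := 8) (i := y) fun j hj => by
    rcases hall j with rfl | rfl | rfl | rfl <;> first | rfl | omega
  have hγ0 : γ ≠ 0 := by
    intro h
    have := hγ z t (by omega)
    rw [hDz t ht, h, zero_mul] at this
    exact mul_ne_zero hi₀ hct this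
  have hγ0' : γ' ≠ 0 := by
    intro h
    have := hγ' t t (by omega)
    rw [hDy t t ht ht, h, zero_mul] at this
    exact mul_ne_zero (mul_ne_zero two_ne_zero hi₀) (mul_ne_zero hct hct) this
  -- With `w = ∑ c a * X a`, the relation of degree eight is a multiple of `w²` modulo `x`, and the
  -- one of degree ten is a multiple of `z * w`. Hence `x`, `w` and the last relation generate an
  -- ideal containing all four relations.
  have hu1 : ∀ a b, H.deg a = 4 → H.deg b = 4 → hess (H.rel y) a b = 2 * (γ'⁻¹ * ζ * (c a * c b)) := by
    intro a b ha hb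
    have := hγ' a b (by omega)
    rw [hDy a b ha hb] at this
    field_simp
    linear_combination -this
  have hu2 : ∀ b, H.deg b = 4 → hess (H.rel y') z b = γ⁻¹ * ζ * c b := by
    intro b hb
    have := hγ z b (by omega)
    rw [hDz b hb] at this
    field_simp
    linear_combination -this
  have hcase : ∀ a, H.deg a ≠ 2 → H.deg a = 4 ∨ a = z := by
    intro a ha
    rcases hall a with rfl | rfl | rfl | rfl
    exacts [absurd h₀ ha, Or.inl h₁, Or.inl h₂, Or.inr rfl]
  have hzc : c z = 0 := hc0 z (by omega)
  refine not_rel_mem_span_union (H := H) {x} {∑ a, C (c a) * X a} {z} (by simp; omega) ?_ fun i hi => ?_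
  · intro e he
    rw [Finset.mem_singleton.1 he]
    exact constantCoeff_linear c
  have hJ : ∀ i, H.deg i = 2 → X i ∈ span (X '' (({x} : Finset (Fin H.k)) : Set (Fin H.k)) ∪
      (({∑ a, C (c a) * X a} : Finset (MvPolynomial (Fin H.k) ℚ)) : Set _) ∪
      H.rel '' (({z} : Finset (Fin H.k)) : Set (Fin H.k))) := fun i hi =>
    subset_span (Or.inl (Or.inl ⟨x, by simp, by rw [hdeg2 i hi]⟩))
  have hw : ∑ a, C (c a) * X a ∈ span (X '' (({x} : Finset (Fin H.k)) : Set (Fin H.k)) ∪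
      (({∑ a, C (c a) * X a} : Finset (MvPolynomial (Fin H.k) ℚ)) : Set _) ∪
      H.rel '' (({z} : Finset (Fin H.k)) : Set (Fin H.k))) :=
    subset_span (Or.inl (Or.inr (by simp)))
  rcases hall i with rfl | rfl | rfl | rfl
  · refine hH.mem_of_hess_eq_zero (H.homogeneous x) (H.rel_mem x) (by omega) hJ fun a ha b hb => ?_
    refine (H.homogeneous x).hess_eq_zero ?_
    rcases hcase a ha with ha | rfl <;> rcases hcase b hb with hb | rfl <;> omega
  · refine hH.mem_of_hess (H.homogeneous y) (H.rel_mem y) (by omega) hJ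
      (s := c) (t := fun a => γ'⁻¹ * ζ * c a) (fun a ha b hb => ?_) hw
    rcases hcase a ha with ha | rfl <;> rcases hcase b hb with hb | rfl
    · rw [hu1 a b ha hb]
      ring
    all_goals
      rw [(H.homogeneous y).hess_eq_zero (by omega), hzc]
      ring
  · refine hH.mem_of_hess (H.homogeneous y') (H.rel_mem y') (by omega) hJ
      (s := c) (t := fun a => if a = z then γ⁻¹ * ζ else 0) (fun a ha b hb => ?_) hw
    rcases hcase a ha with ha | rfl <;> rcases hcase b hb with hb | rfl
    · rw [(H.homogeneous y').hess_eq_zero (by omega), if_neg (by rintro rfl; omega),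
        if_neg (by rintro rfl; omega)]
      ring
    · rw [hess_comm, hu2 a ha, if_pos rfl, hzc]
      ring
    · rw [hu2 b hb, if_pos rfl, hzc]
      ring
    · rw [(H.homogeneous y').hess_eq_zero (by omega), hzc]
      ring
  · exact absurd (Finset.mem_singleton_self z) hi

end PositivelyElliptic

/-! ### Generators of degrees `2, 2, 4, 4, 6` -/

namespace PositivelyElliptic

open MvPolynomial Ideal

variable {H : PositivelyElliptic}

namespace IsLift

variable {δ : Derivation ℚ H.Alg H.Alg} {r : ℤ}
  {D : Derivation ℚ (MvPolynomial (Fin H.k) ℚ) (MvPolynomial (Fin H.k) ℚ)} {z t t' : Fin H.k}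

/-- If a non-zero symmetric form on the two generators of degree four annihilates the linear part
of the derivation, then one of them is mapped to a multiple of the image of the other. -/
theorem apply_X_eq_C_mul_of_sum (hD : IsLift δ D) (ht : H.deg t = 4) (ht' : H.deg t' = 4)
    {m m' : ℚ} (hm : m' ≠ 0)
    (h : ∀ x, H.deg x = 2 → m * constantCoeff (pderiv x (D (X t))) +
      m' * constantCoeff (pderiv x (D (X t'))) = 0) :
    D (X t') = C (-(m / m')) * D (X t) := by
  have h1 : (D (X t)).IsWeightedHomogeneous H.deg 2 := by
    have := hD.homogeneous_X t
    rwa [ht] at this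
  have h2 : (D (X t')).IsWeightedHomogeneous H.deg 2 := by
    have := hD.homogeneous_X t'
    rwa [ht'] at this
  refine sub_eq_zero.1 (eq_zero_of_linear (h2.sub ?_) fun x hx => ?_)
  · have h3 := (isWeightedHomogeneous_C H.deg (-(m / m'))).mul h1
    rwa [zero_add] at h3
  · rw [map_sub, map_sub, pderiv_C_mul, map_mul, constantCoeff_C]
    have := h x hx
    field_simp
    linear_combination this

end IsLift

/-- The case of generators of degrees `2, 2, 4, 4, 6`. -/
theorem IsPureModel.lt_formalDim_of_two_two_four_four_six (hH : H.IsPureModel)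
    (hsplit : ¬ H.Splits) {δ : Derivation ℚ H.Alg H.Alg} (hδ : H.HasDegree δ (-2)) (hδ0 : δ ≠ 0)
    (hk : H.k = 5) (h₀ : H.deg ⟨0, by omega⟩ = 2) (h₁ : H.deg ⟨1, by omega⟩ = 2)
    (h₂ : H.deg ⟨2, by omega⟩ = 4) (h₃ : H.deg ⟨3, by omega⟩ = 4)
    (h₄ : H.deg ⟨4, by omega⟩ = 6) : 20 < H.formalDim := by
  by_contra! hfd
  obtain ⟨D, hD⟩ := hδ.exists_isLift
  have hr : (-2 : ℤ) < 0 := by norm_num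
  set x : Fin H.k := ⟨0, by omega⟩ with hx
  set x' : Fin H.k := ⟨1, by omega⟩ with hx'
  set y : Fin H.k := ⟨2, by omega⟩ with hy
  set y' : Fin H.k := ⟨3, by omega⟩ with hy'
  set z : Fin H.k := ⟨4, by omega⟩ with hz
  have hv : x.1 = 0 ∧ x'.1 = 1 ∧ y.1 = 2 ∧ y'.1 = 3 ∧ z.1 = 4 := ⟨rfl, rfl, rfl, rfl, rfl⟩
  have hall : ∀ i : Fin H.k, i = x ∨ i = x' ∨ i = y ∨ i = y' ∨ i = z := by
    intro i
    have := i.2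
    simp only [Fin.ext_iff, hx, hx', hy, hy', hz]
    omega
  have hsum : ∀ f : Fin H.k → ℕ, ∑ i, f i = f x + f x' + f y + f y' + f z := by
    have : ∀ (n : ℕ) (hn : n = 5) (f : Fin n → ℕ), ∑ i, f i = f ⟨0, by omega⟩ + f ⟨1, by omega⟩ +
        f ⟨2, by omega⟩ + f ⟨3, by omega⟩ + f ⟨4, by omega⟩ := by
      rintro n rfl f
      exact Fin.sum_univ_five f
    exact this H.k hk
  have hne : ∀ i ≠ z, H.deg i ≤ 4 := by
    intro i hi
    rcases hall i with rfl | rfl | rfl | rfl | rfl <;> omega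
  have hbound := H.sum_relDeg_le
  rw [hsum, hsum, h₀, h₁, h₂, h₃, h₄] at hbound
  have hm1 : H.relDeg x ≤ H.relDeg x' := hH.relDeg_mono (Fin.mk_le_mk.2 (by omega))
  have hm2 : H.relDeg x' ≤ H.relDeg y := hH.relDeg_mono (Fin.mk_le_mk.2 (by omega))
  have hm3 : H.relDeg y ≤ H.relDeg y' := hH.relDeg_mono (Fin.mk_le_mk.2 (by omega))
  have hm4 : H.relDeg y' ≤ H.relDeg z := hH.relDeg_mono (Fin.mk_le_mk.2 (by omega))
  have hb0 := hH.four_le_relDeg x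
  have hb1 : 6 ≤ H.relDeg x' := hH.six_le_relDeg hsplit (p := 1) (by omega) fun i => by
    rcases hall i with rfl | rfl | rfl | rfl | rfl <;> constructor <;> intro h <;> omega
  have hb2 := hH.two_mul_deg_le y
  have hb3 := hH.two_mul_deg_le y'
  obtain ⟨i₀, hi₀⟩ := hH.exists_hess_ne_zero h₄ fun i => by
    rcases hall i with rfl | rfl | rfl | rfl | rfl <;> omega
  have hi₀' := relDeg_eq_of_hess_ne_zero hi₀
  -- The lower bounds `4 + 6 + 8 + 8 + 12` already exhaust the permitted total `20 + 18`.
  have hbx : H.relDeg x = 4 ∧ H.relDeg x' = 6 ∧ H.relDeg y = 8 ∧ H.relDeg y' = 8 ∧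
      H.relDeg z = 12 := by
    rcases hall i₀ with rfl | rfl | rfl | rfl | rfl <;> omega
  obtain ⟨hbx, hbx', hby, hby', hbz⟩ := hbx
  -- A linear term of degree four in `D (X z)` would require a relation of degree ten.
  have hc : ∀ j, H.deg j = 4 → constantCoeff (pderiv j (D (X z))) = 0 := by
    intro j hj
    by_contra hcj
    obtain ⟨i₁, hi₁, -⟩ := exists_hess_rel_ne_zero hH (hD.mem (H.rel_mem i₀)) (a := z) (b := j) (by
      rw [hD.hess_apply_z hH h₄ hne (H.rel_mem i₀) hj]
      exact mul_ne_zero hi₀ hcj)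
    rcases hall i₁ with rfl | rfl | rfl | rfl | rfl <;> omega
  have hcase : ∀ a, H.deg a ≠ 2 → H.deg a = 4 ∨ a = z := by
    intro a ha
    rcases hall a with rfl | rfl | rfl | rfl | rfl
    exacts [absurd h₀ ha, absurd h₁ ha, Or.inl h₂, Or.inl h₃, Or.inr rfl]
  have hA2 : ∀ i, H.deg i = 2 → i ∈ ({x, x'} : Finset (Fin H.k)) := by
    intro i hi
    rcases hall i with rfl | rfl | rfl | rfl | rfl <;> first | simp; done | omega
  have hAcard : ({x, x'} : Finset (Fin H.k)).card ≤ 2 := Finset.card_le_two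
  have h8 : ∀ i, H.relDeg i = 8 → i = y ∨ i = y' := by
    intro i hi
    rcases hall i with rfl | rfl | rfl | rfl | rfl <;> omega
  -- the relations of degree eight have independent quadratic parts modulo the first generators
  have hindep : ∀ i j : Fin H.k, H.relDeg i = 8 → H.relDeg j = 8 → i ≠ j → ∀ κ : ℚ,
      ¬ ∀ a b, H.deg a = 4 → H.deg b = 4 → hess (H.rel i) a b = κ * hess (H.rel j) a b := by
    intro i j hi hj hij κ h
    have hBcard : ({j, z} : Finset (Fin H.k)).card ≤ 2 := Finset.card_le_two
    refine not_rel_mem_span_union (H := H) {x, x'} ∅ {j, z} ?_ (by simp) fun l hl => ?_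
    · rw [Finset.card_empty]
      omega
    have hlj : l ≠ j := fun h => hl (by simp [h])
    have hlz : l ≠ z := fun h => hl (by simp [h])
    have hJ : ∀ a, H.deg a = 2 → X a ∈ span (X '' (({x, x'} : Finset (Fin H.k)) : Set (Fin H.k)) ∪
      ((∅ : Finset (MvPolynomial (Fin H.k) ℚ)) : Set _) ∪
      H.rel '' (({j, z} : Finset (Fin H.k)) : Set (Fin H.k))) := fun a ha =>
      subset_span (Or.inl (Or.inl ⟨a, hA2 a ha, rfl⟩))
    by_cases hli : l = i
    · have hjJ : H.rel j ∈ span (X '' (({x, x'} : Finset (Fin H.k)) : Set (Fin H.k)) ∪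
          ((∅ : Finset (MvPolynomial (Fin H.k) ℚ)) : Set _) ∪
          H.rel '' (({j, z} : Finset (Fin H.k)) : Set (Fin H.k))) :=
        subset_span (Or.inr ⟨j, by simp, rfl⟩)
      have h8i := H.homogeneous i
      have h8j := (isWeightedHomogeneous_C H.deg (-κ)).mul (H.homogeneous j)
      rw [hi] at h8i
      rw [hj, zero_add] at h8j
      have h1 : H.rel i + C (-κ) * H.rel j ∈ _ := hH.mem_of_hess_eq_zero (h8i.add h8j)
        (add_mem (H.rel_mem i) (Ideal.mul_mem_left _ _ (H.rel_mem j))) (by norm_num) hJ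
        fun a ha b hb => by
          by_cases h8 : H.deg a + H.deg b = 8
          · have ha4 : H.deg a = 4 := by
              rcases hcase a ha with ha | rfl
              · exact ha
              · rcases hcase b hb with hb | rfl <;> omega
            rw [hess_add, hess_mul (hH.rel_mem_sq j), constantCoeff_C, h a b ha4 (by omega)]
            ring
          · exact (h8i.add h8j).hess_eq_zero h8
      rw [hli]
      have h2 := sub_mem h1 (Ideal.mul_mem_left _ (C (-κ)) hjJ)
      rwa [add_sub_cancel_right] at h2
    · have hl8 : H.relDeg l ≠ 8 := by
        intro hl8
        rcases h8 l hl8 with rfl | rfl <;> rcases h8 i hi with rfl | rfl <;>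
          rcases h8 j hj with rfl | rfl <;>
          first | exact hli rfl | exact hlj rfl | exact hij rfl
      have hlt : H.relDeg l < 8 := by
        rcases hall l with rfl | rfl | rfl | rfl | rfl <;> omega
      refine hH.mem_of_hess_eq_zero (H.homogeneous l) (H.rel_mem l) (by omega) hJ fun a ha b hb => ?_
      refine (H.homogeneous l).hess_eq_zero ?_
      rcases hcase a ha with ha | rfl <;> rcases hcase b hb with hb | rfl <;> omega
  set lin : Fin H.k → Fin H.k → ℚ := fun j a => constantCoeff (pderiv a (D (X j))) with hlin
  have hyy : y ≠ y' := fun h => by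
    have := congrArg Fin.val h
    omega
  have hsum4 : ∀ f : Fin H.k → ℚ, (∀ j, H.deg j ≠ 4 → f j = 0) → ∑ j, f j = f y + f y' := by
    intro f hf
    refine Finset.sum_eq_add y y' hyy (fun j _ hj => hf j ?_) (by simp) (by simp)
    rcases hall j with rfl | rfl | rfl | rfl | rfl <;> omega
  have hmat : ∀ i, ∃ γ : ℚ, ∀ a b, H.deg a = 4 → H.deg b = 2 →
      hess (H.rel i) a y * lin y b + hess (H.rel i) a y' * lin y' b = γ * hess (H.rel x') a b := by
    intro i
    obtain ⟨γ, hγ⟩ := exists_hess_eq_mul hH (hD.mem (H.rel_mem i)) (n := 6) (i := x') fun j hj => by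
      rcases hall j with rfl | rfl | rfl | rfl | rfl <;> first | rfl | omega
    refine ⟨γ, fun a b ha hb => ?_⟩
    rw [← hγ a b (by omega), hess_derivation D hD.constantCoeff_X (hH.rel_mem_sq i),
      Finset.sum_add_distrib, hD.sum_hess_mul_lin hne _ _ ha, hc a ha, mul_zero, add_zero, hsum4]
    intro j hj
    rw [hD.lin_eq_zero (by omega), mul_zero]
  obtain ⟨γ, hγ⟩ := hmat y
  obtain ⟨γ', hγ'⟩ := hmat y'
  -- `D` sends both relations of degree eight into degree six, where there is one relation to
  -- compare with. So a combination `M` of their quadratic forms annihilates the linear part of `D`;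
  -- `M` is non-zero by independence, and a non-zero row of it makes `D (X y)` and `D (X y')`
  -- proportional.
  obtain ⟨α, β, hαβ, hγγ⟩ : ∃ α β : ℚ, (α ≠ 0 ∨ β ≠ 0) ∧ α * γ + β * γ' = 0 := by
    by_cases h : γ = 0
    · exact ⟨1, 0, Or.inl one_ne_zero, by rw [h]; ring⟩
    · exact ⟨γ', -γ, Or.inr (neg_ne_zero.2 h), by ring⟩
  set M : Fin H.k → Fin H.k → ℚ := fun a b => α * hess (H.rel y) a b + β * hess (H.rel y') a b
    with hM
  obtain ⟨a, b, ha, hb, hab⟩ : ∃ a b, H.deg a = 4 ∧ H.deg b = 4 ∧ M a b ≠ 0 := by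
    by_contra! h
    rcases hαβ with hα | hβ
    · refine hindep y y' hby hby' hyy (-(β / α)) fun a b ha hb => ?_
      have := h a b ha hb
      simp only [hM] at this
      field_simp
      linear_combination this
    · refine hindep y' y hby' hby hyy.symm (-(α / β)) fun a b ha hb => ?_
      have := h a b ha hb
      simp only [hM] at this
      field_simp
      linear_combination this
  have hMl : ∀ l, H.deg l = 2 → M a y * lin y l + M a y' * lin y' l = 0 := by
    intro l hl
    simp only [hM]
    linear_combination α * hγ a l ha hl + β * hγ' a l ha hl + hess (H.rel x') a l * hγγ
  obtain ⟨t, t', ν, htt, ht, ht', hall', hν⟩ : ∃ (t t' : Fin H.k) (ν : ℚ), t ≠ t' ∧ H.deg t = 4 ∧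
      H.deg t' = 4 ∧ (∀ i, H.deg i = 4 → i = t ∨ i = t') ∧ D (X t') = C ν * D (X t) := by
    have hb' : b = y ∨ b = y' := by
      rcases hall b with rfl | rfl | rfl | rfl | rfl <;> omega
    have hall4 : ∀ i, H.deg i = 4 → i = y ∨ i = y' := by
      intro i hi
      rcases hall i with rfl | rfl | rfl | rfl | rfl <;> omega
    rcases hb' with rfl | rfl
    · exact ⟨y', y, _, hyy.symm, h₃, h₂, fun i hi => (hall4 i hi).symm,
        hD.apply_X_eq_C_mul_of_sum h₃ h₂ hab fun l hl => by
          have := hMl l hl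
          rwa [add_comm] at this⟩
    · exact ⟨y, y', _, hyy, h₂, h₃, hall4, hD.apply_X_eq_C_mul_of_sum h₂ h₃ hab hMl⟩
  set ρ : Fin H.k → ℚ := fun i => if i = t then 1 else if i = t' then ν else 0 with hρ_def
  have hρ : ∀ i ≠ z, D (X i) = C (ρ i) * D (X t) := by
    intro i hi
    simp only [hρ_def]
    split_ifs with h h'
    · rw [h, C_1, one_mul]
    · rw [h', hν]
    · rw [C_0, zero_mul]
      refine hD.apply_X_eq_zero i ?_
      by_contra h2
      rcases hcase i h2 with h4 | h4
      · rcases hall' i h4 with h5 | h5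
        · exact h h5
        · exact h' h5
      · exact hi h4
  have ht0 : D (X t) ≠ 0 := by
    obtain ⟨i, hi, h0⟩ := hD.exists_apply_X_ne_zero hδ hr hδ0 z
    rw [hρ i hi] at h0
    exact right_ne_zero_of_mul h0
  have hq : ∀ i, H.relDeg i = 8 → hess (H.rel i) t t + 2 * ν * hess (H.rel i) t' t +
      ν ^ 2 * hess (H.rel i) t' t' = 0 := by
    intro i hi
    have h1 := hD.sum_hess_eq_zero hH hδ hr hδ0 ht h₄ hne hρ ht0 hc (hi ▸ H.homogeneous i)
      (H.rel_mem i)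
    have hρt : ρ t = 1 := by simp [hρ_def]
    have hρt' : ρ t' = ν := by simp [hρ_def, htt.symm]
    have hρ0 : ∀ j, j ≠ t ∧ j ≠ t' → ρ j = 0 := fun j hj => by simp [hρ_def, hj.1, hj.2]
    rw [Finset.sum_eq_add t t' htt (fun j _ hj => by simp [hρ0 j hj]) (by simp) (by simp),
      Finset.sum_eq_add t t' htt (fun j _ hj => by simp [hρ0 j hj]) (by simp) (by simp),
      Finset.sum_eq_add t t' htt (fun j _ hj => by simp [hρ0 j hj]) (by simp) (by simp),
      hρt, hρt', hess_comm _ t t'] at h1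
    linear_combination h1
  -- The linear form on the generators of degree four that vanishes at `(1, ν)`. Both forms of
  -- degree eight vanish at this vector, so `s` divides them.
  set s : Fin H.k → ℚ := fun i => if i = t then -ν else if i = t' then 1 else 0 with hs
  have hst : s t = -ν := by simp [hs]
  have hst' : s t' = 1 := by simp [hs, htt.symm]
  have htz : t ≠ z := by
    rintro rfl
    omega
  have htz' : t' ≠ z := by
    rintro rfl
    omega
  have hsz : s z = 0 := by simp [hs, htz.symm, htz'.symm]
  refine not_rel_mem_span_union (H := H) {x, x'} {∑ a, C (s a) * X a} {z} ?_ ?_ fun i hi => ?_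
  · simp only [Finset.card_singleton]
    omega
  · intro e he
    rw [Finset.mem_singleton.1 he]
    exact constantCoeff_linear s
  have hJ : ∀ a, H.deg a = 2 → X a ∈ span (X '' (({x, x'} : Finset (Fin H.k)) : Set (Fin H.k)) ∪
      (({∑ a, C (s a) * X a} : Finset (MvPolynomial (Fin H.k) ℚ)) : Set _) ∪
      H.rel '' (({z} : Finset (Fin H.k)) : Set (Fin H.k))) := fun a ha =>
    subset_span (Or.inl (Or.inl ⟨a, hA2 a ha, rfl⟩))
  have hw : ∑ a, C (s a) * X a ∈ span (X '' (({x, x'} : Finset (Fin H.k)) : Set (Fin H.k)) ∪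
      (({∑ a, C (s a) * X a} : Finset (MvPolynomial (Fin H.k) ℚ)) : Set _) ∪
      H.rel '' (({z} : Finset (Fin H.k)) : Set (Fin H.k))) :=
    subset_span (Or.inl (Or.inr (by simp)))
  have hi8 : H.relDeg i ≤ 8 := by
    rcases hall i with rfl | rfl | rfl | rfl | rfl
    · omega
    · omega
    · omega
    · omega
    · exact absurd (Finset.mem_singleton_self z) hi
  by_cases hi8' : H.relDeg i = 8
  · have hqi := hq i hi8'
    -- The cofactor of `s`, read off from the `t' t` and `t' t'` entries; the `t t` entry then
    -- agrees by `hqi`.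
    set τ : Fin H.k → ℚ := fun j => if j = t then hess (H.rel i) t' t + ν * hess (H.rel i) t' t' / 2
      else if j = t' then hess (H.rel i) t' t' / 2 else 0 with hτ
    have hτt : τ t = hess (H.rel i) t' t + ν * hess (H.rel i) t' t' / 2 := by simp [hτ]
    have hτt' : τ t' = hess (H.rel i) t' t' / 2 := by simp [hτ, htt.symm]
    have hτz : τ z = 0 := by simp [hτ, htz.symm, htz'.symm]
    refine hH.mem_of_hess (H.homogeneous i) (H.rel_mem i) (by omega) hJ (s := s) (t := τ)
      (fun a ha b hb => ?_) hw
    have hcase' : ∀ a, H.deg a ≠ 2 → a = t ∨ a = t' ∨ a = z := by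
      intro a ha
      rcases hcase a ha with h | h
      · rcases hall' a h with h | h <;> simp [h]
      · simp [h]
    rcases hcase' a ha with rfl | rfl | rfl <;> rcases hcase' b hb with rfl | rfl | rfl
    · rw [hst, hτt]
      linear_combination hqi
    · rw [hst, hst', hτt, hτt', hess_comm]
      ring
    · rw [(H.homogeneous i).hess_eq_zero (by omega), hsz, hτz]
      ring
    · rw [hst, hst', hτt, hτt']
      ring
    · rw [hst', hτt']
      ring
    all_goals
      rw [(H.homogeneous i).hess_eq_zero (by omega), hsz, hτz]
      ring
  · refine hH.mem_of_hess_eq_zero (H.homogeneous i) (H.rel_mem i) (by omega) hJ fun a ha b hb => ?_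
    refine (H.homogeneous i).hess_eq_zero ?_
    rcases hcase a ha with ha | rfl <;> rcases hcase b hb with hb | rfl <;> omega

end PositivelyElliptic

/-! ### Reduction to the three families -/

namespace PositivelyElliptic

open MvPolynomial

variable {H : PositivelyElliptic}

theorem exists_card_deg_two (hH : H.IsPureModel) :
    ∃ p ≤ H.k, ∀ i : Fin H.k, H.deg i = 2 ↔ i.1 < p := by
  classical
  by_cases h : ∃ n, ∃ h : n < H.k, H.deg ⟨n, h⟩ ≠ 2
  · obtain ⟨hlt, hne⟩ := Nat.find_spec h
    refine ⟨Nat.find h, hlt.le, fun i => ⟨fun hi => ?_, fun hi => ?_⟩⟩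
    · by_contra! hle
      have h1 : H.deg ⟨Nat.find h, hlt⟩ ≤ H.deg i := hH.deg_mono (Fin.le_def.2 hle)
      have h2 := H.two_le_deg ⟨Nat.find h, hlt⟩
      omega
    · have := Nat.find_min h hi
      push Not at this
      exact this i.2
  · push Not at h
    exact ⟨H.k, le_rfl, fun i => ⟨fun _ => i.2, fun _ => h i.1 i.2⟩⟩

/-- A derivation of negative degree can only be non-zero if it has degree `-2` and the last two
generators have degrees `4` and `6`. -/
theorem HasDegree.degrees {δ : Derivation ℚ H.Alg H.Alg} {r : ℤ} (hδ : H.HasDegree δ r) (hr : r < 0)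
    (hδ0 : δ ≠ 0) (hH : H.IsPureModel) (hk : 2 ≤ H.k)
    (hdeg : H.deg ⟨H.k - 2, by omega⟩ + H.deg ⟨H.k - 1, by omega⟩ = 10) :
    r = -2 ∧ H.deg ⟨H.k - 2, by omega⟩ = 4 ∧ H.deg ⟨H.k - 1, by omega⟩ = 6 := by
  have hle : H.deg ⟨H.k - 2, by omega⟩ ≤ H.deg ⟨H.k - 1, by omega⟩ :=
    hH.deg_mono (Fin.mk_le_mk.2 (by omega))
  obtain ⟨a, ha⟩ := H.deg_even ⟨H.k - 2, by omega⟩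
  obtain ⟨b, hb⟩ := H.deg_even ⟨H.k - 1, by omega⟩
  have h2 := H.two_le_deg ⟨H.k - 2, by omega⟩
  by_contra! hcon
  -- In the excluded cases every generator but the last goes to degree at most zero, or the degree
  -- of `δ` is odd; so `δ` is supported on one generator.
  refine hδ0 (hδ.eq_zero_of_forall_ne hr ⟨H.k - 1, by omega⟩ fun i hi => hδ.apply_X_eq_zero ?_)
  have hi1 : H.deg i ≤ H.deg ⟨H.k - 2, by omega⟩ := by
    refine hH.deg_mono (Fin.le_def.2 ?_)
    have h3 : i.1 ≠ H.k - 1 := fun h => hi (Fin.ext h)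
    have := i.2
    simp only
    omega
  rcases Int.even_or_odd r with ⟨c, hc⟩ | hodd
  · left
    by_cases h4 : a = 2
    · have : r ≠ -2 := fun h => hcon h (by omega) (by omega)
      omega
    · omega
  · exact Or.inr hodd

end PositivelyElliptic

theorem proposition4p2 (H : PositivelyElliptic) (hpure : H.IsPureModel) (hsplit : ¬ H.Splits)
    (hder : ∃ δ : Derivation ℚ H.Alg H.Alg, δ ≠ 0 ∧ ∃ r : ℤ, r < 0 ∧ H.HasDegree δ r)
    (hk : 2 ≤ H.k)
    (hdeg : H.deg ⟨H.k - 2, by omega⟩ + H.deg ⟨H.k - 1, by omega⟩ = 10) :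
    20 < H.formalDim ∨
      (List.ofFn H.deg = [2, 2, 2, 4, 6] ∧ List.ofFn H.relDeg = [4, 4, 6, 10, 12]) := by
  left
  obtain ⟨δ, hδ0, r, hr, hδ⟩ := hder
  obtain ⟨rfl, ht, hz⟩ := hδ.degrees hr hδ0 hpure hk hdeg
  obtain ⟨p, hpk, hp⟩ := PositivelyElliptic.exists_card_deg_two hpure
  have hmid : ∀ i : Fin H.k, p ≤ i.1 → i.1 < H.k - 1 → H.deg i = 4 := by
    intro i hi hi'
    have h1 : H.deg i ≤ H.deg ⟨H.k - 2, by omega⟩ :=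
      hpure.deg_mono (Fin.le_def.2 (by simp only; omega))
    have h2 : H.deg i ≠ 2 := fun h => by
      have := (hp i).1 h
      omega
    have h3 := H.two_le_deg i
    obtain ⟨a, ha⟩ := H.deg_even i
    omega
  have hpk2 : p ≤ H.k - 2 := by
    by_contra! h
    have := (hp ⟨H.k - 2, by omega⟩).2 h
    omega
  -- Without generators of degree two there are no non-zero elements of degree two to receive a
  -- generator of degree four.
  have hp0 : p ≠ 0 := by
    rintro rfl
    obtain ⟨D, hD⟩ := hδ.exists_isLift
    obtain ⟨t, htz, ht0⟩ := hD.exists_apply_X_ne_zero hδ hr hδ0 ⟨H.k - 1, by omega⟩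
    have h1 : H.deg t = 4 := hmid t (Nat.zero_le _) (by
      have h2 : t.1 ≠ H.k - 1 := fun h => htz (Fin.ext h)
      have := t.2
      omega)
    have h2 := hD.homogeneous_X t
    rw [h1] at h2
    exact ht0 (PositivelyElliptic.eq_zero_of_linear h2 fun i hi => absurd ((hp i).1 hi) (Nat.not_lt_zero _))
  by_contra! hfd
  have hp1 : 6 ≤ H.relDeg ⟨p - 1, by omega⟩ := hpure.six_le_relDeg hsplit (p := p - 1) (by omega)
    fun i => by rw [hp i]; omega
  have hsum := H.sum_relDeg_le
  have hdegsum : ∑ i, H.deg i + 2 * p = 4 * H.k + 2 := by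
    have h1 : ∀ i : Fin H.k, H.deg i + (if i.1 < p then 2 else 0) =
        4 + if i = ⟨H.k - 1, by omega⟩ then 2 else 0 := by
      intro i
      by_cases hi : i.1 < p
      · rw [if_pos hi, (hp i).2 hi, if_neg]
        rintro rfl
        simp only at hi
        omega
      · rw [if_neg hi]
        by_cases hi' : i = ⟨H.k - 1, by omega⟩
        · rw [hi', hz, if_pos rfl]
        · rw [if_neg hi', hmid i (by omega)]
          have h2 : i.1 ≠ H.k - 1 := fun h => hi' (Fin.ext h)
          have := i.2
          omega
    have h2 := Finset.sum_congr (rfl : (Finset.univ : Finset (Fin H.k)) = _) fun i _ => h1 i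
    rw [Finset.sum_add_distrib, Finset.sum_add_distrib, ← Finset.sum_filter, Finset.sum_const,
      Finset.sum_const, Finset.sum_ite_eq', if_pos (Finset.mem_univ _), Finset.card_univ,
      Fintype.card_fin, Fin.card_filter_val_lt, min_eq_right hpk] at h2
    simp only [smul_eq_mul] at h2
    omega
  -- The extra `2` comes from the relation at index `p - 1`, whose degree is at least six while its
  -- generator has degree two.
  have hrelsum : 2 * ∑ i, H.deg i + 2 ≤ ∑ i, H.relDeg i := by
    rw [Finset.mul_sum, ← Finset.add_sum_erase _ (fun i => 2 * H.deg i)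
      (Finset.mem_univ (⟨p - 1, by omega⟩ : Fin H.k)), ← Finset.add_sum_erase _ H.relDeg
      (Finset.mem_univ (⟨p - 1, by omega⟩ : Fin H.k)), (hp ⟨p - 1, by omega⟩).2 (by simp only; omega)]
    have := Finset.sum_le_sum fun i (_ : i ∈ Finset.univ.erase (⟨p - 1, by omega⟩ : Fin H.k)) =>
      hpure.two_mul_deg_le i
    omega
  -- The bounds give `∑ |x_i| ≤ 18`, that is `2 * k - p ≤ 8`, with `1 ≤ p ≤ k - 2`.
  rcases (show H.k = p + 2 ∨ (p = 1 ∧ H.k = 4) ∨ (p = 2 ∧ H.k = 5) by omega) with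
    hkp | ⟨rfl, hk4⟩ | ⟨rfl, hk5⟩
  · exact hfd.not_gt (hpure.lt_formalDim_of_single hsplit hδ hδ0 (by omega)
      (fun i hi => (hp i).2 (by omega)) ht hz)
  · refine hfd.not_gt (hpure.lt_formalDim_of_two_four_four_six hsplit hδ hδ0 hk4 ((hp _).2 (by simp))
      (hmid _ (by simp) (by simp only; omega)) (hmid _ (by simp) (by simp only; omega)) ?_)
    rw [← hz]
    congr 2
    omega
  · refine hfd.not_gt (hpure.lt_formalDim_of_two_two_four_four_six hsplit hδ hδ0 hk5
      ((hp _).2 (by simp)) ((hp _).2 (by simp)) (hmid _ (by simp) (by simp only; omega))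
      (hmid _ (by simp) (by simp only; omega)) ?_)
    rw [← hz]
    congr 2
    omega
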